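/- In the Joint Replenishment Problem (JRP) we are given $n$ items with item costs $c(v)\ge 0$, a joint service cost $c(r)\ge 0$ (the leaf costs and the root cost of a two-level tree), a holding cost rate $h\ge 0$ and a backlog cost rate $b>0$. There is a finite sequence of requests $\rho=(v_\rho,a_\rho,d_\rho)$, each for one unit of the item $v_\rho$, with arrival time $a_\rho$ and soft deadline $d_\rho\ge a_\rho$. A service takes place at some time, includes a set $U$ of items, costs $c(r)+\sum_{v\in U}c(v)$, and satisfies an arbitrary set of arrived, as yet unsatisfied requests for items in $U$. A request $\rho$ that is satisfied at time $t\ge a_\rho$ incurs the holding cost $h\,(d_\rho-t)$ if $t\le d_\rho$ and the backlog cost $b\,(t-d_\rho)$ if $t>d_\rho$. Every request must be satisfied; the total cost is the sum of all service, holding and backlog costs. In Online JRP the numbers $n$, $c$, $h$, $b$ are known in advance, and at each time $t$ only the requests with arrival time at most $t$ are known; not even the total number of requests is known. Theorem. There is a deterministic polynomial-time $30$-competitive online algorithm for Online JRP with backlog and holding costs: for every instance, it satisfies all requests, at a total cost of at most $30$ times the cost of any offline solution, and the number of its elementary operations (exact arithmetic operations and comparisons on real numbers, where multiplication and division are only by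 natural numbers and numbers of the input, and random access machine operations on natural numbers) is bounded by a polynomial in the number of items and the number of requests. -/

import Mathlib

/-! # Online joint replenishment with holding and backlog costs -/

namespace JRP

noncomputable section

/-! ## The problem -/

/-- The data known in advance: a two-level tree whose root has cost `jointCost` and whose leaves,
the `n` items, have costs `itemCost v`, together with the uniform rates of the holding cost and of
the backlog cost (per unit of demand and of time). -/
structure Model (n : ℕ) where
  jointCost : ℝ
  itemCost : Fin n → ℝ
  holdRate : ℝ
  backRate : ℝ
  jointCost_nonneg : 0 ≤ jointCost
  itemCost_nonneg : ∀ v, 0 ≤ itemCost v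
  holdRate_nonneg : 0 ≤ holdRate
  backRate_pos : 0 < backRate

/-- A request `(v, a, d)` for one unit of the item `v`, with arrival time `a` and (soft)
deadline `d ≥ a`. -/
structure Request (n : ℕ) where
  item : Fin n
  arrival : ℝ
  deadline : ℝ
  arrival_le_deadline : arrival ≤ deadline

/-- Requests are presented in the order of their arrival (simultaneous ones in any order).
A request is named by its position `0, 1, …` in this list. -/
def InArrivalOrder {n : ℕ} (rs : List (Request n)) : Prop :=
  rs.Pairwise fun r r' => r.arrival ≤ r'.arrival

/-- A service: the time when it takes place, the items that it includes (besides the root), and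
the requests, given by their positions, that it satisfies. -/
structure Service (n : ℕ) where
  time : ℝ
  items : Finset (Fin n)
  served : Finset ℕ

/-- A solution: the list of all services. -/
abbrev Schedule (n : ℕ) := List (Service n)

/-- The holding or backlog cost of a request that is satisfied at time `t`. -/
def Model.delayCost {n : ℕ} (M : Model n) (r : Request n) (t : ℝ) : ℝ :=
  if t ≤ r.deadline then M.holdRate * (r.deadline - t) else M.backRate * (t - r.deadline)

/-- The total cost of one service: joint cost, costs of the included items, and holding and backlog
costs of the requests it satisfies. -/
def Model.serviceCost {n : ℕ} (M : Model n) (rs : List (Request n)) (s : Service n) : ℝ :=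
  M.jointCost + ∑ v ∈ s.items, M.itemCost v +
    ∑ i ∈ s.served, (match rs[i]? with
      | some r => M.delayCost r s.time
      | none => 0)

/-- The total cost of a schedule. -/
def Model.cost {n : ℕ} (M : Model n) (rs : List (Request n)) (S : Schedule n) : ℝ :=
  (S.map (M.serviceCost rs)).sum

open scoped Classical in
/-- A schedule is feasible for `rs` if services satisfy only requests for items that they include,
not before their arrival, and each request is satisfied exactly once. -/
def Feasible {n : ℕ} (rs : List (Request n)) (S : Schedule n) : Prop :=
  (∀ s ∈ S, ∀ i ∈ s.served, ∃ r, rs[i]? = some r ∧ r.item ∈ s.items ∧ r.arrival ≤ s.time) ∧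
  ∀ i < rs.length, S.countP (fun s => decide (i ∈ s.served)) = 1

/-! ## Deterministic online algorithms -/

/-- A deterministic algorithm, seen as a map from instances to schedules. -/
abbrev Algorithm := ∀ n : ℕ, Model n → List (Request n) → Schedule n

open scoped Classical in
/-- The requests that are known at time `t`. -/
def known {n : ℕ} (rs : List (Request n)) (t : ℝ) : List (Request n) :=
  rs.filter fun r => decide (r.arrival ≤ t)

open scoped Classical in
/-- The services that a schedule carries out up to time `t`. -/
def servicesUpTo {n : ℕ} (S : Schedule n) (t : ℝ) : List (Service n) :=
  S.filter fun s => decide (s.time ≤ t)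

/-- An algorithm is online if, at each time `t`, what it has done up to time `t` depends only on the
requests with arrival time at most `t` (and on the data known in advance): nothing else about the
requests, not even their number, influences it. -/
def IsOnline (A : Algorithm) : Prop :=
  ∀ (n : ℕ) (M : Model n) (rs rs' : List (Request n)),
    InArrivalOrder rs → InArrivalOrder rs' → ∀ t : ℝ, known rs t = known rs' t →
      servicesUpTo (A n M rs) t = servicesUpTo (A n M rs') t

/-- An algorithm is `κ`-competitive if on every instance it gives a feasible schedule, of cost at
most `κ` times the cost of any feasible (offline) schedule. -/
def IsCompetitive (κ : ℝ) (A : Algorithm) : Prop :=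
  ∀ (n : ℕ) (M : Model n) (rs : List (Request n)), InArrivalOrder rs →
    Feasible rs (A n M rs) ∧
    ∀ S : Schedule n, Feasible rs S → M.cost rs (A n M rs) ≤ κ * M.cost rs S

/-! ## The machine model: a random access machine with natural and real registers

The registers are organized in arrays, which are named by natural numbers (a program mentions only
finitely many of them). The input can be read with random access but not changed. There are no real
constants, no rounding, and no equality or order tests other than the exact comparisons below.

Natural numbers can be added and subtracted (truncated at `0`). Real numbers can be added,
subtracted and compared, but they can be multiplied and divided only by a natural number or by a
number of the input. So, on rational inputs, every number computed in `T` steps has a numerator and a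
denominator of length polynomial in `T` and the length of the input, and counting steps agrees with
counting bit operations, up to a polynomial. -/

/-- Expressions for natural numbers. -/
inductive NExp where
  | const (k : ℕ)
  /-- the number of items -/
  | numItems
  /-- the number of requests -/
  | numRequests
  /-- the item of the `e`-th request -/
  | item (e : NExp)
  /-- the entry `e` of the array `x` of natural numbers -/
  | get (x : ℕ) (e : NExp)
  | add (e₁ e₂ : NExp)
  | sub (e₁ e₂ : NExp)

/-- Natural numbers and numbers of the input, as real numbers. -/
inductive Atom where
  | nat (e : NExp)
  | jointCost
  | itemCost (e : NExp)
  | holdRate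
  | backRate
  | arrival (e : NExp)
  | deadline (e : NExp)

/-- Expressions for real numbers. -/
inductive RExp where
  | atom (q : Atom)
  /-- the entry `e` of the array `x` of real numbers -/
  | get (x : ℕ) (e : NExp)
  | add (e₁ e₂ : RExp)
  | sub (e₁ e₂ : RExp)
  | mul (e : RExp) (q : Atom)
  | div (e : RExp) (q : Atom)

/-- Tests. -/
inductive Test where
  | nle (e₁ e₂ : NExp)
  | rle (e₁ e₂ : RExp)
  | neg (c : Test)
  | and (c₁ c₂ : Test)

/-- Programs. -/
inductive Prog where
  | skip
  /-- store the value of `e` as entry `i` of the array `x` of natural numbers -/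
  | setNat (x : ℕ) (i e : NExp)
  /-- store the value of `e` as entry `i` of the array `x` of real numbers -/
  | setReal (x : ℕ) (i : NExp) (e : RExp)
  /-- output a new service at time `e`, so far without items and requests -/
  | newService (e : RExp)
  /-- include the item `e` in the service that was output last -/
  | addItem (e : NExp)
  /-- let the service that was output last satisfy the request `e` -/
  | serve (e : NExp)
  | seq (p q : Prog)
  | ite (c : Test) (p q : Prog)
  | while (c : Test) (p : Prog)

/-- The contents of the registers and the services output so far, the last one first. -/
structure State (n : ℕ) where
  nmem : ℕ → ℕ → ℕ
  rmem : ℕ → ℕ → ℝ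
  out : Schedule n

/-- All registers are `0` and nothing has been output. -/
def State.init (n : ℕ) : State n := ⟨fun _ _ => 0, fun _ _ => 0, []⟩

section Semantics

variable {n : ℕ} (M : Model n) (rs : List (Request n))

def NExp.eval (σ : State n) : NExp → ℕ
  | const k => k
  | numItems => n
  | numRequests => rs.length
  | item e => match rs[e.eval σ]? with
      | some r => r.item
      | none => 0
  | get x e => σ.nmem x (e.eval σ)
  | add e₁ e₂ => e₁.eval σ + e₂.eval σ
  | sub e₁ e₂ => e₁.eval σ - e₂.eval σ

def Atom.eval (σ : State n) : Atom → ℝ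
  | nat e => (e.eval rs σ : ℝ)
  | jointCost => M.jointCost
  | itemCost e => if hv : e.eval rs σ < n then M.itemCost ⟨e.eval rs σ, hv⟩ else 0
  | holdRate => M.holdRate
  | backRate => M.backRate
  | arrival e => match rs[e.eval rs σ]? with
      | some r => r.arrival
      | none => 0
  | deadline e => match rs[e.eval rs σ]? with
      | some r => r.deadline
      | none => 0

def RExp.eval (σ : State n) : RExp → ℝ
  | atom q => q.eval M rs σ
  | get x e => σ.rmem x (e.eval rs σ)
  | add e₁ e₂ => e₁.eval σ + e₂.eval σ
  | sub e₁ e₂ => e₁.eval σ - e₂.eval σ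
  | mul e q => e.eval σ * q.eval M rs σ
  | div e q => e.eval σ / q.eval M rs σ

def Test.Holds (σ : State n) : Test → Prop
  | nle e₁ e₂ => e₁.eval rs σ ≤ e₂.eval rs σ
  | rle e₁ e₂ => e₁.eval M rs σ ≤ e₂.eval M rs σ
  | neg c => ¬ c.Holds σ
  | and c₁ c₂ => c₁.Holds σ ∧ c₂.Holds σ

/-- Replace the entry `i` of the array `x`. -/
def store {α : Type} (mem : ℕ → ℕ → α) (x i : ℕ) (a : α) : ℕ → ℕ → α :=
  Function.update mem x (Function.update (mem x) i a)

/-- Apply `f` to the service that was output last (if there is one). -/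
def modifyLast (f : Service n → Service n) : Schedule n → Schedule n
  | [] => []
  | s :: S => f s :: S

/-- Include item number `k` (if there is one) in a service. -/
def Service.addItem (k : ℕ) (s : Service n) : Service n :=
  if hk : k < n then { s with items := insert ⟨k, hk⟩ s.items } else s

/-- Let a service satisfy request number `i`. -/
def Service.serve (i : ℕ) (s : Service n) : Service n :=
  { s with served := insert i s.served }

/-- `Exec M rs p σ T σ'`: on the input `M, rs`, the program `p` started in the state `σ` halts after
`T` steps in the state `σ'`. Each assignment, output, test and `skip` is one step; since the
expressions in a program have fixed sizes, counting the single operations in them instead would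
change the number of steps by at most a constant factor. -/
inductive Exec : Prog → State n → ℕ → State n → Prop where
  | skip (σ : State n) : Exec .skip σ 1 σ
  | setNat (x : ℕ) (i e : NExp) (σ : State n) :
      Exec (.setNat x i e) σ 1 { σ with nmem := store σ.nmem x (i.eval rs σ) (e.eval rs σ) }
  | setReal (x : ℕ) (i : NExp) (e : RExp) (σ : State n) :
      Exec (.setReal x i e) σ 1 { σ with rmem := store σ.rmem x (i.eval rs σ) (e.eval M rs σ) }
  | newService (e : RExp) (σ : State n) :
      Exec (.newService e) σ 1 { σ with out := ⟨e.eval M rs σ, ∅, ∅⟩ :: σ.out }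
  | addItem (e : NExp) (σ : State n) :
      Exec (.addItem e) σ 1 { σ with out := modifyLast (Service.addItem (e.eval rs σ)) σ.out }
  | serve (e : NExp) (σ : State n) :
      Exec (.serve e) σ 1 { σ with out := modifyLast (Service.serve (e.eval rs σ)) σ.out }
  | seq {p q : Prog} {σ₁ σ₂ σ₃ : State n} {T₁ T₂ : ℕ} :
      Exec p σ₁ T₁ σ₂ → Exec q σ₂ T₂ σ₃ → Exec (.seq p q) σ₁ (T₁ + T₂) σ₃
  | iteTrue {c : Test} {p q : Prog} {σ σ' : State n} {T : ℕ} :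
      c.Holds M rs σ → Exec p σ T σ' → Exec (.ite c p q) σ (T + 1) σ'
  | iteFalse {c : Test} {p q : Prog} {σ σ' : State n} {T : ℕ} :
      ¬ c.Holds M rs σ → Exec q σ T σ' → Exec (.ite c p q) σ (T + 1) σ'
  | whileTrue {c : Test} {p : Prog} {σ₁ σ₂ σ₃ : State n} {T₁ T₂ : ℕ} :
      c.Holds M rs σ₁ → Exec p σ₁ T₁ σ₂ → Exec (.while c p) σ₂ T₂ σ₃ →
        Exec (.while c p) σ₁ (T₁ + T₂ + 1) σ₃
  | whileFalse {c : Test} {p : Prog} {σ : State n} :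
      ¬ c.Holds M rs σ → Exec (.while c p) σ 1 σ

/-- Programs are deterministic: result and number of steps are determined by the start. -/
theorem Exec.deterministic {p : Prog} {σ σ₁ σ₂ : State n} {T₁ T₂ : ℕ}
    (h₁ : Exec M rs p σ T₁ σ₁) (h₂ : Exec M rs p σ T₂ σ₂) : T₁ = T₂ ∧ σ₁ = σ₂ := by
  induction h₁ generalizing T₂ σ₂ with
  | skip | setNat | setReal | newService | addItem | serve => cases h₂; exact ⟨rfl, rfl⟩
  | seq _ _ ih₁ ih₂ =>
    cases h₂ with
    | seq g₁ g₂ =>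
      obtain ⟨rfl, rfl⟩ := ih₁ g₁
      obtain ⟨rfl, rfl⟩ := ih₂ g₂
      exact ⟨rfl, rfl⟩
  | iteTrue hc _ ih =>
    cases h₂ with
    | iteTrue _ g => obtain ⟨rfl, rfl⟩ := ih g; exact ⟨rfl, rfl⟩
    | iteFalse hn _ => exact absurd hc hn
  | iteFalse hc _ ih =>
    cases h₂ with
    | iteTrue hn _ => exact absurd hn hc
    | iteFalse _ g => obtain ⟨rfl, rfl⟩ := ih g; exact ⟨rfl, rfl⟩
  | whileTrue hc _ _ ih₁ ih₂ =>
    cases h₂ with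
    | whileTrue _ g₁ g₂ =>
      obtain ⟨rfl, rfl⟩ := ih₁ g₁
      obtain ⟨rfl, rfl⟩ := ih₂ g₂
      exact ⟨rfl, rfl⟩
    | whileFalse hn => exact absurd hc hn
  | whileFalse hc =>
    cases h₂ with
    | whileTrue hn _ _ => exact absurd hn hc
    | whileFalse _ => exact ⟨rfl, rfl⟩

end Semantics

/-- An algorithm runs in polynomial time if one program computes its schedules, within a number of
steps that is bounded by a polynomial in the number of items and the number of requests. (For an
online algorithm, run on the requests known at time `t`, this program also gives the decisions up to
time `t` on every continuation of the input, so that each decision takes polynomial time in what is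
known when it is made.) -/
def IsPolynomialTime (A : Algorithm) : Prop :=
  ∃ (P : Prog) (f : Polynomial ℕ), ∀ (n : ℕ) (M : Model n) (rs : List (Request n)),
    InArrivalOrder rs → ∃ (T : ℕ) (σ : State n),
      Exec M rs P (State.init n) T σ ∧ T ≤ f.eval (n + rs.length) ∧ σ.out = A n M rs

end

end JRP

namespace JRP

noncomputable section

/-! ## Thresholds -/

/-! The algorithm `replenish` waits until some set of pending requests has accumulated backlog cost
equal to the joint cost plus the costs of their items (`trig`). At that time it includes every
mature item, meaning an item whose own overdue requests have backlog cost at least the item cost,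
and further items in the order of their future maturity times, up to total cost equal to the joint
cost. It satisfies all overdue requests of the included items. Requests that are not yet due are
taken in deadline order under two separate holding budgets: the item cost for each item, and the
joint cost for all included items together. Every part of such a service is bounded by a budget, so
it costs at most 6 joint costs plus 3 times the costs of its mature items (`service_cost_le`).

The lower bound on an offline solution rests on `backlog_or_holding`. Suppose that the offline
solution satisfies nothing relevant between an online service and a later time T. If the requests
falling due in between do not all pay their backlog cost at T, some cheap request j was satisfied
before the interval. It was present at the online service and was passed over, so the holding budget
was exceeded by the requests up to its deadline. Each of these pays at least its share of that
budget: by holding if it is satisfied early, and otherwise by a backlog cost that exceeds the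
holding cost of j.

Applied to one item between consecutive services of it, this gives `item_charge`, and hence
`mature_charge`: the cost of the mature items is paid by offline item costs and delays. For the
joint cost (`joint_charge`) there are three cases. The offline solution has a service between
consecutive online services. Or an item left out at the first one matures by the second; then the
items maturing no later than it cost more than the joint cost in total and can each be charged
(`premature_charge`). Or no left out item matures; then the joint cost within the trigger condition
must come from included items or new requests, and the joint holding budget applies
(`surplus_charge`). By `Next.unique`, each offline item cost is charged at one service only. A delay
cost is charged at most 2 times for mature items and 4 times for joint costs. The result is 6 for
joint costs, 6 + 3 for item costs and 6·4 + 3·2 = 30 for delay costs.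

The trigger minimum over all subsets reduces to one over the initial segments of a single order
(`trig_le_iff`), which makes it computable in polynomial time. The algorithm is online because a
request with deadline after t cannot cause a service at time t (`TrigBy.filter`). -/

/-- The elements of `S` whose initial segment with respect to `key` has weight at most `B` have total
weight at most `B`. -/
theorem sum_threshold_le {α : Type*} (S : Finset α) (key w : α → ℝ) (B : ℝ) (hB : 0 ≤ B)
    (hw : ∀ x ∈ S, 0 ≤ w x) :
    ∑ x ∈ S with ∑ y ∈ S with key y ≤ key x, w y ≤ B, w x ≤ B := by
  rcases (S.filter fun x => ∑ y ∈ S with key y ≤ key x, w y ≤ B).eq_empty_or_nonempty with h | h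
  · rw [h]; simpa using hB
  -- The selected element with the largest key: its initial segment has weight at most B and
  -- contains all selected elements.
  · obtain ⟨x, hx, hmax⟩ := Finset.exists_max_image _ key h
    rw [Finset.mem_filter] at hx
    refine le_trans (Finset.sum_le_sum_of_subset_of_nonneg ?_ ?_) hx.2
    · intro y hy
      exact Finset.mem_filter.2 ⟨(Finset.mem_filter.1 hy).1, hmax y hy⟩
    · intro y hy _
      exact hw y (Finset.mem_filter.1 hy).1

/-! ## Instances indexed by natural numbers -/

/-- An instance of the joint replenishment problem, with items and requests named by natural
numbers. -/
structure Inst where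
  joint : ℝ
  cost : ℕ → ℝ
  hold : ℝ
  back : ℝ
  item : ℕ → ℕ
  arr : ℕ → ℝ
  dl : ℕ → ℝ
  joint_nonneg : 0 ≤ joint
  cost_nonneg : ∀ v, 0 ≤ cost v
  hold_nonneg : 0 ≤ hold
  back_pos : 0 < back
  arr_le_dl : ∀ j, arr j ≤ dl j

namespace Inst

variable (D : Inst)

/-- The holding or backlog cost of request `j` if it is satisfied at time `t`. -/
def delay (j : ℕ) (t : ℝ) : ℝ :=
  if t ≤ D.dl j then D.hold * (D.dl j - t) else D.back * (t - D.dl j)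

theorem delay_nonneg (j : ℕ) (t : ℝ) : 0 ≤ D.delay j t := by
  unfold delay
  split_ifs with h
  · exact mul_nonneg D.hold_nonneg (by linarith)
  · exact mul_nonneg D.back_pos.le (by linarith)

theorem delay_of_le {j : ℕ} {t : ℝ} (h : D.dl j ≤ t) : D.delay j t = D.back * (t - D.dl j) := by
  unfold delay
  split_ifs with h'
  · rw [le_antisymm h h']; simp
  · rfl

theorem delay_of_ge {j : ℕ} {t : ℝ} (h : t ≤ D.dl j) : D.delay j t = D.hold * (D.dl j - t) :=
  if_pos h

theorem backlog_le_delay {j : ℕ} {t o : ℝ} (h : D.dl j ≤ t) (ho : t ≤ o) :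
    D.back * (t - D.dl j) ≤ D.delay j o := by
  rw [D.delay_of_le (h.trans ho)]
  exact mul_le_mul_of_nonneg_left (by linarith) D.back_pos.le

theorem holding_le_delay {j : ℕ} {t o : ℝ} (h : t ≤ D.dl j) (ho : o ≤ t) :
    D.hold * (D.dl j - t) ≤ D.delay j o := by
  rw [D.delay_of_ge (ho.trans h)]
  exact mul_le_mul_of_nonneg_left (by linarith) D.hold_nonneg

/-! ## Maturity times -/

/-- The items of the requests in `P`. -/
def itemsOf (P : Finset ℕ) : Finset ℕ := P.image D.item

/-- The requests in `P` for the item `v`. -/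
def ofItem (P : Finset ℕ) (v : ℕ) : Finset ℕ := P.filter fun i => D.item i = v

/-- The requests in `P` for the item of `j` with a deadline not after that of `j`. -/
def upto (P : Finset ℕ) (j : ℕ) : Finset ℕ :=
  P.filter fun i => D.item i = D.item j ∧ D.dl i ≤ D.dl j

/-- The time when the requests in `upto P j` reach a total backlog cost equal to the item cost. -/
def cand (P : Finset ℕ) (j : ℕ) : ℝ :=
  (D.cost (D.item j) / D.back + ∑ i ∈ D.upto P j, D.dl i) / ((D.upto P j).card : ℝ)

/-- The time when the item `v` becomes mature, if the requests in `P` remain unsatisfied. -/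
def tau (P : Finset ℕ) (v : ℕ) : ℝ :=
  if h : (D.ofItem P v).Nonempty then (D.ofItem P v).inf' h (D.cand P) else 0

/-- The time when request `j` is overdue and its item is mature. -/
def key (P : Finset ℕ) (j : ℕ) : ℝ := max (D.dl j) (D.tau P (D.item j))

/-- The time when the total backlog cost of the requests `i` with `key P i ≤ key P j` pays for the
service of their items. -/
def cross (P : Finset ℕ) (j : ℕ) : ℝ :=
  ((D.joint + ∑ v ∈ D.itemsOf P with D.tau P v ≤ D.key P j, D.cost v) / D.back +
    ∑ i ∈ P with D.key P i ≤ D.key P j, D.dl i) / ((P.filter fun i => D.key P i ≤ D.key P j).card : ℝ)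

/-- The time of the next service, if the requests in `P` are pending and nothing else arrives. -/
def trig (P : Finset ℕ) : ℝ := if h : P.Nonempty then P.inf' h (D.cross P) else 0

/-- At time `t`, the backlog cost of some requests in `P` pays for the service of their items. -/
def TrigBy (P : Finset ℕ) (t : ℝ) : Prop :=
  ∃ X ⊆ P, X.Nonempty ∧ D.joint + ∑ v ∈ X.image D.item, D.cost v ≤ ∑ j ∈ X, D.back * (t - D.dl j)

/-- The mature items at time `t`. -/
def mature (P : Finset ℕ) (t : ℝ) : Finset ℕ := (D.itemsOf P).filter fun v => D.tau P v ≤ t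

variable {D}

theorem sum_back (X : Finset ℕ) (t : ℝ) :
    ∑ j ∈ X, D.back * (t - D.dl j) = D.back * (X.card * t - ∑ j ∈ X, D.dl j) := by
  rw [← Finset.mul_sum, Finset.sum_sub_distrib, Finset.sum_const, nsmul_eq_mul]

/-- The backlog sum, with requests not yet due counted negatively, is linear and increasing in t, so
the time when it reaches K has a closed form that divides only by an input number and a cardinality,
as the machine model permits. -/
theorem crossing_le_iff {X : Finset ℕ} (hX : X.Nonempty) (K t : ℝ) :
    (K / D.back + ∑ j ∈ X, D.dl j) / (X.card : ℝ) ≤ t ↔ K ≤ ∑ j ∈ X, D.back * (t - D.dl j) := by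
  have hc : (0 : ℝ) < X.card := by exact_mod_cast hX.card_pos
  rw [sum_back, div_le_iff₀ hc, ← le_sub_iff_add_le, div_le_iff₀ D.back_pos]
  constructor <;> intro h <;> linarith

theorem le_crossing_iff {X : Finset ℕ} (hX : X.Nonempty) (K t : ℝ) :
    t ≤ (K / D.back + ∑ j ∈ X, D.dl j) / (X.card : ℝ) ↔ ∑ j ∈ X, D.back * (t - D.dl j) ≤ K := by
  have hc : (0 : ℝ) < X.card := by exact_mod_cast hX.card_pos
  rw [sum_back, le_div_iff₀ hc, ← sub_le_iff_le_add, le_div_iff₀ D.back_pos]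
  constructor <;> intro h <;> linarith

/-- Requests that are not yet due contribute negatively and overdue ones nonnegatively, so the
overdue part of Y maximizes the sum among its subsets. -/
theorem sum_back_le_overdue {X Y : Finset ℕ} (h : X ⊆ Y) (t : ℝ) :
    ∑ j ∈ X, D.back * (t - D.dl j) ≤ ∑ j ∈ Y with D.dl j ≤ t, D.back * (t - D.dl j) := by
  calc ∑ j ∈ X, D.back * (t - D.dl j)
      ≤ ∑ j ∈ X, if D.dl j ≤ t then D.back * (t - D.dl j) else 0 := by
        refine Finset.sum_le_sum fun j _ => ?_
        split_ifs with hj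
        · exact le_rfl
        · exact mul_nonpos_of_nonneg_of_nonpos D.back_pos.le (by linarith)
    _ ≤ ∑ j ∈ Y, if D.dl j ≤ t then D.back * (t - D.dl j) else 0 := by
        refine Finset.sum_le_sum_of_subset_of_nonneg h fun j _ _ => ?_
        split_ifs with hj
        · exact mul_nonneg D.back_pos.le (by linarith)
        · exact le_rfl
    _ = _ := (Finset.sum_filter _ _).symm

theorem exists_overdue {X : Finset ℕ} (hX : X.Nonempty) {K t : ℝ} (hK : 0 ≤ K)
    (h : K ≤ ∑ j ∈ X, D.back * (t - D.dl j)) : ∃ j ∈ X, D.dl j ≤ t := by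
  by_contra! hc
  have : ∑ j ∈ X, D.back * (t - D.dl j) < 0 :=
    Finset.sum_neg (fun j hj => mul_neg_of_pos_of_neg D.back_pos (by linarith [hc j hj])) hX
  linarith

theorem mem_ofItem {P : Finset ℕ} {v j : ℕ} : j ∈ D.ofItem P v ↔ j ∈ P ∧ D.item j = v :=
  Finset.mem_filter

theorem mem_itemsOf {P : Finset ℕ} {v : ℕ} : v ∈ D.itemsOf P ↔ ∃ j ∈ P, D.item j = v :=
  Finset.mem_image

theorem item_mem_itemsOf {P : Finset ℕ} {j : ℕ} (h : j ∈ P) : D.item j ∈ D.itemsOf P :=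
  Finset.mem_image_of_mem _ h

theorem ofItem_nonempty {P : Finset ℕ} {v : ℕ} : (D.ofItem P v).Nonempty ↔ v ∈ D.itemsOf P := by
  simp only [Finset.Nonempty, mem_ofItem, mem_itemsOf]

/-- The best subset at time t consists of all overdue requests for the item. It is a deadline prefix
`upto P j`, where j is the overdue request of latest deadline; hence the minimum over prefixes in
`tau` loses nothing. -/
theorem tau_le_of_subset {P X : Finset ℕ} {v : ℕ} {t : ℝ} (hXP : X ⊆ D.ofItem P v)
    (hX : X.Nonempty) (h : D.cost v ≤ ∑ j ∈ X, D.back * (t - D.dl j)) : D.tau P v ≤ t := by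
  have hP : (D.ofItem P v).Nonempty := hX.mono hXP
  obtain ⟨i, hi, hit⟩ := exists_overdue hX (D.cost_nonneg v) h
  obtain ⟨j, hj, hmax⟩ := Finset.exists_max_image ((D.ofItem P v).filter fun i => D.dl i ≤ t) D.dl
    ⟨i, Finset.mem_filter.2 ⟨hXP hi, hit⟩⟩
  obtain ⟨hjP, hjt⟩ := Finset.mem_filter.1 hj
  obtain ⟨hjP', hjv⟩ := mem_ofItem.1 hjP
  have hup : D.upto P j = (D.ofItem P v).filter fun i => D.dl i ≤ t := by
    ext x
    simp only [upto, ofItem, Finset.mem_filter, hjv]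
    constructor
    · rintro ⟨h1, h2, h3⟩; exact ⟨⟨h1, h2⟩, h3.trans hjt⟩
    · rintro ⟨⟨h1, h2⟩, h3⟩
      exact ⟨h1, h2, hmax x (by simp only [ofItem, Finset.mem_filter]; exact ⟨⟨h1, h2⟩, h3⟩)⟩
  rw [tau, dif_pos hP, Finset.inf'_le_iff]
  refine ⟨j, hjP, ?_⟩
  rw [cand, hjv, hup, crossing_le_iff ⟨j, hj⟩]
  exact h.trans (sum_back_le_overdue hXP t)

/-- The existence of an overdue request is a separate condition: for an item of cost 0 the empty sum
would satisfy the inequality alone. -/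
theorem tau_le_iff {P : Finset ℕ} {v : ℕ} (hv : v ∈ D.itemsOf P) {t : ℝ} :
    D.tau P v ≤ t ↔ (∃ j ∈ P, D.item j = v ∧ D.dl j ≤ t) ∧
      D.cost v ≤ ∑ j ∈ D.ofItem P v with D.dl j ≤ t, D.back * (t - D.dl j) := by
  have hP : (D.ofItem P v).Nonempty := ofItem_nonempty.2 hv
  constructor
  · intro h
    rw [tau, dif_pos hP, Finset.inf'_le_iff] at h
    obtain ⟨j, hj, hjt⟩ := h
    have hjv := (mem_ofItem.1 hj).2
    have hne : (D.upto P j).Nonempty :=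
      ⟨j, Finset.mem_filter.2 ⟨(mem_ofItem.1 hj).1, rfl, le_rfl⟩⟩
    have hsub : D.upto P j ⊆ D.ofItem P v := fun x hx => by
      obtain ⟨h1, h2, _⟩ := Finset.mem_filter.1 hx
      exact mem_ofItem.2 ⟨h1, h2.trans hjv⟩
    rw [cand, crossing_le_iff hne, hjv] at hjt
    obtain ⟨i, hi, hit⟩ := exists_overdue hne (D.cost_nonneg v) hjt
    exact ⟨⟨i, (mem_ofItem.1 (hsub hi)).1, (mem_ofItem.1 (hsub hi)).2, hit⟩,
      hjt.trans (sum_back_le_overdue hsub t)⟩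
  · rintro ⟨⟨j, hj, hjv, hjt⟩, h⟩
    exact tau_le_of_subset (Finset.filter_subset _ _)
      ⟨j, Finset.mem_filter.2 ⟨mem_ofItem.2 ⟨hj, hjv⟩, hjt⟩⟩ h

/-! ## Trigger times -/

theorem mem_mature {P : Finset ℕ} {t : ℝ} {v : ℕ} :
    v ∈ D.mature P t ↔ v ∈ D.itemsOf P ∧ D.tau P v ≤ t := Finset.mem_filter

theorem sum_due_by_item (P : Finset ℕ) (M : Finset ℕ) (t : ℝ) (f : ℕ → ℝ) :
    ∑ j ∈ P with D.dl j ≤ t ∧ D.item j ∈ M, f j =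
      ∑ v ∈ M, ∑ j ∈ D.ofItem P v with D.dl j ≤ t, f j := by
  rw [← Finset.sum_fiberwise_of_maps_to (s := P.filter fun j => D.dl j ≤ t ∧ D.item j ∈ M)
    (t := M) (g := D.item) (fun x hx => (Finset.mem_filter.1 hx).2.2)]
  refine Finset.sum_congr rfl fun v hv => Finset.sum_congr ?_ fun _ _ => rfl
  ext x
  simp only [Finset.mem_filter, ofItem]
  constructor
  · rintro ⟨⟨h1, h2, _⟩, h3⟩; exact ⟨⟨h1, h3⟩, h2⟩
  · rintro ⟨⟨h1, h3⟩, h2⟩; exact ⟨⟨h1, h2, h3 ▸ hv⟩, h3⟩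

/-- Grouped by items, the backlog must cover the item costs in total, so for some item it covers the
cost of that item. -/
theorem TrigBy.exists_mature {P : Finset ℕ} {t : ℝ} (h : D.TrigBy P t) :
    (D.mature P t).Nonempty := by
  obtain ⟨X, hXP, hX, hc⟩ := h
  by_contra hM
  rw [Finset.not_nonempty_iff_eq_empty] at hM
  have hlt : ∑ j ∈ X, D.back * (t - D.dl j) < ∑ v ∈ X.image D.item, D.cost v := by
    rw [← Finset.sum_fiberwise_of_maps_to (s := X) (t := X.image D.item) (g := D.item)
      (fun x hx => Finset.mem_image_of_mem _ hx)]
    refine Finset.sum_lt_sum_of_nonempty (hX.image _) fun v hv => ?_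
    by_contra! hle
    obtain ⟨j, hj, hjv⟩ := Finset.mem_image.1 hv
    have : v ∈ D.mature P t := mem_mature.2
      ⟨mem_itemsOf.2 ⟨j, hXP hj, hjv⟩, tau_le_of_subset
        (fun x hx => mem_ofItem.2 ⟨hXP (Finset.mem_filter.1 hx).1, (Finset.mem_filter.1 hx).2⟩)
        ⟨j, Finset.mem_filter.2 ⟨hj, hjv⟩⟩ hle⟩
    simp [hM] at this
  linarith [D.joint_nonneg]

/-- Mature items have a nonnegative surplus of overdue backlog over item cost, and the requests of
any other item have a negative one. So passing to the overdue requests of the mature items can only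
increase the total surplus. -/
theorem TrigBy.le_sum_mature {P : Finset ℕ} {t : ℝ} (h : D.TrigBy P t) :
    D.joint + ∑ v ∈ D.mature P t, D.cost v ≤
      ∑ j ∈ P with D.dl j ≤ t ∧ D.item j ∈ D.mature P t, D.back * (t - D.dl j) := by
  obtain ⟨X, hXP, hX, hc⟩ := h
  rw [sum_due_by_item]
  rw [← Finset.sum_fiberwise_of_maps_to (s := X) (t := X.image D.item) (g := D.item)
      (fun x hx => Finset.mem_image_of_mem _ hx)] at hc
  have hle : ∑ v ∈ X.image D.item, (∑ j ∈ X with D.item j = v, D.back * (t - D.dl j) - D.cost v) ≤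
      ∑ v ∈ D.mature P t,
        (∑ j ∈ D.ofItem P v with D.dl j ≤ t, D.back * (t - D.dl j) - D.cost v) := by
    have hsub : ∀ v, (X.filter fun j => D.item j = v) ⊆ D.ofItem P v := fun v x hx =>
      mem_ofItem.2 ⟨hXP (Finset.mem_filter.1 hx).1, (Finset.mem_filter.1 hx).2⟩
    calc _ ≤ ∑ v ∈ X.image D.item, (if v ∈ D.mature P t then
          ∑ j ∈ D.ofItem P v with D.dl j ≤ t, D.back * (t - D.dl j) - D.cost v else 0) := by
          refine Finset.sum_le_sum fun v hv => ?_
          split_ifs with hvM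
          · exact sub_le_sub_right (sum_back_le_overdue (hsub v) t) _
          · by_contra! hlt
            obtain ⟨j, hj, hjv⟩ := Finset.mem_image.1 hv
            exact hvM (mem_mature.2 ⟨mem_itemsOf.2 ⟨j, hXP hj, hjv⟩, tau_le_of_subset (hsub v)
              ⟨j, Finset.mem_filter.2 ⟨hj, hjv⟩⟩ (by linarith)⟩)
      _ = ∑ v ∈ (X.image D.item).filter (· ∈ D.mature P t),
          (∑ j ∈ D.ofItem P v with D.dl j ≤ t, D.back * (t - D.dl j) - D.cost v) :=
          (Finset.sum_filter _ _).symm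
      _ ≤ _ := by
          refine Finset.sum_le_sum_of_subset_of_nonneg
            (fun v hv => (Finset.mem_filter.1 hv).2) fun v hv _ => ?_
          have := mem_mature.1 hv
          linarith [((tau_le_iff this.1).1 this.2).2]
  rw [Finset.sum_sub_distrib, Finset.sum_sub_distrib] at hle
  linarith

/-- By `TrigBy.le_sum_mature` only the overdue requests of mature items need be tested at time t.
They are the requests with `key` at most t, an initial segment in the order of `key`, so the minimum
of `cross` over P replaces a search over all subsets. -/
theorem trig_le_iff {P : Finset ℕ} (hP : P.Nonempty) {t : ℝ} : D.trig P ≤ t ↔ D.TrigBy P t := by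
  rw [trig, dif_pos hP, Finset.inf'_le_iff]
  constructor
  · rintro ⟨j, hj, h⟩
    have hne : (P.filter fun i => D.key P i ≤ D.key P j).Nonempty :=
      ⟨j, Finset.mem_filter.2 ⟨hj, le_rfl⟩⟩
    rw [cross, crossing_le_iff hne] at h
    refine ⟨_, Finset.filter_subset _ _, hne, le_trans ?_ h⟩
    refine add_le_add_right (Finset.sum_le_sum_of_subset_of_nonneg ?_
      fun v _ _ => D.cost_nonneg v) _
    intro v hv
    obtain ⟨i, hi, rfl⟩ := Finset.mem_image.1 hv
    rw [Finset.mem_filter] at hi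
    exact Finset.mem_filter.2 ⟨item_mem_itemsOf hi.1, (le_max_right _ _).trans hi.2⟩
  · intro h
    have hmem : ∀ j, (j ∈ P ∧ D.dl j ≤ t ∧ D.item j ∈ D.mature P t) ↔ j ∈ P ∧ D.key P j ≤ t := by
      intro j
      rw [mem_mature, key, max_le_iff]
      constructor
      · rintro ⟨h1, h2, _, h3⟩; exact ⟨h1, h2, h3⟩
      · rintro ⟨h1, h2, h3⟩; exact ⟨h1, h2, item_mem_itemsOf h1, h3⟩
    have hO : (P.filter fun j => D.dl j ≤ t ∧ D.item j ∈ D.mature P t) =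
        P.filter fun j => D.key P j ≤ t := by
      ext j; rw [Finset.mem_filter, Finset.mem_filter, hmem]
    have hdue : ∀ v ∈ D.mature P t, ∃ j ∈ P, D.item j = v ∧ D.key P j ≤ t := by
      intro v hv
      obtain ⟨hv1, hv2⟩ := mem_mature.1 hv
      obtain ⟨⟨j, hj, hjv, hjt⟩, _⟩ := (tau_le_iff hv1).1 hv2
      exact ⟨j, hj, hjv, max_le hjt (hjv ▸ hv2)⟩
    obtain ⟨v, hv⟩ := h.exists_mature
    obtain ⟨i, hi, _, hit⟩ := hdue v hv
    obtain ⟨j, hj, hmax⟩ := Finset.exists_max_image (P.filter fun j => D.key P j ≤ t) (D.key P)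
      ⟨i, Finset.mem_filter.2 ⟨hi, hit⟩⟩
    obtain ⟨hjP, hjt⟩ := Finset.mem_filter.1 hj
    have e1 : (P.filter fun i => D.key P i ≤ D.key P j) = P.filter fun j => D.key P j ≤ t := by
      ext x
      simp only [Finset.mem_filter]
      exact ⟨fun hx => ⟨hx.1, hx.2.trans hjt⟩, fun hx => ⟨hx.1, hmax x (Finset.mem_filter.2 hx)⟩⟩
    -- Each mature item has an overdue request, whose key is at least the maturity time; so no
    -- maturity time lies between the largest key up to t and t itself.
    have e2 : ((D.itemsOf P).filter fun v => D.tau P v ≤ D.key P j) = D.mature P t := by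
      ext x
      rw [mem_mature, Finset.mem_filter]
      refine ⟨fun hx => ⟨hx.1, hx.2.trans hjt⟩, fun hx => ⟨hx.1, ?_⟩⟩
      obtain ⟨y, hy, rfl, hyt⟩ := hdue x (mem_mature.2 hx)
      exact (le_max_right _ _).trans (hmax y (Finset.mem_filter.2 ⟨hy, hyt⟩))
    refine ⟨j, hjP, ?_⟩
    rw [cross, e1, e2, crossing_le_iff ⟨j, hj⟩, ← hO]
    exact h.le_sum_mature

theorem TrigBy.nonempty {P : Finset ℕ} {t : ℝ} (h : D.TrigBy P t) : P.Nonempty := by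
  obtain ⟨X, hXP, hX, _⟩ := h
  exact hX.mono hXP

theorem TrigBy.mono {P Q : Finset ℕ} {t : ℝ} (h : D.TrigBy P t) (hPQ : P ⊆ Q) : D.TrigBy Q t := by
  obtain ⟨X, hXP, hX⟩ := h
  exact ⟨X, hXP.trans hPQ, hX⟩

theorem trigBy_trig {P : Finset ℕ} (hP : P.Nonempty) : D.TrigBy P (D.trig P) :=
  (trig_le_iff hP).1 le_rfl

/-- Requests with a deadline after `t` are irrelevant for triggering a service at time `t`. -/
theorem TrigBy.filter {P : Finset ℕ} {t : ℝ} (h : D.TrigBy P t) :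
    D.TrigBy (P.filter fun j => D.dl j ≤ t) t := by
  obtain ⟨X, hXP, hX, hc⟩ := h
  have h0 : 0 ≤ D.joint + ∑ v ∈ X.image D.item, D.cost v :=
    add_nonneg D.joint_nonneg (Finset.sum_nonneg fun v _ => D.cost_nonneg v)
  obtain ⟨j, hj, hjt⟩ := exists_overdue hX h0 hc
  refine ⟨X.filter fun j => D.dl j ≤ t, Finset.filter_subset_filter _ hXP,
    ⟨j, Finset.mem_filter.2 ⟨hj, hjt⟩⟩, le_trans ?_ (hc.trans (sum_back_le_overdue subset_rfl t))⟩
  refine add_le_add_right (Finset.sum_le_sum_of_subset_of_nonneg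
    (Finset.image_subset_image (Finset.filter_subset _ _)) fun v _ _ => D.cost_nonneg v) _

/-- Were the backlog of X larger, X would have triggered a service earlier: `trig P` is at most the
crossing time of X. -/
theorem sum_back_trig_le {P X : Finset ℕ} (hXP : X ⊆ P) :
    ∑ j ∈ X, D.back * (D.trig P - D.dl j) ≤ D.joint + ∑ v ∈ X.image D.item, D.cost v := by
  rcases X.eq_empty_or_nonempty with rfl | hX
  · simpa using D.joint_nonneg
  · rw [← le_crossing_iff hX, trig_le_iff (hX.mono hXP)]
    exact ⟨X, hXP, hX, (crossing_le_iff hX _ _).1 le_rfl⟩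

/-! ## The services of the algorithm -/

variable (D)

/-- The items included in a service at time `t` with pending requests `P`: the mature items, and
other items in the order of their maturity times, up to a total cost equal to the joint cost. -/
def incl (P : Finset ℕ) (t : ℝ) : Finset ℕ :=
  (D.itemsOf P).filter fun v =>
    ∑ u ∈ D.itemsOf P with t < D.tau P u ∧ D.tau P u ≤ D.tau P v, D.cost u ≤ D.joint

/-- The holding cost at time `t` of the requests of the same item up to the deadline of `j`. -/
def itemHold (P : Finset ℕ) (t : ℝ) (j : ℕ) : ℝ :=
  ∑ i ∈ P with D.item i = D.item j ∧ t < D.dl i ∧ D.dl i ≤ D.dl j, D.hold * (D.dl i - t)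

/-- The holding cost at time `t` of the requests of all included items up to the deadline
of `j`. -/
def jointHold (P : Finset ℕ) (t : ℝ) (j : ℕ) : ℝ :=
  ∑ i ∈ P with D.item i ∈ D.incl P t ∧ t < D.dl i ∧ D.dl i ≤ D.dl j, D.hold * (D.dl i - t)

/-- The requests satisfied by a service at time `t` with pending requests `P`. -/
def served (P : Finset ℕ) (t : ℝ) : Finset ℕ :=
  P.filter fun j => D.item j ∈ D.incl P t ∧
    (D.itemHold P t j ≤ D.cost (D.item j) ∨ D.jointHold P t j ≤ D.joint)

variable {D}

theorem served_subset (P : Finset ℕ) (t : ℝ) : D.served P t ⊆ P := Finset.filter_subset _ _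

theorem mature_subset_incl (P : Finset ℕ) (t : ℝ) : D.mature P t ⊆ D.incl P t := by
  intro v hv
  obtain ⟨h1, h2⟩ := mem_mature.1 hv
  refine Finset.mem_filter.2 ⟨h1, ?_⟩
  rw [Finset.filter_false_of_mem]
  · simpa using D.joint_nonneg
  · rintro u - ⟨h3, h4⟩; linarith

theorem mem_served_of_overdue {P : Finset ℕ} {t : ℝ} {j : ℕ} (hj : j ∈ P)
    (hv : D.item j ∈ D.incl P t) (hjt : D.dl j ≤ t) : j ∈ D.served P t := by
  refine Finset.mem_filter.2 ⟨hj, hv, Or.inl ?_⟩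
  rw [itemHold, Finset.filter_false_of_mem]
  · simpa using D.cost_nonneg _
  · rintro u - ⟨-, h3, h4⟩; linarith

theorem served_trig_nonempty {P : Finset ℕ} (hP : P.Nonempty) :
    (D.served P (D.trig P)).Nonempty := by
  obtain ⟨v, hv⟩ := (trigBy_trig hP).exists_mature
  have h := mem_mature.1 hv
  obtain ⟨⟨j, hj, rfl, hjt⟩, _⟩ := (tau_le_iff h.1).1 h.2
  exact ⟨j, mem_served_of_overdue hj (mature_subset_incl _ _ hv) hjt⟩

/-- After a service at time `t`, another service is not triggered at time `t`. -/
theorem not_trigBy_sdiff_served (P : Finset ℕ) (t : ℝ) : ¬ D.TrigBy (P \ D.served P t) t := by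
  intro h
  -- An item mature for the remaining requests is also mature for P, hence included; but then its
  -- overdue requests have all been satisfied, while maturity requires one.
  obtain ⟨v, hv⟩ := h.exists_mature
  have h := mem_mature.1 hv
  obtain ⟨⟨j, hj, hjv, hjt⟩, hle⟩ := (tau_le_iff h.1).1 h.2
  obtain ⟨hjP, hjS⟩ := Finset.mem_sdiff.1 hj
  refine hjS (mem_served_of_overdue hjP (mature_subset_incl _ _ ?_) hjt)
  rw [hjv]
  refine mem_mature.2 ⟨hjv ▸ item_mem_itemsOf hjP, tau_le_of_subset (X := (D.ofItem (P \ D.served P t)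
    v).filter fun j => D.dl j ≤ t) ?_ ⟨j, Finset.mem_filter.2 ⟨mem_ofItem.2 ⟨hj, hjv⟩, hjt⟩⟩ hle⟩
  intro x hx
  obtain ⟨hx1, hx2⟩ := mem_ofItem.1 (Finset.mem_filter.1 hx).1
  exact mem_ofItem.2 ⟨(Finset.mem_sdiff.1 hx1).1, hx2⟩

/-! ### The cost of one service -/

theorem sum_back_ofItem_le {P : Finset ℕ} {t : ℝ} {v : ℕ} (h : v ∉ D.mature P t) :
    ∑ j ∈ D.ofItem P v with D.dl j ≤ t, D.back * (t - D.dl j) ≤ D.cost v := by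
  rcases ((D.ofItem P v).filter fun j => D.dl j ≤ t).eq_empty_or_nonempty with h0 | h0
  · rw [h0]; simpa using D.cost_nonneg v
  · by_contra! hlt
    exact h (mem_mature.2 ⟨ofItem_nonempty.1 (h0.mono (Finset.filter_subset _ _)),
      tau_le_of_subset (Finset.filter_subset _ _) h0 hlt.le⟩)

/-- For items that are not mature, `incl` is exactly the threshold rule with key `tau` and budget
`joint`. -/
theorem sum_premature_le (P : Finset ℕ) (t : ℝ) :
    ∑ v ∈ D.incl P t \ D.mature P t, D.cost v ≤ D.joint := by
  refine le_trans (le_of_eq ?_) (sum_threshold_le ((D.itemsOf P).filter fun v => t < D.tau P v)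
    (D.tau P) D.cost D.joint D.joint_nonneg fun v _ => D.cost_nonneg v)
  refine Finset.sum_congr ?_ fun _ _ => rfl
  ext v
  simp only [incl, mature, Finset.mem_sdiff, Finset.mem_filter, Finset.filter_filter, not_and,
    not_le]
  tauto

/-- The threshold rule, with deadlines as keys and the item cost as budget, is applied within each
item separately. -/
theorem sum_item_hold_le (P : Finset ℕ) (t : ℝ) (I : Finset ℕ) :
    ∑ j ∈ P with D.item j ∈ I ∧ t < D.dl j ∧ D.itemHold P t j ≤ D.cost (D.item j),
      D.hold * (D.dl j - t) ≤ ∑ v ∈ I, D.cost v := by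
  rw [← Finset.sum_fiberwise_of_maps_to (t := I) (g := D.item)
    (fun x hx => (Finset.mem_filter.1 hx).2.1)]
  refine Finset.sum_le_sum fun v hv => ?_
  refine le_trans (le_of_eq ?_) (sum_threshold_le ((D.ofItem P v).filter fun j => t < D.dl j)
    D.dl (fun j => D.hold * (D.dl j - t)) (D.cost v) (D.cost_nonneg v) fun j hj =>
      mul_nonneg D.hold_nonneg (by linarith [(Finset.mem_filter.1 hj).2]))
  refine Finset.sum_congr ?_ fun _ _ => rfl
  ext j
  rw [Finset.mem_filter, Finset.mem_filter, Finset.mem_filter, Finset.mem_filter]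
  simp only [itemHold, ofItem, Finset.filter_filter, and_assoc]
  constructor
  · rintro ⟨h1, h2, h3, h4, rfl⟩
    exact ⟨Finset.mem_filter.2 ⟨h1, rfl⟩, h3, h4⟩
  · rintro ⟨h1, h3, h4⟩
    obtain ⟨h2, rfl⟩ := Finset.mem_filter.1 h1
    exact ⟨h2, hv, h3, h4, rfl⟩

theorem sum_joint_hold_le (P : Finset ℕ) (t : ℝ) :
    ∑ j ∈ P with D.item j ∈ D.incl P t ∧ t < D.dl j ∧ D.jointHold P t j ≤ D.joint,
      D.hold * (D.dl j - t) ≤ D.joint := by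
  refine le_trans (le_of_eq ?_) (sum_threshold_le
    (P.filter fun j => D.item j ∈ D.incl P t ∧ t < D.dl j)
    D.dl (fun j => D.hold * (D.dl j - t)) D.joint D.joint_nonneg fun j hj =>
      mul_nonneg D.hold_nonneg (by linarith [(Finset.mem_filter.1 hj).2.2]))
  refine Finset.sum_congr ?_ fun _ _ => rfl
  ext j
  rw [Finset.mem_filter, Finset.mem_filter, Finset.mem_filter]
  simp only [jointHold, Finset.filter_filter, and_assoc]

/-- The cost of a service of the algorithm. -/
theorem service_cost_le (P : Finset ℕ) :
    D.joint + ∑ v ∈ D.incl P (D.trig P), D.cost v +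
        ∑ j ∈ D.served P (D.trig P), D.delay j (D.trig P) ≤
      6 * D.joint + 3 * ∑ v ∈ D.mature P (D.trig P), D.cost v := by
  set t := D.trig P with ht
  set I := D.incl P t with hI
  set M := D.mature P t with hM
  have hMI : M ⊆ I := mature_subset_incl P t
  have hsplit := Finset.sum_sdiff (f := D.cost) hMI
  have hpre := sum_premature_le (D := D) P t
  have hbackM : ∑ j ∈ P with D.dl j ≤ t ∧ D.item j ∈ M, D.back * (t - D.dl j) ≤
      D.joint + ∑ v ∈ M, D.cost v := by
    refine (sum_back_trig_le (Finset.filter_subset _ _)).trans (add_le_add_right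
      (Finset.sum_le_sum_of_subset_of_nonneg ?_ fun v _ _ => D.cost_nonneg v) _)
    intro v hv
    obtain ⟨i, hi, rfl⟩ := Finset.mem_image.1 hv
    exact (Finset.mem_filter.1 hi).2.2
  have hbackP : ∑ j ∈ P with D.dl j ≤ t ∧ D.item j ∈ I \ M, D.back * (t - D.dl j) ≤
      ∑ v ∈ I \ M, D.cost v := by
    rw [sum_due_by_item]
    exact Finset.sum_le_sum fun v hv => sum_back_ofItem_le (Finset.mem_sdiff.1 hv).2
  have hloc := sum_item_hold_le (D := D) P t I
  have hglob := sum_joint_hold_le (D := D) P t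
  -- Overdue requests are covered by one of the first two sums; a request satisfied early is covered
  -- by one or both of the last two.
  have hdelay : ∑ j ∈ D.served P t, D.delay j t ≤
      ∑ j ∈ P with D.dl j ≤ t ∧ D.item j ∈ M, D.back * (t - D.dl j) +
      ∑ j ∈ P with D.dl j ≤ t ∧ D.item j ∈ I \ M, D.back * (t - D.dl j) +
      ∑ j ∈ P with D.item j ∈ I ∧ t < D.dl j ∧ D.itemHold P t j ≤ D.cost (D.item j),
        D.hold * (D.dl j - t) +
      ∑ j ∈ P with D.item j ∈ I ∧ t < D.dl j ∧ D.jointHold P t j ≤ D.joint,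
        D.hold * (D.dl j - t) := by
    simp only [served, Finset.sum_filter, ← Finset.sum_add_distrib]
    refine Finset.sum_le_sum fun j _ => ?_
    rcases le_or_gt (D.dl j) t with hj | hj
    · have h0 : 0 ≤ D.back * (t - D.dl j) := mul_nonneg D.back_pos.le (by linarith)
      rw [D.delay_of_le hj]
      by_cases h1 : D.item j ∈ I
      · by_cases h2 : D.item j ∈ M
        · simp only [← hI, h1, h2, hj, hj.not_gt, Finset.mem_sdiff, true_and, false_and,
            if_true, if_false, not_true_eq_false, and_false]
          split_ifs <;> linarith
        · simp only [← hI, h1, h2, hj, hj.not_gt, Finset.mem_sdiff, true_and, false_and,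
            if_true, if_false, not_false_eq_true, and_false, and_true]
          split_ifs <;> linarith
      · have h2 : D.item j ∉ M := fun h => h1 (hMI h)
        simp [← hI, h1, h2]
    · have h0 : 0 ≤ D.hold * (D.dl j - t) := mul_nonneg D.hold_nonneg (by linarith)
      rw [D.delay_of_ge hj.le]
      by_cases h1 : D.item j ∈ I
      · simp only [← hI, h1, hj, hj.not_ge, true_and, false_and, if_false]
        split_ifs with h3 h4 h5 h5 h4 h5 h5 <;> first | linarith | tauto
      · simp [← hI, h1, hj.not_ge]
  -- The six joint costs are the joint cost itself, the premature items, the excess backlog of the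
  -- mature items, the backlog of the premature items, their individual holding budgets and the
  -- common holding budget. The mature items are paid three times: as item cost, in their backlog
  -- and as individual holding budgets.
  linarith

/-! ## Requests not satisfied within a time interval -/

/-- Suppose that no request of `Z` or `Y` is satisfied within `(lo, T]`. Then either all requests of
`Z` pay at least their backlog cost at time `T`, or the requests of `Y` pay at least `β`. -/
theorem backlog_or_holding {lo T β : ℝ} {Z Y : Finset ℕ} {o : ℕ → ℝ}
    (hZ : ∀ j ∈ Z, lo < D.dl j ∧ D.dl j ≤ T) (hoZ : ∀ j ∈ Z, o j ≤ lo ∨ T < o j)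
    (hoY : ∀ j ∈ Y, o j ≤ lo ∨ T < o j)
    (hβ : ∀ j ∈ Z, o j ≤ lo →
      β ≤ ∑ i ∈ Y with lo < D.dl i ∧ D.dl i ≤ D.dl j, D.hold * (D.dl i - lo)) :
    (∀ j ∈ Z, D.back * (T - D.dl j) ≤ D.delay j (o j)) ∨
      β ≤ ∑ i ∈ Y with lo < D.dl i ∧ D.dl i ≤ T, D.delay i (o i) := by
  by_cases hall : ∀ j ∈ Z, D.back * (T - D.dl j) ≤ D.delay j (o j)
  · exact Or.inl hall
  right
  push Not at hall
  -- The cheap request j pays less than its backlog cost at T, so it was satisfied by time lo. It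
  -- serves as a bound for all i with earlier deadlines.
  obtain ⟨j, hj, hlt⟩ := hall
  have hjZ := hZ j hj
  have hoj : o j ≤ lo := by
    rcases hoZ j hj with h | h
    · exact h
    · linarith [D.backlog_le_delay hjZ.2 h.le]
  have hhold := D.holding_le_delay hjZ.1.le hoj
  refine (hβ j hj hoj).trans ((Finset.sum_le_sum (g := fun i => D.delay i (o i)) ?_).trans
    (Finset.sum_le_sum_of_subset_of_nonneg ?_ fun i _ _ => D.delay_nonneg _ _))
  · intro i hi
    obtain ⟨hiY, hi1, hi2⟩ := Finset.mem_filter.1 hi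
    rcases hoY i hiY with h | h
    · exact D.holding_le_delay hi1.le h
    -- If i is satisfied after T, it pays at least the backlog of j at T, since its deadline is no
    -- later. By the choice of j this exceeds the holding cost of j from lo, which is at least that
    -- of i.
    · have h1 := D.backlog_le_delay (hi2.trans hjZ.2) h.le
      have h2 : D.hold * (D.dl i - lo) ≤ D.hold * (D.dl j - lo) :=
        mul_le_mul_of_nonneg_left (by linarith) D.hold_nonneg
      have h3 : D.back * (T - D.dl j) ≤ D.back * (T - D.dl i) :=
        mul_le_mul_of_nonneg_left (by linarith) D.back_pos.le
      linarith
  · intro i hi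
    obtain ⟨hiY, hi1, hi2⟩ := Finset.mem_filter.1 hi
    exact Finset.mem_filter.2 ⟨hiY, hi1, hi2.trans hjZ.2⟩

/-! ## Runs of the algorithm -/

/-- A complete run of the algorithm on the requests `0, …, R - 1`, with services at times
`t 1 < ⋯ < t N` and pending requests `P i` at time `t i`. The time `t 0` precedes all arrivals. -/
structure Run (D : Inst) (R N : ℕ) where
  t : ℕ → ℝ
  P : ℕ → Finset ℕ
  t_lt : ∀ {i j}, i < j → j ≤ N → t i < t j
  mem_P : ∀ {i j}, i ≤ N →
    (j ∈ P i ↔ j < R ∧ D.arr j ≤ t i ∧ ∀ l < i, j ∉ D.served (P l) (t l))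
  start : ∀ j < R, t 0 < D.arr j
  nonempty : ∀ {i}, 1 ≤ i → i ≤ N → (P i).Nonempty
  t_eq : ∀ {i}, 1 ≤ i → i ≤ N → t i = D.trig (P i)

/-- An offline solution: services at the times `y s` with items `U s`, where `σ j` is the service
that satisfies the request `j`. -/
structure Offline (D : Inst) (R : ℕ) (ι : Type) where
  y : ι → ℝ
  U : ι → Finset ℕ
  σ : ℕ → ι
  item_mem : ∀ j < R, D.item j ∈ U (σ j)
  arr_le : ∀ j < R, D.arr j ≤ y (σ j)

namespace Run

variable {R N : ℕ} (r : Run D R N)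

/-- The requests satisfied by the `i`-th service. -/
def S (i : ℕ) : Finset ℕ := D.served (r.P i) (r.t i)

/-- The `i`-th service includes `v`; the fictitious service `0` includes everything. -/
def Inc (i v : ℕ) : Prop := i = 0 ∨ v ∈ D.incl (r.P i) (r.t i)

/-- The item `v` is mature at the `i`-th service. -/
def Mat (i v : ℕ) : Prop := v ∈ D.mature (r.P i) (r.t i)

/-- The first service of `w` that is not in `A` is the service `i`, where `w` is not mature,
or the service `i + 1`, where `w` is mature. -/
def Next (A : ℕ → Prop) (w i : ℕ) : Prop :=
  (¬ A i ∧ r.Inc i w ∧ ¬ r.Mat i w ∧ ∀ m < i, r.Inc m w → A m) ∨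
    (¬ A (i + 1) ∧ r.Mat (i + 1) w ∧ ∀ m < i + 1, r.Inc m w → A m)

variable {r}

theorem Mat.inc {i v : ℕ} (h : r.Mat i v) : r.Inc i v := Or.inr (mature_subset_incl _ _ h)

/-- The first service of w outside A is unique, and whether w is mature there decides which
alternative applies, hence i. The shift by one in `Next` therefore causes no double charging. -/
theorem Next.unique {A : ℕ → Prop} {w i j : ℕ} (hi : r.Next A w i) (hj : r.Next A w j) :
    i = j := by
  have key : ∀ {k l : ℕ}, ¬ A k → r.Inc k w → (∀ m < k, r.Inc m w → A m) →
      ¬ A l → r.Inc l w → (∀ m < l, r.Inc m w → A m) → k = l := by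
    intro k l hk hkw hkm hl hlw hlm
    rcases lt_trichotomy k l with h | h | h
    · exact absurd (hlm k h hkw) hk
    · exact h
    · exact absurd (hkm l h hlw) hl
  rcases hi with ⟨h1, h2, h3, h4⟩ | ⟨h1, h3, h4⟩ <;>
    rcases hj with ⟨g1, g2, g3, g4⟩ | ⟨g1, g3, g4⟩
  · exact key h1 h2 h4 g1 g2 g4
  · have := key h1 h2 h4 g1 g3.inc g4
    subst this; exact absurd g3 h3
  · have := key h1 h3.inc h4 g1 g2 g4
    subst this; exact absurd h3 g3
  · have := key h1 h3.inc h4 g1 g3.inc g4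
    omega

theorem mem_S_of_overdue {i j : ℕ} (hj : j ∈ r.P i) (hv : r.Inc i (D.item j))
    (hP0 : i = 0 → r.P i = ∅) (hd : D.dl j ≤ r.t i) : j ∈ r.S i := by
  rcases hv with h | h
  · rw [hP0 h] at hj; simp at hj
  · exact mem_served_of_overdue hj h hd

variable (r)

theorem P_zero {i : ℕ} (h : i = 0) : r.P i = ∅ := by
  subst h
  ext j
  rw [r.mem_P (Nat.zero_le _)]
  simp only [Finset.notMem_empty, iff_false, not_and]
  intro hj h
  linarith [r.start j hj]

variable {r}

theorem t_le {i j : ℕ} (h : i ≤ j) (hj : j ≤ N) : r.t i ≤ r.t j := by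
  rcases h.eq_or_lt with rfl | h
  · exact le_rfl
  · exact (r.t_lt h hj).le

theorem lt_of_mem_P {i j : ℕ} (hi : i ≤ N) (h : j ∈ r.P i) : j < R := ((r.mem_P hi).1 h).1

theorem mem_P_of_S {i j : ℕ} (h : j ∈ r.S i) : j ∈ r.P i := served_subset _ _ h

theorem inc_of_mem_S {i j : ℕ} (h : j ∈ r.S i) : r.Inc i (D.item j) :=
  Or.inr (Finset.mem_filter.1 h).2.1

theorem S_unique {i i' j : ℕ} (hi : i ≤ N) (hi' : i' ≤ N) (h : j ∈ r.S i) (h' : j ∈ r.S i') :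
    i = i' := by
  rcases lt_trichotomy i i' with hlt | heq | hlt
  · exact absurd h (((r.mem_P hi').1 (mem_P_of_S h')).2.2 i hlt)
  · exact heq
  · exact absurd h' (((r.mem_P hi).1 (mem_P_of_S h)).2.2 i' hlt)

variable (r)

theorem exists_last (v : ℕ) {m : ℕ} (hm : 0 < m) :
    ∃ l < m, r.Inc l v ∧ ∀ k < m, r.Inc k v → k ≤ l := by
  classical
  obtain ⟨l, hl, hmax⟩ := Finset.exists_max_image ((Finset.range m).filter fun k => r.Inc k v) id
    ⟨0, Finset.mem_filter.2 ⟨Finset.mem_range.2 hm, Or.inl rfl⟩⟩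
  obtain ⟨h1, h2⟩ := Finset.mem_filter.1 hl
  exact ⟨l, Finset.mem_range.1 h1, h2, fun k hk hkv =>
    hmax k (Finset.mem_filter.2 ⟨Finset.mem_range.2 hk, hkv⟩)⟩

variable {r}

theorem mem_P_of_gap {v l m j : ℕ} (hm : m ≤ N) (hlm : l < m)
    (hlast : ∀ k < m, r.Inc k v → k ≤ l) (hj : j ∈ r.P l) (hjv : D.item j = v)
    (hjS : j ∉ r.S l) : j ∈ r.P m := by
  obtain ⟨h1, h2, h3⟩ := (r.mem_P (hlm.le.trans hm)).1 hj
  refine (r.mem_P hm).2 ⟨h1, h2.trans (t_le hlm.le hm), fun k hk hkS => ?_⟩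
  rcases (hlast k hk (hjv ▸ inc_of_mem_S hkS)).lt_or_eq with h | rfl
  · exact h3 k h hkS
  · exact hjS hkS

/-- A request due by `t l` has also arrived by then, and a service satisfies every overdue pending
request of its items. -/
theorem lt_dl_of_later {l m j : ℕ} (hm : m ≤ N) (hlm : l < m) (hj : j ∈ r.P m)
    (hv : r.Inc l (D.item j)) : r.t l < D.dl j := by
  obtain ⟨h1, h2, h3⟩ := (r.mem_P hm).1 hj
  by_contra! hle
  exact h3 l hlm (mem_S_of_overdue ((r.mem_P (hlm.le.trans hm)).2
    ⟨h1, (D.arr_le_dl j).trans hle, fun k hk => h3 k (hk.trans hlm)⟩) hv (r.P_zero) hle)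

/-! ## Charging the cost of an item -/

variable {ι : Type} (O : Offline D R ι)

/-- The delay cost of request `j` in the offline solution. -/
def _root_.JRP.Inst.Offline.del (j : ℕ) : ℝ := D.delay j (O.y (O.σ j))

theorem _root_.JRP.Inst.Offline.del_nonneg (j : ℕ) : 0 ≤ O.del j := D.delay_nonneg _ _

/-- If the requests for `v` pending at service `m` have backlog cost at least `D.cost v` at
time `T`, then the offline solution serves `v` between the last service of `v` before `m` and `T`,
or it has enough delay costs. -/
theorem item_charge {v l m : ℕ} {T : ℝ} (hm : m ≤ N) (hlm : l < m) (hl : r.Inc l v)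
    (hlast : ∀ k < m, r.Inc k v → k ≤ l)
    (hZ : D.cost v ≤ ∑ j ∈ D.ofItem (r.P m) v with D.dl j ≤ T, D.back * (T - D.dl j)) :
    (∃ s, v ∈ O.U s ∧ r.t l < O.y s ∧ O.y s ≤ T) ∨
      D.cost v ≤ ∑ j ∈ Finset.range R with
        D.item j = v ∧ (j ∈ r.P m ∧ D.dl j ≤ T ∨ j ∈ r.S l), O.del j := by
  by_cases hs : ∃ s, v ∈ O.U s ∧ r.t l < O.y s ∧ O.y s ≤ T
  · exact Or.inl hs
  right
  push Not at hs
  have hlN : l ≤ N := hlm.le.trans hm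
  have ho : ∀ j < R, D.item j = v → O.y (O.σ j) ≤ r.t l ∨ T < O.y (O.σ j) := by
    intro j hj hjv
    rcases le_or_gt (O.y (O.σ j)) (r.t l) with h | h
    · exact Or.inl h
    · exact Or.inr (hs _ (hjv ▸ O.item_mem j hj) h)
  have main := backlog_or_holding (D := D) (lo := r.t l) (T := T) (β := D.cost v)
    (Z := (D.ofItem (r.P m) v).filter fun j => D.dl j ≤ T) (Y := D.ofItem (r.P l) v)
    (o := fun j => O.y (O.σ j)) ?_ ?_ ?_ ?_
  · rcases main with h | h
    · refine hZ.trans ((Finset.sum_le_sum h).trans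
        (Finset.sum_le_sum_of_subset_of_nonneg ?_ fun j _ _ => O.del_nonneg j))
      intro j hj
      obtain ⟨hj1, hjT⟩ := Finset.mem_filter.1 hj
      obtain ⟨hjP, hjv⟩ := mem_ofItem.1 hj1
      exact Finset.mem_filter.2
        ⟨Finset.mem_range.2 (lt_of_mem_P hm hjP), hjv, Or.inl ⟨hjP, hjT⟩⟩
    · refine h.trans (Finset.sum_le_sum_of_subset_of_nonneg ?_ fun j _ _ => O.del_nonneg j)
      intro j hj
      obtain ⟨hj1, _, hjT⟩ := Finset.mem_filter.1 hj
      obtain ⟨hjP, hjv⟩ := mem_ofItem.1 hj1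
      refine Finset.mem_filter.2 ⟨Finset.mem_range.2 (lt_of_mem_P hlN hjP), hjv, ?_⟩
      -- The requests that fill the holding budget at service l are either satisfied there or still
      -- pending at m; these two kinds are charged separately.
      by_cases hjS : j ∈ r.S l
      · exact Or.inr hjS
      · exact Or.inl ⟨mem_P_of_gap hm hlm hlast hjP hjv hjS, hjT⟩
  · intro j hj
    obtain ⟨hj1, hjT⟩ := Finset.mem_filter.1 hj
    obtain ⟨hjP, hjv⟩ := mem_ofItem.1 hj1
    exact ⟨lt_dl_of_later hm hlm hjP (hjv.symm ▸ hl), hjT⟩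
  · intro j hj
    obtain ⟨hj1, hjT⟩ := Finset.mem_filter.1 hj
    obtain ⟨hjP, hjv⟩ := mem_ofItem.1 hj1
    exact ho j (lt_of_mem_P hm hjP) hjv
  · intro j hj
    obtain ⟨hjP, hjv⟩ := mem_ofItem.1 hj
    exact ho j (lt_of_mem_P hlN hjP) hjv
  -- If the offline solution satisfies j by `t l`, then j had arrived at service l and was passed
  -- over, so the requests for v up to its deadline exceed the individual holding budget.
  · intro j hj hoj
    obtain ⟨hj1, hjT⟩ := Finset.mem_filter.1 hj
    obtain ⟨hjP, rfl⟩ := mem_ofItem.1 hj1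
    obtain ⟨hjR, _, hjS⟩ := (r.mem_P hm).1 hjP
    have hjl : j ∈ r.P l := (r.mem_P hlN).2
      ⟨hjR, (O.arr_le j hjR).trans hoj, fun k hk => hjS k (hk.trans hlm)⟩
    have hinc : D.item j ∈ D.incl (r.P l) (r.t l) := by
      rcases hl with h | h
      · rw [r.P_zero h] at hjl; simp at hjl
      · exact h
    have hns := hjS l hlm
    rw [served, Finset.mem_filter] at hns
    push Not at hns
    have := (hns hjl hinc).1.le
    rwa [itemHold, ← Finset.filter_filter] at this

open scoped Classical in
-- Each payer, a pair of an offline service and an item or a request, belongs to a single item, so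
-- different items of Q never share one. The predicates ρ and K record which payers are used, so
-- that their uses over all services can be counted later.
theorem sum_charge_le [Fintype ι] (Q : Finset ℕ) (ρ : ι → ℕ → Prop) (K : ℕ → Prop)
    (h : ∀ w ∈ Q, (∃ s, w ∈ O.U s ∧ ρ s w) ∨ ∃ W ⊆ Finset.range R,
      (∀ j ∈ W, D.item j = w ∧ K j) ∧ D.cost w ≤ ∑ j ∈ W, O.del j) :
    ∑ w ∈ Q, D.cost w ≤ (∑ s, ∑ w ∈ O.U s, if ρ s w then D.cost w else 0) +
      ∑ j ∈ Finset.range R, if K j then O.del j else 0 := by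
  have h1 : ∀ w ∈ Q, D.cost w ≤ (∑ s, if w ∈ O.U s then (if ρ s w then D.cost w else 0) else 0) +
      ∑ j ∈ Finset.range R, if w = D.item j then (if K j then O.del j else 0) else 0 := by
    intro w hw
    have hA : 0 ≤ ∑ s, if w ∈ O.U s then (if ρ s w then D.cost w else 0) else 0 :=
      Finset.sum_nonneg fun s _ => by
        split_ifs <;> first | exact D.cost_nonneg w | exact le_rfl
    have hB : ∀ j ∈ Finset.range R,
        0 ≤ if w = D.item j then (if K j then O.del j else 0) else 0 := fun j _ => by
      split_ifs <;> first | exact O.del_nonneg j | exact le_rfl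
    rcases h w hw with ⟨s, hs, hρ⟩ | ⟨W, hWR, hW, hle⟩
    · have : D.cost w ≤ ∑ s, if w ∈ O.U s then (if ρ s w then D.cost w else 0) else 0 := by
        refine le_trans ?_ (Finset.single_le_sum (f := fun s =>
          if w ∈ O.U s then (if ρ s w then D.cost w else 0) else 0) (fun s _ => ?_)
          (Finset.mem_univ s))
        · simp [hs, hρ]
        · split_ifs <;> first | exact D.cost_nonneg w | exact le_rfl
      linarith [Finset.sum_nonneg hB]
    · have : ∑ j ∈ W, O.del j ≤
          ∑ j ∈ Finset.range R, if w = D.item j then (if K j then O.del j else 0) else 0 := by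
        refine le_trans (Finset.sum_le_sum fun j hj => ?_)
          (Finset.sum_le_sum_of_subset_of_nonneg hWR fun j hj _ => hB j hj)
        rw [if_pos (hW j hj).1.symm, if_pos (hW j hj).2]
      linarith
  refine (Finset.sum_le_sum h1).trans ?_
  rw [Finset.sum_add_distrib, Finset.sum_comm,
    Finset.sum_comm (s := Q) (t := Finset.range R)]
  refine add_le_add (Finset.sum_le_sum fun s _ => ?_) (Finset.sum_le_sum fun j _ => ?_)
  · rw [← Finset.sum_filter]
    refine Finset.sum_le_sum_of_subset_of_nonneg (fun w hw => (Finset.mem_filter.1 hw).2)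
      fun w _ _ => ?_
    split_ifs <;> first | exact D.cost_nonneg w | exact le_rfl
  · rw [Finset.sum_ite_eq']
    split_ifs <;> first | exact O.del_nonneg j | exact le_rfl

variable (r)

/-- The offline item costs charged at service `i + 1`. -/
def itemCharge [Fintype ι] (i : ℕ) : ℝ :=
  open scoped Classical in
  ∑ s, ∑ w ∈ O.U s, if r.Next (fun m => r.t m < O.y s) w i then D.cost w else 0

/-- The requests charged for the item costs of service `i + 1`. -/
def K₁ (j i : ℕ) : Prop :=
  j ∈ r.S (i + 1) ∨ ∃ l ≤ N, j ∈ r.S l ∧ r.Next (· ≤ l) (D.item j) i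

/-- The requests charged for the joint cost of service `i + 1`. -/
def K₂ (j i : ℕ) : Prop :=
  (r.K₁ j i ∨ j ∈ r.S i) ∨ r.t i < D.dl j ∧ D.dl j ≤ r.t (i + 1)

open scoped Classical in
-- Use `item_charge` with the last service l of v before `i + 1` and T = `t (i + 1)`. For an offline
-- service after `t l`, and for a request satisfied at l, the next online service of v is `i + 1`,
-- where v is mature. Overdue pending requests are satisfied at `i + 1` itself.
theorem mature_charge [Fintype ι] {i : ℕ} (hi : i < N) :
    ∑ v ∈ D.mature (r.P (i + 1)) (r.t (i + 1)), D.cost v ≤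
      r.itemCharge O i + ∑ j ∈ Finset.range R, if r.K₁ j i then O.del j else 0 := by
  refine sum_charge_le O _ (fun s w => r.Next (fun m => r.t m < O.y s) w i) _ fun v hv => ?_
  obtain ⟨l, hl, hlv, hlast⟩ := r.exists_last v (Nat.succ_pos i)
  have hMat : r.Mat (i + 1) v := hv
  obtain ⟨hv1, hv2⟩ := mem_mature.1 hv
  rcases item_charge O hi hl hlv hlast ((tau_le_iff hv1).1 hv2).2 with ⟨s, hs, h1, h2⟩ | h
  · exact Or.inl ⟨s, hs, Or.inr ⟨h2.not_gt, hMat, fun m hm hmv =>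
      (t_le (hlast m hm hmv) (hl.le.trans hi)).trans_lt h1⟩⟩
  · refine Or.inr ⟨_, Finset.filter_subset _ _, fun j hj => ?_, h⟩
    obtain ⟨_, rfl, hj2⟩ := Finset.mem_filter.1 hj
    refine ⟨rfl, ?_⟩
    rcases hj2 with ⟨hjP, hjd⟩ | hjS
    · exact Or.inl (mem_S_of_overdue hjP hMat.inc r.P_zero hjd)
    · exact Or.inr ⟨l, hl.le.trans hi, hjS, Or.inr ⟨by omega, hMat, hlast⟩⟩

/-! ## Charging the joint cost -/

theorem mem_P_succ_of_not_inc {i j : ℕ} (hi : i < N) (hj : j ∈ r.P i)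
    (hinc : ¬ r.Inc i (D.item j)) : j ∈ r.P (i + 1) := by
  obtain ⟨h1, h2, h3⟩ := (r.mem_P hi.le).1 hj
  refine (r.mem_P hi).2 ⟨h1, h2.trans (t_le (Nat.le_succ i) hi), fun k hk hkS => ?_⟩
  rcases (Nat.lt_succ_iff.1 hk).lt_or_eq with h | rfl
  · exact h3 k h hkS
  · exact hinc (inc_of_mem_S hkS)

/-- Since service i leaves w out, all its requests stay pending, so its maturity time cannot move
back. -/
theorem mat_succ_of_not_inc {i w : ℕ} (hi : i < N) (hw : w ∈ D.itemsOf (r.P i))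
    (hτ : D.tau (r.P i) w ≤ r.t (i + 1)) (hinc : ¬ r.Inc i w) : r.Mat (i + 1) w := by
  obtain ⟨⟨j, hj, hjw, hjd⟩, hle⟩ := (tau_le_iff hw).1 hτ
  refine mem_mature.2 ⟨mem_itemsOf.2 ⟨j, r.mem_P_succ_of_not_inc hi hj (hjw ▸ hinc), hjw⟩,
    tau_le_of_subset (fun x hx => ?_) ⟨j, Finset.mem_filter.2 ⟨mem_ofItem.2 ⟨hj, hjw⟩, hjd⟩⟩ hle⟩
  obtain ⟨hx1, hx2⟩ := mem_ofItem.1 (Finset.mem_filter.1 hx).1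
  exact mem_ofItem.2 ⟨r.mem_P_succ_of_not_inc hi hx1 (hx2 ▸ hinc), hx2⟩

open scoped Classical in
/-- The case where an item that is not included in a service matures until the next service. -/
theorem premature_charge [Fintype ι] {i u : ℕ} (hi : i < N)
    (hroot : ∀ s, O.y s ≤ r.t i ∨ r.t (i + 1) < O.y s)
    (hu : u ∈ D.itemsOf (r.P i)) (huI : u ∉ D.incl (r.P i) (r.t i))
    (hτ : D.tau (r.P i) u ≤ r.t (i + 1)) :
    D.joint ≤ r.itemCharge O i + ∑ j ∈ Finset.range R, if r.K₂ j i then O.del j else 0 := by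
  have hi0 : 0 < i := by
    rcases Nat.eq_zero_or_pos i with h | h
    · rw [r.P_zero h] at hu; simp [itemsOf] at hu
    · exact h
  -- Since u was left out, the items that mature after `t i` and no later than u cost more than the
  -- joint cost in total. All of them mature by `t (i + 1)`, so each can be charged.
  rw [incl, Finset.mem_filter, not_and, not_le] at huI
  refine (huI hu).le.trans
    (sum_charge_le O _ (fun s w => r.Next (fun m => r.t m < O.y s) w i) _ fun w hw => ?_)
  obtain ⟨hwP, hwt, hwu⟩ := Finset.mem_filter.1 hw
  obtain ⟨l, hl, hlw, hlast⟩ := r.exists_last w hi0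
  have hnmat : ¬ r.Mat i w := fun h => absurd (mem_mature.1 h).2 hwt.not_ge
  have hwτ := hwu.trans hτ
  -- An item w included at service i is premature there, which is the first alternative of `Next`;
  -- otherwise it is mature at service `i + 1`, the second alternative.
  have hnext : ∀ A : ℕ → Prop, (∀ m ≤ l, A m) → (¬ A i) → (¬ A (i + 1)) → r.Next A w i := by
    intro A hA h1 h2
    by_cases hinc : r.Inc i w
    · exact Or.inl ⟨h1, hinc, hnmat, fun m hm hmw => hA m (hlast m hm hmw)⟩
    · refine Or.inr ⟨h2, r.mat_succ_of_not_inc hi hwP hwτ hinc, fun m hm hmw => ?_⟩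
      rcases (Nat.lt_succ_iff.1 hm).lt_or_eq with h | rfl
      · exact hA m (hlast m h hmw)
      · exact absurd hmw hinc
  rcases item_charge O hi.le hl hlw hlast ((tau_le_iff hwP).1 hwτ).2 with ⟨s, hs, h1, h2⟩ | h
  · have hsi : O.y s ≤ r.t i := (hroot s).resolve_right h2.not_gt
    exact Or.inl ⟨s, hs, hnext _ (fun m hm => (t_le hm (hl.le.trans hi.le)).trans_lt h1)
      hsi.not_gt h2.not_gt⟩
  · refine Or.inr ⟨_, Finset.filter_subset _ _, fun j hj => ?_, h⟩
    obtain ⟨_, rfl, hj2⟩ := Finset.mem_filter.1 hj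
    refine ⟨rfl, ?_⟩
    rcases hj2 with ⟨hjP, hjd⟩ | hjS
    -- A request falling due within the interval is charged through its deadline. One that was
    -- already overdue is satisfied by service i if its item is included there, and by service `i +
    -- 1` otherwise.
    · rcases lt_or_ge (r.t i) (D.dl j) with hd | hd
      · exact Or.inr ⟨hd, hjd⟩
      · by_cases hinc : r.Inc i (D.item j)
        · exact Or.inl (Or.inr (mem_S_of_overdue hjP hinc r.P_zero hd))
        · exact Or.inl (Or.inl (Or.inl (mem_S_of_overdue (r.mem_P_succ_of_not_inc hi hjP hinc)
            (r.mat_succ_of_not_inc hi hwP hwτ hinc).inc r.P_zero hjd)))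
    · exact Or.inl (Or.inl (Or.inr ⟨l, hl.le.trans hi.le, hjS,
        hnext _ (fun m hm => hm) (by omega) (by omega)⟩))

open scoped Classical in
/-- The case where no item that is not included in a service matures until the next service. -/
theorem surplus_charge {i : ℕ} (hi : i < N)
    (hroot : ∀ s, O.y s ≤ r.t i ∨ r.t (i + 1) < O.y s)
    (hu : ∀ u ∈ D.itemsOf (r.P i), u ∉ D.incl (r.P i) (r.t i) → r.t (i + 1) < D.tau (r.P i) u) :
    D.joint ≤ ∑ j ∈ Finset.range R, if r.K₂ j i then O.del j else 0 := by
  set I := D.incl (r.P i) (r.t i) with hI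
  set T := r.t (i + 1) with hT
  set M := D.mature (r.P (i + 1)) T with hM
  have hdue := (trigBy_trig (D := D) (r.nonempty (Nat.le_add_left 1 i) hi)).le_sum_mature
  rw [← r.t_eq (Nat.le_add_left 1 i) hi] at hdue
  have main := backlog_or_holding (D := D) (lo := r.t i) (T := T) (β := D.joint)
    (Z := (r.P (i + 1)).filter fun j => (D.dl j ≤ T ∧ D.item j ∈ M) ∧ D.item j ∈ I)
    (Y := (r.P i).filter fun j => D.item j ∈ I)
    (o := fun j => O.y (O.σ j)) ?_ (fun j _ => hroot _) (fun j _ => hroot _) ?_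
  · rcases main with h | h
    · have hfinal : ∑ j ∈ r.P (i + 1) with D.dl j ≤ T ∧ D.item j ∈ M, D.back * (T - D.dl j) ≤
          ∑ v ∈ M, D.cost v + ∑ j ∈ r.P (i + 1) with D.dl j ≤ T ∧ D.item j ∈ M, O.del j := by
        rw [sum_due_by_item, sum_due_by_item, ← Finset.sum_add_distrib]
        refine Finset.sum_le_sum fun v hv => ?_
        -- For an included item all overdue requests pay offline. For a left out item the old
        -- requests have backlog at most the item cost, because it has not matured; only new
        -- requests can contribute more.
        by_cases hvI : v ∈ I
        · refine le_trans (Finset.sum_le_sum (g := O.del) fun j hj => ?_)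
            (le_add_of_nonneg_left (D.cost_nonneg v))
          obtain ⟨hj1, hjT⟩ := Finset.mem_filter.1 hj
          obtain ⟨hjP, rfl⟩ := mem_ofItem.1 hj1
          exact h j (Finset.mem_filter.2 ⟨hjP, ⟨hjT, hv⟩, hvI⟩)
        · have hold : ∑ j ∈ D.ofItem (r.P i) v with D.dl j ≤ T, D.back * (T - D.dl j) ≤
              D.cost v := by
            refine sum_back_ofItem_le fun h => ?_
            obtain ⟨h1, h2⟩ := mem_mature.1 h
            exact (hu v h1 hvI).not_ge h2
          rw [Finset.sum_filter] at hold
          have hnew : ∑ j ∈ D.ofItem (r.P (i + 1)) v with D.dl j ≤ T, D.back * (T - D.dl j) ≤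
              (∑ j ∈ D.ofItem (r.P (i + 1)) v with D.dl j ≤ T,
                if j ∈ r.P i then D.back * (T - D.dl j) else 0) +
              ∑ j ∈ D.ofItem (r.P (i + 1)) v with D.dl j ≤ T, O.del j := by
            rw [← Finset.sum_add_distrib]
            refine Finset.sum_le_sum fun j hj => ?_
            obtain ⟨hj1, hjT⟩ := Finset.mem_filter.1 hj
            obtain ⟨hjP, hjv⟩ := mem_ofItem.1 hj1
            split_ifs with hji
            · linarith [O.del_nonneg j]
            · obtain ⟨h1, h2, h3⟩ := (r.mem_P hi).1 hjP
              have harr : r.t i < D.arr j := by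
                by_contra! hle
                exact hji ((r.mem_P hi.le).2 ⟨h1, hle, fun k hk => h3 k (hk.trans (Nat.lt_succ_self i))⟩)
              -- A request that arrived after `t i` cannot be satisfied offline within the interval,
              -- so it waits beyond T.
              have hlate : T < O.y (O.σ j) :=
                (hroot _).resolve_left (harr.trans_le (O.arr_le j h1)).not_ge
              linarith [D.backlog_le_delay hjT hlate.le, show O.del j = D.delay j _ from rfl]
          have hle : ∑ j ∈ D.ofItem (r.P (i + 1)) v with D.dl j ≤ T,
                (if j ∈ r.P i then D.back * (T - D.dl j) else 0) ≤
              ∑ j ∈ D.ofItem (r.P i) v, if D.dl j ≤ T then D.back * (T - D.dl j) else 0 := by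
            rw [← Finset.sum_filter, ← Finset.sum_filter]
            refine Finset.sum_le_sum_of_subset_of_nonneg (fun j hj => ?_) fun j hj _ =>
              mul_nonneg D.back_pos.le (by linarith [(Finset.mem_filter.1 hj).2])
            simp only [Finset.mem_filter, mem_ofItem] at hj ⊢
            exact ⟨⟨hj.2, hj.1.1.2⟩, hj.1.2⟩
          linarith
      have hle : D.joint ≤ ∑ j ∈ r.P (i + 1) with D.dl j ≤ T ∧ D.item j ∈ M, O.del j := by
        linarith
      refine hle.trans ?_
      rw [← Finset.sum_filter]
      refine Finset.sum_le_sum_of_subset_of_nonneg (fun j hj => ?_) fun j _ _ => O.del_nonneg j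
      obtain ⟨hjP, hjT, hjM⟩ := Finset.mem_filter.1 hj
      exact Finset.mem_filter.2 ⟨Finset.mem_range.2 (lt_of_mem_P hi hjP), Or.inl (Or.inl (Or.inl
        (mem_S_of_overdue hjP (Mat.inc hjM) r.P_zero hjT)))⟩
    · refine h.trans ?_
      rw [← Finset.sum_filter]
      refine Finset.sum_le_sum_of_subset_of_nonneg (fun j hj => ?_) fun j _ _ => O.del_nonneg j
      obtain ⟨hjY, hj1, hj2⟩ := Finset.mem_filter.1 hj
      exact Finset.mem_filter.2 ⟨Finset.mem_range.2
        (lt_of_mem_P hi.le (Finset.mem_filter.1 hjY).1), Or.inr ⟨hj1, hj2⟩⟩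
  · intro j hj
    obtain ⟨hjP, ⟨hjT, _⟩, hjI⟩ := Finset.mem_filter.1 hj
    exact ⟨lt_dl_of_later hi (Nat.lt_succ_self i) hjP (Or.inr hjI), hjT⟩
  · intro j hj hoj
    obtain ⟨hjP, ⟨hjT, _⟩, hjI⟩ := Finset.mem_filter.1 hj
    obtain ⟨hjR, _, hjS⟩ := (r.mem_P hi).1 hjP
    have hji : j ∈ r.P i := (r.mem_P hi.le).2
      ⟨hjR, (O.arr_le j hjR).trans hoj, fun k hk => hjS k (hk.trans (Nat.lt_succ_self i))⟩
    -- Here j was passed over by the common rule, so the requests of all included items up to its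
    -- deadline exceed the joint holding budget.
    have hns := hjS i (Nat.lt_succ_self i)
    rw [served, Finset.mem_filter] at hns
    push Not at hns
    have := (hns hji hjI).2.le
    rwa [jointHold, ← Finset.filter_filter] at this

open scoped Classical in
theorem joint_charge [Fintype ι] {i : ℕ} (hi : i < N) :
    D.joint ≤ (∑ s, if r.t i < O.y s ∧ O.y s ≤ r.t (i + 1) then D.joint else 0) +
      (r.itemCharge O i + ∑ j ∈ Finset.range R, if r.K₂ j i then O.del j else 0) := by
  have h0 : ∀ s ∈ Finset.univ,
      0 ≤ if r.t i < O.y s ∧ O.y s ≤ r.t (i + 1) then D.joint else 0 := fun s _ => by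
    split_ifs <;> first | exact D.joint_nonneg | exact le_rfl
  have h1 : 0 ≤ r.itemCharge O i := Finset.sum_nonneg fun s _ => Finset.sum_nonneg fun w _ => by
    split_ifs <;> first | exact D.cost_nonneg w | exact le_rfl
  have h2 : 0 ≤ ∑ j ∈ Finset.range R, if r.K₂ j i then O.del j else 0 :=
    Finset.sum_nonneg fun j _ => by
      split_ifs <;> first | exact O.del_nonneg j | exact le_rfl
  by_cases hs : ∃ s, r.t i < O.y s ∧ O.y s ≤ r.t (i + 1)
  · obtain ⟨s, hs⟩ := hs
    have := Finset.single_le_sum h0 (Finset.mem_univ s)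
    rw [if_pos hs] at this
    linarith
  · push Not at hs
    have hroot : ∀ s, O.y s ≤ r.t i ∨ r.t (i + 1) < O.y s := fun s =>
      (le_or_gt _ _).imp_right (hs s)
    have h3 := Finset.sum_nonneg h0
    by_cases hu : ∃ u ∈ D.itemsOf (r.P i), u ∉ D.incl (r.P i) (r.t i) ∧
        D.tau (r.P i) u ≤ r.t (i + 1)
    · obtain ⟨u, hu1, hu2, hu3⟩ := hu
      linarith [r.premature_charge O hi hroot hu1 hu2 hu3]
    · push Not at hu
      linarith [r.surplus_charge O hi hroot hu]

/-! ## The competitive ratio -/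

theorem _root_.JRP.sum_ite_le_of_unique (s : Finset ℕ) (p : ℕ → Prop) [DecidablePred p] {x : ℝ}
    (hx : 0 ≤ x) (h : ∀ i ∈ s, ∀ j ∈ s, p i → p j → i = j) :
    ∑ i ∈ s, (if p i then x else 0) ≤ x := by
  rw [← Finset.sum_filter, Finset.sum_const, nsmul_eq_mul]
  have : ((s.filter p).card : ℝ) ≤ 1 := by
    exact_mod_cast Finset.card_le_one.2 fun i hi j hj => h i (Finset.mem_filter.1 hi).1 j
      (Finset.mem_filter.1 hj).1 (Finset.mem_filter.1 hi).2 (Finset.mem_filter.1 hj).2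
  nlinarith

theorem _root_.JRP.sum_ite_or_le (s : Finset ℕ) {c p q : ℕ → Prop} [DecidablePred c]
    [DecidablePred p] [DecidablePred q] {x : ℝ} (hx : 0 ≤ x) (h : ∀ i, c i ↔ p i ∨ q i) :
    ∑ i ∈ s, (if c i then x else 0) ≤
      ∑ i ∈ s, (if p i then x else 0) + ∑ i ∈ s, (if q i then x else 0) := by
  rw [← Finset.sum_add_distrib]
  refine Finset.sum_le_sum fun i _ => ?_
  by_cases h1 : p i <;> by_cases h2 : q i <;> simp [h, h1, h2, hx]

theorem crossing_unique {x : ℝ} {i j : ℕ} (hi : i < N) (hj : j < N)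
    (h : r.t i < x ∧ x ≤ r.t (i + 1)) (h' : r.t j < x ∧ x ≤ r.t (j + 1)) : i = j := by
  rcases lt_trichotomy i j with hlt | heq | hlt
  · linarith [r.t_le (Nat.succ_le_of_lt hlt) hj.le]
  · exact heq
  · linarith [r.t_le (Nat.succ_le_of_lt hlt) hi.le]

open scoped Classical in
-- Each of the two clauses of `K₁` holds for at most one i: a request is satisfied by a single
-- service, and `Next` determines its index.
theorem sum_K₁_le (j : ℕ) :
    ∑ i ∈ Finset.range N, (if r.K₁ j i then O.del j else 0) ≤ 2 * O.del j := by
  have h0 := O.del_nonneg j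
  have h1 := sum_ite_le_of_unique (Finset.range N) (fun i => j ∈ r.S (i + 1)) h0
    fun i hi k hk h h' => by
      have := S_unique (r := r) (Finset.mem_range.1 hi) (Finset.mem_range.1 hk) h h'
      omega
  have h2 := sum_ite_le_of_unique (Finset.range N)
    (fun i => ∃ l ≤ N, j ∈ r.S l ∧ r.Next (· ≤ l) (D.item j) i) h0
    fun i hi k hk ⟨l, hl, hjl, h⟩ ⟨l', hl', hjl', h'⟩ => by
      have := S_unique hl hl' hjl hjl'
      subst this
      exact h.unique h'
  have h3 := sum_ite_or_le (Finset.range N) (c := fun i => r.K₁ j i) h0 fun i => Iff.rfl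
  linarith

open scoped Classical in
theorem sum_K₂_le (j : ℕ) :
    ∑ i ∈ Finset.range N, (if r.K₂ j i then O.del j else 0) ≤ 4 * O.del j := by
  have h0 := O.del_nonneg j
  have h1 := r.sum_K₁_le O j
  have h2 := sum_ite_le_of_unique (Finset.range N) (fun i => j ∈ r.S i) h0
    fun i hi k hk h h' =>
      S_unique (r := r) (Finset.mem_range.1 hi).le (Finset.mem_range.1 hk).le h h'
  have h3 := sum_ite_le_of_unique (Finset.range N)
    (fun i => r.t i < D.dl j ∧ D.dl j ≤ r.t (i + 1)) h0
    fun i hi k hk h h' =>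
      r.crossing_unique (Finset.mem_range.1 hi) (Finset.mem_range.1 hk) h h'
  have h4 := sum_ite_or_le (Finset.range N) (c := fun i => r.K₂ j i) h0 fun i => Iff.rfl
  have h5 := sum_ite_or_le (Finset.range N) (c := fun i => r.K₁ j i ∨ j ∈ r.S i) h0
    fun i => Iff.rfl
  linarith

open scoped Classical in
theorem sum_itemCharge_le [Fintype ι] :
    ∑ i ∈ Finset.range N, r.itemCharge O i ≤ ∑ s, ∑ w ∈ O.U s, D.cost w := by
  unfold itemCharge
  rw [Finset.sum_comm]
  refine Finset.sum_le_sum fun s _ => ?_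
  rw [Finset.sum_comm]
  exact Finset.sum_le_sum fun w _ => sum_ite_le_of_unique _ _ (D.cost_nonneg w)
    fun i _ j _ h h' => h.unique h'

/-- The services of the algorithm cost at most `30` times as much as an offline solution. -/
theorem cost_le [Fintype ι] :
    ∑ i ∈ Finset.range N, (D.joint + ∑ v ∈ D.incl (r.P (i + 1)) (r.t (i + 1)), D.cost v +
      ∑ j ∈ r.S (i + 1), D.delay j (r.t (i + 1))) ≤
    30 * (∑ s, (D.joint + ∑ v ∈ O.U s, D.cost v) + ∑ j ∈ Finset.range R, O.del j) := by
  classical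
  have hservice : ∀ i ∈ Finset.range N,
      D.joint + ∑ v ∈ D.incl (r.P (i + 1)) (r.t (i + 1)), D.cost v +
        ∑ j ∈ r.S (i + 1), D.delay j (r.t (i + 1)) ≤
      6 * ((∑ s, if r.t i < O.y s ∧ O.y s ≤ r.t (i + 1) then D.joint else 0) +
        (r.itemCharge O i + ∑ j ∈ Finset.range R, if r.K₂ j i then O.del j else 0)) +
      3 * (r.itemCharge O i + ∑ j ∈ Finset.range R, if r.K₁ j i then O.del j else 0) := by
    intro i hi
    have hi' := Finset.mem_range.1 hi
    have h1 := service_cost_le (D := D) (r.P (i + 1))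
    rw [← r.t_eq (Nat.le_add_left 1 i) hi'] at h1
    have h2 := r.joint_charge O hi'
    have h3 := r.mature_charge O hi'
    have h4 : r.S (i + 1) = D.served (r.P (i + 1)) (r.t (i + 1)) := rfl
    rw [h4]
    linarith
  refine (Finset.sum_le_sum hservice).trans ?_
  rw [Finset.sum_add_distrib, ← Finset.mul_sum, ← Finset.mul_sum, Finset.sum_add_distrib,
    Finset.sum_add_distrib, Finset.sum_add_distrib]
  have hroot : ∑ i ∈ Finset.range N,
      (∑ s, if r.t i < O.y s ∧ O.y s ≤ r.t (i + 1) then D.joint else 0) ≤ ∑ _s : ι, D.joint := by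
    rw [Finset.sum_comm]
    exact Finset.sum_le_sum fun s _ => sum_ite_le_of_unique _ _ D.joint_nonneg
      fun i hi j hj h h' => r.crossing_unique (Finset.mem_range.1 hi) (Finset.mem_range.1 hj) h h'
  have hitem := r.sum_itemCharge_le O
  have hK1 : ∑ i ∈ Finset.range N, (∑ j ∈ Finset.range R, if r.K₁ j i then O.del j else 0) ≤
      2 * ∑ j ∈ Finset.range R, O.del j := by
    rw [Finset.sum_comm, Finset.mul_sum]
    exact Finset.sum_le_sum fun j _ => r.sum_K₁_le O j
  have hK2 : ∑ i ∈ Finset.range N, (∑ j ∈ Finset.range R, if r.K₂ j i then O.del j else 0) ≤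
      4 * ∑ j ∈ Finset.range R, O.del j := by
    rw [Finset.sum_comm, Finset.mul_sum]
    exact Finset.sum_le_sum fun j _ => r.sum_K₂_le O j
  have h1 : 0 ≤ ∑ _s : ι, D.joint := Finset.sum_nonneg fun _ _ => D.joint_nonneg
  have h2 : 0 ≤ ∑ s, ∑ w ∈ O.U s, D.cost w :=
    Finset.sum_nonneg fun s _ => Finset.sum_nonneg fun w _ => D.cost_nonneg w
  rw [Finset.sum_add_distrib]
  -- The factors are 6 for joint costs, 6 + 3 for item costs and 6·4 + 3·2 for delay costs. The last
  -- one attains 30.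
  linarith

end Run

end Inst

/-! ## The algorithm -/

/-- The instance given by a model and a list of requests. -/
def Model.inst {n : ℕ} (M : Model n) (rs : List (Request n)) : Inst where
  joint := M.jointCost
  cost v := if hv : v < n then M.itemCost ⟨v, hv⟩ else 0
  hold := M.holdRate
  back := M.backRate
  item j := match rs[j]? with
    | some r => r.item
    | none => 0
  arr j := match rs[j]? with
    | some r => r.arrival
    | none => 0
  dl j := match rs[j]? with
    | some r => r.deadline
    | none => 0
  joint_nonneg := M.jointCost_nonneg
  cost_nonneg v := by
    split_ifs
    · exact M.itemCost_nonneg _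
    · exact le_rfl
  hold_nonneg := M.holdRate_nonneg
  back_pos := M.backRate_pos
  arr_le_dl j := by
    rcases rs[j]? with _ | r
    · exact le_rfl
    · exact r.arrival_le_deadline

/-- The state of the algorithm: the number `k` of requests that have arrived, the set `P` of those
not yet satisfied, and the services carried out, the last one first. -/
structure Sim (n : ℕ) where
  k : ℕ
  P : Finset ℕ
  out : Schedule n

/-- The next service if `P` is the set of pending requests. -/
def Inst.service (D : Inst) (n : ℕ) (P : Finset ℕ) : Service n where
  time := D.trig P
  items := Finset.univ.filter fun v : Fin n => (v : ℕ) ∈ D.incl P (D.trig P)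
  served := D.served P (D.trig P)

open scoped Classical in
/-- The next event of the algorithm on an instance with `R` requests: an arrival or a service. -/
def Sim.step {n : ℕ} (D : Inst) (R : ℕ) (s : Sim n) : Sim n :=
  -- The inequality is weak: in a tie the arrival comes first, so a service sees every request that
  -- has arrived by its time.
  if s.k < R ∧ (s.P = ∅ ∨ D.arr s.k ≤ D.trig s.P) then ⟨s.k + 1, insert s.k s.P, s.out⟩
  else if s.P = ∅ then s
  else ⟨s.k, s.P \ D.served s.P (D.trig s.P), D.service n s.P :: s.out⟩

def Sim.init (n : ℕ) : Sim n := ⟨0, ∅, []⟩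

/-- The online algorithm: all requests have been satisfied after two events per request. -/
def replenish : Algorithm := fun n M rs =>
  ((Sim.step (M.inst rs) rs.length)^[2 * rs.length] (Sim.init n)).out

namespace Sim

variable {n : ℕ} {D : Inst} {R : ℕ}

/-- The three kinds of events. -/
theorem step_cases (D : Inst) (R : ℕ) (s : Sim n) :
    (s.k < R ∧ (s.P.Nonempty → D.arr s.k ≤ D.trig s.P) ∧
      s.step D R = ⟨s.k + 1, insert s.k s.P, s.out⟩) ∨
    (s.P.Nonempty ∧ (s.k < R → D.trig s.P < D.arr s.k) ∧
      s.step D R = ⟨s.k, s.P \ D.served s.P (D.trig s.P), D.service n s.P :: s.out⟩) ∨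
    (s.P = ∅ ∧ R ≤ s.k ∧ s.step D R = s) := by
  by_cases h : s.k < R ∧ (s.P = ∅ ∨ D.arr s.k ≤ D.trig s.P)
  · refine Or.inl ⟨h.1, fun hne => h.2.resolve_left hne.ne_empty, if_pos h⟩
  · right
    by_cases h' : s.P = ∅
    · refine Or.inr ⟨h', ?_, ?_⟩
      · by_contra! hk
        exact h ⟨hk, Or.inl h'⟩
      · rw [step, if_neg h, if_pos h']
    · refine Or.inl ⟨Finset.nonempty_iff_ne_empty.2 h', fun hk => ?_, ?_⟩
      · by_contra! hle
        exact h ⟨hk, Or.inr hle⟩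
      · rw [step, if_neg h, if_neg h']

/-! ### Termination -/

/-- A bound on the number of remaining events. -/
def remaining (R : ℕ) (s : Sim n) : ℕ := 2 * (R - s.k) + s.P.card

/-- An arrival trades a weight of 2 for at most one pending request, and a service satisfies at
least one request. -/
theorem remaining_step (s : Sim n) : (s.step D R).remaining R ≤ s.remaining R - 1 := by
  rcases s.step_cases D R with ⟨h, _, e⟩ | ⟨h, _, e⟩ | ⟨h, h', e⟩
  · rw [e, remaining, remaining]
    have := Finset.card_insert_le s.k s.P
    simp only
    omega
  · rw [e, remaining, remaining]
    have h1 := Finset.card_sdiff_add_card_inter s.P (D.served s.P (D.trig s.P))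
    rw [Finset.inter_eq_right.2 (Inst.served_subset _ _)] at h1
    have h2 := (Inst.served_trig_nonempty (D := D) h).card_pos
    simp only
    omega
  · rw [e, remaining, h, Finset.card_empty]
    omega

theorem remaining_iterate (s : Sim n) (m : ℕ) :
    ((step D R)^[m] s).remaining R ≤ s.remaining R - m := by
  induction m with
  | zero => simp
  | succ m ih =>
    rw [Function.iterate_succ_apply']
    have := remaining_step (D := D) (R := R) ((step D R)^[m] s)
    omega

theorem step_of_remaining {s : Sim n} (h : s.remaining R = 0) : s.step D R = s := by
  have h1 : s.P = ∅ := by rw [← Finset.card_eq_zero]; unfold remaining at h; omega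
  have h2 : R ≤ s.k := by unfold remaining at h; omega
  rw [step, if_neg (by omega), if_pos h1]

/-- The number of rounds depends on the total number of requests, which an online algorithm does not
know. Extra rounds do nothing, so two instances can be compared after the same number of rounds. -/
theorem iterate_final {m : ℕ} (hm : 2 * R ≤ m) :
    (step D R)^[m] (init n) = (step D R)^[2 * R] (init n) := by
  obtain ⟨d, rfl⟩ := Nat.exists_eq_add_of_le' hm
  rw [Function.iterate_add_apply, Function.iterate_fixed]
  apply step_of_remaining
  have := remaining_iterate (D := D) (R := R) (init n) (2 * R)
  simp only [remaining, init, Finset.card_empty] at this ⊢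
  omega

/-! ### No service up to a given time -/

/-- No further service takes place up to time `t`. -/
def Frozen (D : Inst) (R : ℕ) (t : ℝ) (s : Sim n) : Prop :=
  ¬ D.TrigBy s.P t ∧ ∀ j < R, s.k ≤ j → t < D.arr j

/-- The deadline of the new request is not before its arrival, so the request is not due at t and
cannot help to trigger a service. -/
theorem _root_.JRP.Inst.TrigBy.of_insert {P : Finset ℕ} {t : ℝ} {k : ℕ}
    (h : D.TrigBy (insert k P) t) (hk : t < D.arr k) : D.TrigBy P t := by
  refine h.filter.mono fun j hj => ?_
  obtain ⟨h1, h2⟩ := Finset.mem_filter.1 hj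
  rcases Finset.mem_insert.1 h1 with rfl | h1
  · linarith [D.arr_le_dl j]
  · exact h1

theorem Frozen.step {t : ℝ} {s : Sim n} (h : s.Frozen D R t) : (s.step D R).Frozen D R t := by
  rcases s.step_cases D R with ⟨h1, _, e⟩ | ⟨_, _, e⟩ | ⟨_, _, e⟩ <;> rw [e]
  · exact ⟨fun hc => h.1 (hc.of_insert (h.2 _ h1 le_rfl)),
      fun j hj hk => h.2 j hj ((Nat.le_succ _).trans hk)⟩
  · exact ⟨fun hc => h.1 (hc.mono Finset.sdiff_subset), h.2⟩
  · exact h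

theorem Frozen.trig_gt {t : ℝ} {s : Sim n} (h : s.Frozen D R t) (hP : s.P.Nonempty) :
    t < D.trig s.P := by
  by_contra! hle
  exact h.1 ((Inst.trig_le_iff hP).1 hle)

theorem Frozen.servicesUpTo_step {t : ℝ} {s : Sim n} (h : s.Frozen D R t) :
    servicesUpTo (s.step D R).out t = servicesUpTo s.out t := by
  rcases s.step_cases D R with ⟨h1, _, e⟩ | ⟨hP, _, e⟩ | ⟨_, _, e⟩ <;> rw [e]
  have := h.trig_gt hP
  unfold servicesUpTo
  rw [List.filter_cons_of_neg]
  exact fun hc => absurd (of_decide_eq_true hc) this.not_ge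

theorem Frozen.servicesUpTo_iterate {t : ℝ} {s : Sim n} (h : s.Frozen D R t) (m : ℕ) :
    servicesUpTo ((Sim.step D R)^[m] s).out t = servicesUpTo s.out t := by
  induction m generalizing s with
  | zero => rfl
  | succ m ih => rw [Function.iterate_succ_apply, ih h.step, h.servicesUpTo_step]

end Sim

/-! ## Instances that agree on the pending requests -/

/-- The instances have the same model and agree on the requests in `P`. -/
structure Inst.Agree (D D' : Inst) (P : Finset ℕ) : Prop where
  joint : D.joint = D'.joint
  cost : D.cost = D'.cost
  hold : D.hold = D'.hold
  back : D.back = D'.back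
  item : ∀ j ∈ P, D.item j = D'.item j
  dl : ∀ j ∈ P, D.dl j = D'.dl j

namespace Inst.Agree

variable {D D' : Inst} {P : Finset ℕ}

theorem itemsOf (h : D.Agree D' P) : D.itemsOf P = D'.itemsOf P := Finset.image_congr h.item

theorem ofItem (h : D.Agree D' P) (v : ℕ) : D.ofItem P v = D'.ofItem P v :=
  Finset.filter_congr fun j hj => by rw [h.item j hj]

theorem upto (h : D.Agree D' P) {j : ℕ} (hj : j ∈ P) : D.upto P j = D'.upto P j :=
  Finset.filter_congr fun i hi => by rw [h.item i hi, h.item j hj, h.dl i hi, h.dl j hj]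

theorem cand (h : D.Agree D' P) {j : ℕ} (hj : j ∈ P) : D.cand P j = D'.cand P j := by
  have e : ∑ i ∈ D'.upto P j, D.dl i = ∑ i ∈ D'.upto P j, D'.dl i :=
    Finset.sum_congr rfl fun i hi => h.dl i (Finset.mem_filter.1 hi).1
  rw [Inst.cand, Inst.cand, h.upto hj, h.cost, h.item j hj, h.back, e]

theorem tau (h : D.Agree D' P) (v : ℕ) : D.tau P v = D'.tau P v := by
  unfold Inst.tau
  simp only [h.ofItem v]
  split_ifs with hne
  · exact Finset.inf'_congr _ rfl fun j hj => h.cand (mem_ofItem.1 hj).1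
  · rfl

theorem key (h : D.Agree D' P) {j : ℕ} (hj : j ∈ P) : D.key P j = D'.key P j := by
  rw [Inst.key, Inst.key, h.dl j hj, h.item j hj, h.tau]

theorem cross (h : D.Agree D' P) {j : ℕ} (hj : j ∈ P) : D.cross P j = D'.cross P j := by
  have e : (P.filter fun i => D.key P i ≤ D.key P j) = P.filter fun i => D'.key P i ≤ D'.key P j :=
    Finset.filter_congr fun i hi => by rw [h.key hi, h.key hj]
  rw [Inst.cross, Inst.cross, e, h.key hj, h.itemsOf, h.joint, h.cost, h.back,
    Finset.sum_congr rfl fun i hi => h.dl i (Finset.mem_filter.1 hi).1]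
  simp only [h.tau]

theorem trig (h : D.Agree D' P) : D.trig P = D'.trig P := by
  unfold Inst.trig
  split_ifs with hne
  · exact Finset.inf'_congr _ rfl fun j hj => h.cross hj
  · rfl

theorem incl (h : D.Agree D' P) (t : ℝ) : D.incl P t = D'.incl P t := by
  unfold Inst.incl
  simp only [h.itemsOf, h.tau, h.cost, h.joint]

theorem itemHold (h : D.Agree D' P) (t : ℝ) {j : ℕ} (hj : j ∈ P) : D.itemHold P t j = D'.itemHold P t j := by
  unfold Inst.itemHold
  refine Finset.sum_congr (Finset.filter_congr fun i hi => ?_) fun i hi => ?_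
  · rw [h.item i hi, h.item j hj, h.dl i hi, h.dl j hj]
  · rw [h.hold, h.dl i (Finset.mem_filter.1 hi).1]

theorem jointHold (h : D.Agree D' P) (t : ℝ) {j : ℕ} (hj : j ∈ P) : D.jointHold P t j = D'.jointHold P t j := by
  unfold Inst.jointHold
  refine Finset.sum_congr (Finset.filter_congr fun i hi => ?_) fun i hi => ?_
  · rw [h.item i hi, h.incl, h.dl i hi, h.dl j hj]
  · rw [h.hold, h.dl i (Finset.mem_filter.1 hi).1]

theorem served (h : D.Agree D' P) (t : ℝ) : D.served P t = D'.served P t :=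
  Finset.filter_congr fun j hj => by
    rw [h.item j hj, h.incl, h.itemHold t hj, h.jointHold t hj, h.cost, h.joint]

theorem service (h : D.Agree D' P) (n : ℕ) : D.service n P = D'.service n P := by
  unfold Inst.service
  simp only [h.trig, h.incl, h.served]

end Inst.Agree

/-! ## The algorithm is online -/

/-- By the arrival order the known requests form a prefix of the list, so they have the same
positions, and thus the same names, in every continuation. -/
theorem known_append {n : ℕ} {rs : List (Request n)} (h : InArrivalOrder rs) (t : ℝ) :
    ∃ l : List (Request n), rs = known rs t ++ l ∧ ∀ r ∈ l, t < r.arrival := by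
  induction rs with
  | nil => exact ⟨[], rfl, by simp⟩
  | cons r rs ih =>
    obtain ⟨h1, h2⟩ := List.pairwise_cons.1 h
    by_cases hr : r.arrival ≤ t
    · obtain ⟨l, hl, hlt⟩ := ih h2
      refine ⟨l, ?_, hlt⟩
      rw [known, List.filter_cons_of_pos (by simpa using hr), List.cons_append]
      congr 1
    · refine ⟨r :: rs, ?_, ?_⟩
      · rw [known, List.filter_eq_nil_iff.2, List.nil_append]
        intro x hx
        rcases List.mem_cons.1 hx with rfl | hx
        · simpa using hr
        · have := h1 x hx
          simp only [decide_eq_true_eq]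
          linarith
      · intro x hx
        rcases List.mem_cons.1 hx with rfl | hx
        · linarith
        · have := h1 x hx
          linarith

/-- On two instances with the same first `K` requests, all others arriving after time `t`, the
algorithm does the same up to time `t`. -/
theorem Sim.servicesUpTo_eq {n : ℕ} {D D' : Inst} {R R' K : ℕ} {t : ℝ} (hR : K ≤ R) (hR' : K ≤ R')
    (hD : D.Agree D' (Finset.range K)) (harr : ∀ j < K, D.arr j = D'.arr j)
    (hlate : ∀ j < R, K ≤ j → t < D.arr j) (hlate' : ∀ j < R', K ≤ j → t < D'.arr j)
    (m : ℕ) (s : Sim n) (hk : s.k ≤ K) (hP : s.P ⊆ Finset.range K) :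
    servicesUpTo ((step D R)^[m] s).out t = servicesUpTo ((step D' R')^[m] s).out t := by
  induction m generalizing s with
  | zero => rw [Function.iterate_zero, Function.iterate_zero]
  | succ m ih =>
    have hA : D.Agree D' s.P := ⟨hD.joint, hD.cost, hD.hold, hD.back,
      fun j hj => hD.item j (hP hj), fun j hj => hD.dl j (hP hj)⟩
    -- Once the common requests have arrived and nothing triggers by t, both executions are frozen
    -- up to t. Until then they take the same branch: the next arrival is a common one, or a service
    -- due by t precedes all later arrivals.
    by_cases hfr : s.k = K ∧ ¬ D.TrigBy s.P t
    · have hf : s.Frozen D R t := ⟨hfr.2, fun j hj hjk => hlate j hj (hfr.1 ▸ hjk)⟩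
      have hf' : s.Frozen D' R' t := by
        refine ⟨fun hc => hfr.2 ?_, fun j hj hjk => hlate' j hj (hfr.1 ▸ hjk)⟩
        have hne := hc.nonempty
        rw [← Inst.trig_le_iff hne] at hc ⊢
        rwa [hA.trig]
      rw [hf.servicesUpTo_iterate, hf'.servicesUpTo_iterate]
    · have hcond : (s.k < R ∧ (s.P = ∅ ∨ D.arr s.k ≤ D.trig s.P)) ↔
          (s.k < R' ∧ (s.P = ∅ ∨ D'.arr s.k ≤ D'.trig s.P)) := by
        rcases hk.lt_or_eq with hlt | heq
        · rw [harr _ hlt, hA.trig]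
          exact and_congr_left fun _ => ⟨fun _ => hlt.trans_le hR', fun _ => hlt.trans_le hR⟩
        · have htr : D.TrigBy s.P t := by
            by_contra hc; exact hfr ⟨heq, hc⟩
          have hne := htr.nonempty
          have hle := (Inst.trig_le_iff hne).2 htr
          constructor
          · rintro ⟨h1, h2⟩
            have := h2.resolve_left hne.ne_empty
            linarith [hlate _ h1 heq.ge]
          · rintro ⟨h1, h2⟩
            have := h2.resolve_left hne.ne_empty
            rw [← hA.trig] at this
            linarith [hlate' _ h1 heq.ge]
      have hstep : s.step D R = s.step D' R' := by
        unfold step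
        rw [if_congr hcond rfl rfl, hA.trig, hA.served, hA.service]
      rw [Function.iterate_succ_apply, Function.iterate_succ_apply, ← hstep]
      rcases s.step_cases D R with ⟨h1, h2, e⟩ | ⟨_, _, e⟩ | ⟨_, _, e⟩
      · have hlt : s.k < K := by
          rcases hk.lt_or_eq with hlt | heq
          · exact hlt
          · have htr : D.TrigBy s.P t := by
              by_contra hc; exact hfr ⟨heq, hc⟩
            have hne := htr.nonempty
            have hle := (Inst.trig_le_iff hne).2 htr
            linarith [hlate _ h1 heq.ge, h2 hne]
        refine ih _ ?_ ?_ <;> rw [e]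
        · exact hlt
        · exact Finset.insert_subset (Finset.mem_range.2 hlt) hP
      · refine ih _ ?_ ?_ <;> rw [e]
        · exact hk
        · exact Finset.sdiff_subset.trans hP
      · refine ih _ ?_ ?_ <;> rw [e]
        · exact hk
        · exact hP

theorem replenish_isOnline : IsOnline replenish := by
  intro n M rs rs' hrs hrs' t hknown
  obtain ⟨l, hl, hlt⟩ := known_append hrs t
  obtain ⟨l', hl', hlt'⟩ := known_append hrs' t
  rw [← hknown] at hl'
  set p := known rs t with hp
  have hget : ∀ j < p.length, rs[j]? = rs'[j]? := fun j hj => by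
    rw [hl, hl', List.getElem?_append_left hj, List.getElem?_append_left hj]
  have hlate : ∀ (q q' : List (Request n)), q = p ++ q' → (∀ r ∈ q', t < r.arrival) →
      ∀ j < q.length, p.length ≤ j → t < (M.inst q).arr j := by
    intro q q' hq hq' j hj hpj
    have : q[j]? = some q[j] := List.getElem?_eq_getElem hj
    simp only [Model.inst, this]
    refine hq' _ ?_
    subst hq
    rw [List.getElem_append_right hpj]
    exact List.getElem_mem _
  have hR : p.length ≤ rs.length := by rw [hl]; simp
  have hR' : p.length ≤ rs'.length := by rw [hl']; simp
  have e1 : replenish n M rs = ((Sim.step (M.inst rs) rs.length)^[2 * rs.length + 2 * rs'.length]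
      (Sim.init n)).out := by rw [Sim.iterate_final (by omega)]; rfl
  have e2 : replenish n M rs' = ((Sim.step (M.inst rs') rs'.length)^[2 * rs.length + 2 * rs'.length]
      (Sim.init n)).out := by rw [Sim.iterate_final (by omega)]; rfl
  rw [e1, e2]
  refine Sim.servicesUpTo_eq (D := M.inst rs) (D' := M.inst rs') (K := p.length) hR hR' ⟨rfl, rfl, rfl, rfl, fun j hj => ?_,
    fun j hj => ?_⟩ (fun j hj => ?_) (hlate rs l hl hlt) (hlate rs' l' hl' hlt') _ _
    (Nat.zero_le _) (Finset.empty_subset _)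
  · simp only [Model.inst, hget j (Finset.mem_range.1 hj)]
  · simp only [Model.inst, hget j (Finset.mem_range.1 hj)]
  · simp only [Model.inst, hget j hj]

/-! ### The events form a complete run -/

namespace Sim

variable {n : ℕ} {D : Inst} {R : ℕ}

/-- The state `s` is reached after services at the times `t 1 < ⋯ < t N`, with sets of pending
requests `P 1, …, P N`. -/
structure Trace (D : Inst) (R : ℕ) (s : Sim n) (N : ℕ) (t : ℕ → ℝ) (P : ℕ → Finset ℕ) : Prop where
  k_le : s.k ≤ R
  t_lt : ∀ {i j}, i < j → j ≤ N → t i < t j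
  mem_P : ∀ {i j}, i ≤ N →
    (j ∈ P i ↔ j < R ∧ D.arr j ≤ t i ∧ ∀ l < i, j ∉ D.served (P l) (t l))
  start : ∀ j < R, t 0 < D.arr j
  nonempty : ∀ {i}, 1 ≤ i → i ≤ N → (P i).Nonempty
  t_eq : ∀ {i}, 1 ≤ i → i ≤ N → t i = D.trig (P i)
  mem_pending : ∀ j, j ∈ s.P ↔ j < s.k ∧ ∀ l ≤ N, j ∉ D.served (P l) (t l)
  arr_le : s.P.Nonempty → ∀ j < s.k, D.arr j ≤ D.trig s.P
  frozen : s.Frozen D R (t N)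
  out_eq : s.out = ((List.range N).map fun i => D.service n (P (i + 1))).reverse

theorem trace_init {lo : ℝ} (hlo : ∀ j < R, lo < D.arr j) :
    (init n).Trace D R 0 (fun _ => lo) fun _ => ∅ where
  k_le := Nat.zero_le _
  t_lt h h' := by omega
  mem_P {i j} hi := by
    simp only [Finset.notMem_empty, false_iff, not_and]
    intro h1 h2
    linarith [hlo j h1]
  start := hlo
  nonempty h h' := by omega
  t_eq h h' := by omega
  mem_pending j := by simp [init]
  arr_le h := by simp [init] at h
  frozen := ⟨fun h => by simpa [init] using h.nonempty, fun j hj _ => hlo j hj⟩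
  out_eq := rfl

theorem Trace.step {s : Sim n} {N : ℕ} {t : ℕ → ℝ} {P : ℕ → Finset ℕ}
    (hmono : ∀ i j, i ≤ j → j < R → D.arr i ≤ D.arr j) (h : s.Trace D R N t P) :
    ∃ N' t' P', (s.step D R).Trace D R N' t' P' := by
  have hfr := h.frozen.step
  rcases s.step_cases D R with ⟨h1, h2, e⟩ | ⟨h1, h2, e⟩ | ⟨h1, h2, e⟩
  · refine ⟨N, t, P, ?_⟩
    rw [e] at hfr ⊢
    refine ⟨h1, h.t_lt, h.mem_P, h.start, h.nonempty, h.t_eq, fun j => ?_, fun _ j hj => ?_, hfr,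
      h.out_eq⟩
    · rw [Finset.mem_insert, h.mem_pending, Nat.lt_succ_iff_lt_or_eq]
      constructor
      · rintro (rfl | ⟨h3, h4⟩)
        · refine ⟨Or.inr rfl, fun l hl hs => ?_⟩
          have h3 := ((h.mem_P hl).1 (Inst.served_subset _ _ hs)).2.1
          have h4 := h.frozen.2 _ h1 le_rfl
          rcases hl.lt_or_eq with hl | rfl
          · linarith [h.t_lt hl le_rfl]
          · linarith
        · exact ⟨Or.inl h3, h4⟩
      · rintro ⟨h3 | h3, h4⟩
        · exact Or.inr ⟨h3, h4⟩
        · exact Or.inl h3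
    · refine (hmono j s.k (Nat.lt_succ_iff.1 hj) h1).trans ?_
      -- If the new trigger time preceded the arrival, the new request would be irrelevant to it,
      -- and the old pending set would have triggered a service before this arrival.
      by_contra! hlt
      have := (Inst.trigBy_trig (D := D) (Finset.insert_nonempty s.k s.P)).of_insert hlt
      linarith [h2 this.nonempty, (Inst.trig_le_iff this.nonempty).2 this]
  · set T := D.trig s.P with hT
    have hNT : t N < T := h.frozen.trig_gt h1
    refine ⟨N + 1, fun i => if i ≤ N then t i else T, fun i => if i ≤ N then P i else s.P, ?_⟩
    rw [e]
    have hlast : ∀ {i}, i ≤ N + 1 → ¬ i ≤ N → i = N + 1 := by intro i h1 h2; omega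
    have hserved : ∀ {l}, l ≤ N → D.served (if l ≤ N then P l else s.P)
        (if l ≤ N then t l else T) = D.served (P l) (t l) := by
      intro l hl; rw [if_pos hl, if_pos hl]
    refine ⟨h.k_le, fun {i j} hij hj => ?_, fun {i j} hi => ?_, ?_, fun {i} hi hi' => ?_,
      fun {i} hi hi' => ?_, fun j => ?_, fun hne j hj => ?_, ⟨?_, ?_⟩, ?_⟩
    · by_cases hjN : j ≤ N
      · simp only [hjN, (hij.le.trans hjN), if_true]
        exact h.t_lt hij hjN
      · have hiN : i ≤ N := by omega
        simp only [hjN, hiN, if_true, if_false]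
        rcases hiN.lt_or_eq with hl | rfl
        · exact (h.t_lt hl le_rfl).trans hNT
        · exact hNT
    · by_cases hiN : i ≤ N
      · simp only [hiN, if_true]
        rw [h.mem_P hiN]
        refine and_congr_right fun _ => and_congr_right fun _ => forall₂_congr fun l hl => ?_
        rw [hserved (hl.le.trans hiN)]
      · simp only [hiN, if_false]
        rw [h.mem_pending]
        obtain rfl := hlast hi hiN
        have hall : (∀ l < N + 1, j ∉ D.served (if l ≤ N then P l else s.P)
            (if l ≤ N then t l else T)) ↔ ∀ l ≤ N, j ∉ D.served (P l) (t l) := by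
          refine forall_congr' fun l => ?_
          rw [Nat.lt_succ_iff]
          exact forall_congr' fun hl => by rw [hserved hl]
        rw [hall, ← and_assoc]
        -- The requests processed so far are exactly those that have arrived by T: a service takes
        -- place only if it strictly precedes the next arrival.
        refine and_congr_left fun _ => ⟨fun hj => ⟨hj.trans_le h.k_le, h.arr_le h1 j hj⟩, ?_⟩
        rintro ⟨hjR, hjT⟩
        by_contra! hk
        linarith [h2 (hk.trans_lt hjR), hmono _ _ hk hjR]
    · simpa using h.start
    · by_cases hiN : i ≤ N
      · simp only [hiN, if_true]; exact h.nonempty hi hiN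
      · simp only [hiN, if_false]; exact h1
    · by_cases hiN : i ≤ N
      · simp only [hiN, if_true]; exact h.t_eq hi hiN
      · simp only [hiN, if_false]; exact hT
    · rw [Finset.mem_sdiff, h.mem_pending]
      constructor
      · rintro ⟨⟨h3, h4⟩, h5⟩
        refine ⟨h3, fun l hl => ?_⟩
        by_cases hlN : l ≤ N
        · rw [hserved hlN]; exact h4 l hlN
        · rw [if_neg hlN, if_neg hlN]; exact h5
      · rintro ⟨h3, h4⟩
        refine ⟨⟨h3, fun l hl => ?_⟩, ?_⟩
        · have := h4 l (hl.trans (Nat.le_succ N))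
          rwa [hserved hl] at this
        · have := h4 (N + 1) le_rfl
          rwa [if_neg (by omega), if_neg (by omega)] at this
    · refine (h.arr_le h1 j hj).trans ?_
      exact (Inst.trig_le_iff h1).2 ((Inst.trigBy_trig hne).mono Finset.sdiff_subset)
    · simp only [Nat.not_succ_le_self, if_false]
      -- This keeps the service times strictly increasing: the remaining requests cannot trigger
      -- again at the same time.
      exact Inst.not_trigBy_sdiff_served _ _
    · simp only [Nat.not_succ_le_self, if_false]
      intro j hj hk
      exact (h2 (hk.trans_lt hj)).trans_le (hmono _ _ hk hj)
    · rw [List.range_succ, List.map_append, List.reverse_append, h.out_eq]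
      simp only [List.map_cons, List.map_nil, List.reverse_cons, List.reverse_nil, List.nil_append,
        List.cons_append, Nat.not_succ_le_self, if_false]
      congr 2
      refine List.map_congr_left fun i hi => ?_
      rw [if_pos (by have := List.mem_range.1 hi; omega)]
  · exact ⟨N, t, P, by rw [e]; exact h⟩

theorem exists_run (n : ℕ) (D : Inst) (R : ℕ)
    (hmono : ∀ i j, i ≤ j → j < R → D.arr i ≤ D.arr j) :
    ∃ N, ∃ r : Inst.Run D R N, (∀ j < R, ∃ i < N, j ∈ r.S (i + 1)) ∧
      ((step D R)^[2 * R] (init n)).out =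
        ((List.range N).map fun i => D.service n (r.P (i + 1))).reverse := by
  obtain ⟨lo, hlo⟩ : ∃ lo, ∀ j < R, lo < D.arr j :=
    ⟨D.arr 0 - 1, fun j hj => by linarith [hmono 0 j (Nat.zero_le _) hj]⟩
  have hall : ∀ m, ∃ N t P, ((step D R)^[m] (init n)).Trace D R N t P := by
    intro m
    induction m with
    | zero => exact ⟨_, _, _, trace_init hlo⟩
    | succ m ih =>
      obtain ⟨N, t, P, h⟩ := ih
      obtain ⟨N', t', P', h'⟩ := h.step hmono
      rw [Function.iterate_succ_apply']
      exact ⟨N', t', P', h'⟩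
  obtain ⟨N, t, P, h⟩ := hall (2 * R)
  have hrem := remaining_iterate (D := D) (R := R) (init n) (2 * R)
  set s := (step D R)^[2 * R] (init n) with hs
  have h0 : s.remaining R = 0 := by
    simp only [remaining, init, Finset.card_empty] at hrem ⊢
    omega
  have hP : s.P = ∅ := by rw [← Finset.card_eq_zero]; unfold remaining at h0; omega
  have hk : s.k = R := by have := h.k_le; unfold remaining at h0; omega
  let r : Inst.Run D R N := ⟨t, P, h.t_lt, h.mem_P, h.start, h.nonempty, h.t_eq⟩
  refine ⟨N, r, fun j hj => ?_, h.out_eq⟩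
  have hj' := (h.mem_pending j).not.1 (by simp [hP])
  push Not at hj'
  obtain ⟨l, hl, hjl⟩ := hj' (hk.symm ▸ hj)
  have hjS : j ∈ r.S l := hjl
  have hl0 : l ≠ 0 := fun h => by
    have := Inst.Run.mem_P_of_S hjS
    rw [r.P_zero h] at this
    simp at this
  exact ⟨l - 1, by omega, by rwa [Nat.sub_add_cancel (by omega)]⟩

end Sim

/-! ## Feasibility and cost -/

section

variable {n : ℕ} (M : Model n) (rs : List (Request n))

theorem inst_arr_mono (h : InArrivalOrder rs) (i j : ℕ) (hij : i ≤ j) (hj : j < rs.length) :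
    (M.inst rs).arr i ≤ (M.inst rs).arr j := by
  rcases hij.eq_or_lt with rfl | hij
  · exact le_rfl
  · simp only [Model.inst, List.getElem?_eq_getElem hj, List.getElem?_eq_getElem (hij.trans hj)]
    exact List.pairwise_iff_getElem.1 h i j (hij.trans hj) hj hij

theorem sum_itemCost (A : Finset (Fin n)) :
    ∑ v ∈ A, M.itemCost v = ∑ v ∈ A.image Fin.val, (M.inst rs).cost v := by
  rw [Finset.sum_image fun x _ y _ h => Fin.val_injective h]
  refine Finset.sum_congr rfl fun v _ => ?_
  simp [Model.inst]

theorem delay_eq {j : ℕ} (hj : j < rs.length) (t : ℝ) :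
    (match rs[j]? with
      | some r => M.delayCost r t
      | none => 0) = (M.inst rs).delay j t := by
  simp only [Inst.delay, Model.inst, List.getElem?_eq_getElem hj, Model.delayCost]

theorem serviceCost_eq (s : Service n) (hs : ∀ i ∈ s.served, i < rs.length) :
    M.serviceCost rs s = (M.inst rs).joint + ∑ v ∈ s.items.image Fin.val, (M.inst rs).cost v +
      ∑ i ∈ s.served, (M.inst rs).delay i s.time := by
  unfold Model.serviceCost
  rw [sum_itemCost M rs]
  congr 1
  exact Finset.sum_congr rfl fun i hi => delay_eq M rs (hs i hi) _

theorem item_lt {j : ℕ} (hj : j < rs.length) : (M.inst rs).item j < n := by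
  simp only [Model.inst, List.getElem?_eq_getElem hj]
  exact Fin.is_lt _

theorem service_items {P : Finset ℕ} (hP : ∀ j ∈ P, j < rs.length) :
    (((M.inst rs).service n P).items).image Fin.val =
      (M.inst rs).incl P ((M.inst rs).trig P) := by
  ext v
  simp only [Inst.service, Finset.mem_image, Finset.mem_filter, Finset.mem_univ, true_and]
  constructor
  · rintro ⟨w, hw, rfl⟩; exact hw
  · intro hv
    obtain ⟨j, hj, rfl⟩ := Inst.mem_itemsOf.1 (Finset.mem_filter.1 hv).1
    exact ⟨⟨_, item_lt M rs (hP j hj)⟩, hv, rfl⟩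

theorem countP_range_eq_one {N : ℕ} {p : ℕ → Bool} {i : ℕ} (hi : i < N) (hp : p i = true)
    (huniq : ∀ k < N, p k = true → k = i) : (List.range N).countP p = 1 := by
  have : (List.range N).countP p = ((Finset.range N).filter fun k => p k = true).card := by
    rw [← Nat.count_eq_card_filter_range, Nat.count]
    simp
  rw [this, Finset.card_eq_one]
  refine ⟨i, ?_⟩
  ext k
  rw [Finset.mem_filter, Finset.mem_range, Finset.mem_singleton]
  exact ⟨fun h => huniq k h.1 h.2, fun h => h ▸ ⟨hi, hp⟩⟩

theorem sum_map_range (N : ℕ) (f : ℕ → ℝ) :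
    ((List.range N).map f).sum = ∑ i ∈ Finset.range N, f i := by
  induction N with
  | zero => simp
  | succ N ih => rw [List.range_succ, List.map_append, List.sum_append, ih, Finset.sum_range_succ]; simp

theorem replenish_feasible (h : InArrivalOrder rs) : Feasible rs (replenish n M rs) := by
  obtain ⟨N, r, hall, hout⟩ := Sim.exists_run n (M.inst rs) rs.length (inst_arr_mono M rs h)
  have hout' : replenish n M rs =
      ((List.range N).map fun i => (M.inst rs).service n (r.P (i + 1))).reverse := hout
  rw [hout']
  constructor
  · intro s hs j hj
    rw [List.mem_reverse, List.mem_map] at hs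
    obtain ⟨i, hi, rfl⟩ := hs
    have hi' : i + 1 ≤ N := List.mem_range.1 hi
    have hj' : j ∈ (M.inst rs).served (r.P (i + 1)) ((M.inst rs).trig (r.P (i + 1))) := hj
    have hjP := Inst.served_subset _ _ hj'
    obtain ⟨hjR, harr, _⟩ := (r.mem_P hi').1 hjP
    have hget := List.getElem?_eq_getElem hjR
    refine ⟨rs[j], hget, ?_, ?_⟩
    · have e : (M.inst rs).item j = rs[j].item := by simp only [Model.inst, hget]
      exact Finset.mem_filter.2 ⟨Finset.mem_univ _, e ▸ (Finset.mem_filter.1 hj').2.1⟩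
    · rw [r.t_eq (Nat.le_add_left 1 i) hi'] at harr
      have e : (M.inst rs).arr j = rs[j].arrival := by simp only [Model.inst, hget]
      rw [← e]
      exact harr
  · intro j hj
    obtain ⟨i, hi, hji⟩ := hall j hj
    rw [List.countP_reverse, List.countP_map]
    have hS : ∀ k < N, ((M.inst rs).service n (r.P (k + 1))).served = r.S (k + 1) := by
      intro k hk
      simp only [Inst.service, Inst.Run.S, r.t_eq (Nat.le_add_left 1 k) hk]
    refine countP_range_eq_one hi ?_ fun k hk hjk => ?_
    · simp only [Function.comp, decide_eq_true_eq, hS i hi, hji]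
    · simp only [Function.comp, decide_eq_true_eq, hS k hk] at hjk
      have := Inst.Run.S_unique (r := r) hk hi hjk hji
      omega

theorem cost_nonneg (S : Schedule n) : 0 ≤ M.cost rs S := by
  refine List.sum_nonneg fun x hx => ?_
  obtain ⟨s, _, rfl⟩ := List.mem_map.1 hx
  refine add_nonneg (add_nonneg M.jointCost_nonneg
    (Finset.sum_nonneg fun v _ => M.itemCost_nonneg v)) (Finset.sum_nonneg fun i _ => ?_)
  rcases lt_or_ge i rs.length with h | h
  · exact ((M.inst rs).delay_nonneg i s.time).trans_eq (delay_eq M rs h s.time).symm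
  · rw [List.getElem?_eq_none h]

/-- The delay of request j is one of the terms of a service that satisfies it; dropping all other
terms suffices, since only an upper bound by the cost of S is needed. -/
theorem exists_offline {S : Schedule n} (hS : Feasible rs S) (h0 : 0 < rs.length) :
    ∃ O : Inst.Offline (M.inst rs) rs.length (Fin S.length),
      ∑ s, ((M.inst rs).joint + ∑ v ∈ O.U s, (M.inst rs).cost v) +
        ∑ j ∈ Finset.range rs.length, O.del j ≤ M.cost rs S := by
  classical
  have hex : ∀ j < rs.length, ∃ s : Fin S.length, j ∈ S[s].served := by
    intro j hj
    have h2 : 0 < S.countP fun s => decide (j ∈ s.served) := by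
      convert Nat.one_pos using 1
      convert hS.2 j hj
    obtain ⟨s, hs, hjs⟩ := List.countP_pos_iff.1 h2
    obtain ⟨i, hi, rfl⟩ := List.getElem_of_mem hs
    exact ⟨⟨i, hi⟩, by simpa using hjs⟩
  have hlt : ∀ s : Fin S.length, ∀ i ∈ S[s].served, i < rs.length := by
    intro s i hi
    obtain ⟨r, hr, _⟩ := hS.1 _ (List.getElem_mem s.2) i hi
    exact (List.getElem?_eq_some_iff.1 hr).1
  -- There is a request, hence a service; `choose!` needs one as the default value for numbers that
  -- name no request.
  have : Nonempty (Fin S.length) := ⟨(hex 0 h0).choose⟩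
  choose! σ hσ using hex
  refine ⟨⟨fun s => S[s].time, fun s => S[s].items.image Fin.val, σ, fun j hj => ?_,
    fun j hj => ?_⟩, ?_⟩
  · obtain ⟨r, hr, hri, _⟩ := hS.1 _ (List.getElem_mem (σ j).2) j (hσ j hj)
    simp only [Model.inst, hr]
    exact Finset.mem_image_of_mem _ hri
  · obtain ⟨r, hr, _, hra⟩ := hS.1 _ (List.getElem_mem (σ j).2) j (hσ j hj)
    simp only [Model.inst, hr]
    exact hra
  · have hcost : M.cost rs S = ∑ s : Fin S.length, M.serviceCost rs S[s] :=
      (Fin.sum_univ_fun_getElem S (M.serviceCost rs)).symm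
    have hsum : ∑ s : Fin S.length, M.serviceCost rs S[s] =
        ∑ s : Fin S.length, ((M.inst rs).joint +
          ∑ v ∈ S[s].items.image Fin.val, (M.inst rs).cost v) +
        ∑ s : Fin S.length, ∑ i ∈ S[s].served, (M.inst rs).delay i S[s].time := by
      rw [← Finset.sum_add_distrib]
      exact Finset.sum_congr rfl fun s _ => serviceCost_eq M rs S[s] (hlt s)
    rw [hcost, hsum]
    refine add_le_add_right ?_ _
    have h1 : ∀ s : Fin S.length, ∑ i ∈ S[s].served, (M.inst rs).delay i S[s].time =
        ∑ i ∈ Finset.range rs.length,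
          if i ∈ S[s].served then (M.inst rs).delay i S[s].time else 0 := by
      intro s
      rw [← Finset.sum_filter]
      refine Finset.sum_congr ?_ fun _ _ => rfl
      ext i
      rw [Finset.mem_filter, Finset.mem_range]
      exact ⟨fun h => ⟨hlt s i h, h⟩, fun h => h.2⟩
    rw [Finset.sum_congr rfl fun s _ => h1 s, Finset.sum_comm]
    refine Finset.sum_le_sum fun j hj => ?_
    have h2 := Finset.single_le_sum (f := fun s : Fin S.length =>
      if j ∈ S[s].served then (M.inst rs).delay j S[s].time else 0) (fun s _ => by
        split_ifs
        · exact (M.inst rs).delay_nonneg _ _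
        · exact le_rfl) (Finset.mem_univ (σ j))
    rwa [if_pos (hσ j (Finset.mem_range.1 hj))] at h2

theorem replenish_isCompetitive : IsCompetitive 30 replenish := by
  intro n M rs h
  refine ⟨replenish_feasible M rs h, fun S hS => ?_⟩
  rcases rs.length.eq_zero_or_pos with h0 | h0
  · have : replenish n M rs = [] := by
      unfold replenish
      rw [h0]
      rfl
    rw [this]
    have := cost_nonneg M rs S
    simp only [Model.cost, List.map_nil, List.sum_nil] at this ⊢
    linarith
  obtain ⟨O, hO⟩ := exists_offline M rs hS h0
  obtain ⟨N, r, _, hout⟩ := Sim.exists_run n (M.inst rs) rs.length (inst_arr_mono M rs h)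
  have hout' : replenish n M rs =
      ((List.range N).map fun i => (M.inst rs).service n (r.P (i + 1))).reverse := hout
  refine le_trans (le_of_eq ?_) ((r.cost_le O).trans (mul_le_mul_of_nonneg_left hO (by norm_num)))
  rw [hout', Model.cost, List.map_reverse, List.sum_reverse, List.map_map, sum_map_range]
  refine Finset.sum_congr rfl fun i hi => ?_
  have hi' : i + 1 ≤ N := Finset.mem_range.1 hi
  have hP : ∀ j ∈ r.P (i + 1), j < rs.length := fun j hj => Inst.Run.lt_of_mem_P hi' hj
  rw [Function.comp, serviceCost_eq M rs _ fun j hj => hP j (Inst.served_subset _ _ hj),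
    service_items M rs hP, r.t_eq (Nat.le_add_left 1 i) hi']
  simp only [Inst.service, Inst.Run.S, r.t_eq (Nat.le_add_left 1 i) hi']

end

/-! ## Reasoning about programs -/

section Runs

variable {n : ℕ} (M : Model n) (rs : List (Request n))

/-- Started in the state `σ`, the program halts after at most `T` steps, in a state with `Q`. -/
def Runs (p : Prog) (T : ℕ) (σ : State n) (Q : State n → Prop) : Prop :=
  ∃ T' σ', Exec M rs p σ T' σ' ∧ T' ≤ T ∧ Q σ'

variable {M rs}

theorem Runs.mono {p : Prog} {T T' : ℕ} {σ : State n} {Q Q' : State n → Prop}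
    (h : Runs M rs p T σ Q) (hT : T ≤ T') (hQ : ∀ σ', Q σ' → Q' σ') : Runs M rs p T' σ Q' := by
  obtain ⟨U, τ, h1, h2, h3⟩ := h
  exact ⟨U, τ, h1, h2.trans hT, hQ τ h3⟩

theorem Runs.seq {p q : Prog} {T U : ℕ} {σ : State n} {Q Q' : State n → Prop}
    (h : Runs M rs p T σ Q) (h' : ∀ σ', Q σ' → Runs M rs q U σ' Q') :
    Runs M rs (.seq p q) (T + U) σ Q' := by
  obtain ⟨T', τ, h1, h2, h3⟩ := h
  obtain ⟨U', υ, g1, g2, g3⟩ := h' τ h3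
  exact ⟨T' + U', υ, .seq h1 g1, add_le_add h2 g2, g3⟩

theorem Runs.ite {c : Test} {p q : Prog} {T : ℕ} {σ : State n} {Q : State n → Prop}
    (h : c.Holds M rs σ → Runs M rs p T σ Q) (h' : ¬ c.Holds M rs σ → Runs M rs q T σ Q) :
    Runs M rs (.ite c p q) (T + 1) σ Q := by
  by_cases hc : c.Holds M rs σ
  · obtain ⟨T', τ, h1, h2, h3⟩ := h hc
    exact ⟨T' + 1, τ, .iteTrue hc h1, Nat.succ_le_succ h2, h3⟩
  · obtain ⟨T', τ, h1, h2, h3⟩ := h' hc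
    exact ⟨T' + 1, τ, .iteFalse hc h1, Nat.succ_le_succ h2, h3⟩

theorem Runs.skip {σ : State n} {Q : State n → Prop} (h : Q σ) : Runs M rs .skip 1 σ Q :=
  ⟨1, σ, .skip σ, le_rfl, h⟩

theorem Runs.setNat {x : ℕ} {i e : NExp} {σ : State n} {Q : State n → Prop}
    (h : Q { σ with nmem := store σ.nmem x (i.eval rs σ) (e.eval rs σ) }) :
    Runs M rs (.setNat x i e) 1 σ Q :=
  ⟨1, _, .setNat x i e σ, le_rfl, h⟩

theorem Runs.setReal {x : ℕ} {i : NExp} {e : RExp} {σ : State n} {Q : State n → Prop}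
    (h : Q { σ with rmem := store σ.rmem x (i.eval rs σ) (e.eval M rs σ) }) :
    Runs M rs (.setReal x i e) 1 σ Q :=
  ⟨1, _, .setReal x i e σ, le_rfl, h⟩

theorem Runs.newService {e : RExp} {σ : State n} {Q : State n → Prop}
    (h : Q { σ with out := ⟨e.eval M rs σ, ∅, ∅⟩ :: σ.out }) :
    Runs M rs (.newService e) 1 σ Q :=
  ⟨1, _, .newService e σ, le_rfl, h⟩

theorem Runs.addItem {e : NExp} {σ : State n} {Q : State n → Prop}
    (h : Q { σ with out := modifyLast (Service.addItem (e.eval rs σ)) σ.out }) :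
    Runs M rs (.addItem e) 1 σ Q :=
  ⟨1, _, .addItem e σ, le_rfl, h⟩

theorem Runs.serve {e : NExp} {σ : State n} {Q : State n → Prop}
    (h : Q { σ with out := modifyLast (Service.serve (e.eval rs σ)) σ.out }) :
    Runs M rs (.serve e) 1 σ Q :=
  ⟨1, _, .serve e σ, le_rfl, h⟩

end Runs

/-! ### Frame conditions for the registers -/

theorem store_apply {α : Type} (mem : ℕ → ℕ → α) (x i : ℕ) (a : α) (y : ℕ) :
    store mem x i a y = if y = x then Function.update (mem x) i a else mem y := by
  unfold store
  split_ifs with h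
  · rw [h, Function.update_self]
  · rw [Function.update_of_ne h]

/-- The states agree, except on the arrays `N` of natural numbers, the arrays `Q` of real numbers,
and the output. -/
structure Same {n : ℕ} (N Q : List ℕ) (σ σ' : State n) : Prop where
  nmem : ∀ x, x ∉ N → σ'.nmem x = σ.nmem x
  rmem : ∀ x, x ∉ Q → σ'.rmem x = σ.rmem x

namespace Same

variable {n : ℕ} {N N' Q Q' : List ℕ} {σ₁ σ₂ σ₃ : State n}

theorem refl (N Q : List ℕ) (σ : State n) : Same N Q σ σ := ⟨fun _ _ => rfl, fun _ _ => rfl⟩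

theorem trans (h : Same N Q σ₁ σ₂) (h' : Same N Q σ₂ σ₃) : Same N Q σ₁ σ₃ :=
  ⟨fun x hx => (h'.nmem x hx).trans (h.nmem x hx), fun x hx => (h'.rmem x hx).trans (h.rmem x hx)⟩

theorem mono (h : Same N Q σ₁ σ₂) (hN : N ⊆ N') (hQ : Q ⊆ Q') : Same N' Q' σ₁ σ₂ :=
  ⟨fun x hx => h.nmem x fun h => hx (hN h), fun x hx => h.rmem x fun h => hx (hQ h)⟩

theorem store_nmem (h : Same N Q σ₁ σ₂) {x : ℕ} (hx : x ∈ N) (i v : ℕ) :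
    Same N Q σ₁ { σ₂ with nmem := store σ₂.nmem x i v } :=
  ⟨fun y hy => by
    rw [← h.nmem y hy]
    simp only [store_apply, if_neg (ne_of_mem_of_not_mem hx hy).symm], h.rmem⟩

theorem store_rmem (h : Same N Q σ₁ σ₂) {x : ℕ} (hx : x ∈ Q) (i : ℕ) (v : ℝ) :
    Same N Q σ₁ { σ₂ with rmem := store σ₂.rmem x i v } :=
  ⟨h.nmem, fun y hy => by
    rw [← h.rmem y hy]
    simp only [store_apply, if_neg (ne_of_mem_of_not_mem hx hy).symm]⟩

theorem set_out (h : Same N Q σ₁ σ₂) (o : Schedule n) : Same N Q σ₁ { σ₂ with out := o } :=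
  ⟨h.nmem, h.rmem⟩

end Same

/-! ### Loops -/

/-- The entry `0` of an array of natural numbers, used as a variable. -/
def NExp.var (x : ℕ) : NExp := .get x (.const 0)

/-- The entry `0` of an array of real numbers, used as a variable. -/
def RExp.var (x : ℕ) : RExp := .get x (.const 0)

/-- Execute `p` with the values `0, …, b - 1` of the variable `i`. -/
def Prog.forLoop (i : ℕ) (b : NExp) (p : Prog) : Prog :=
  .seq (.setNat i (.const 0) (.const 0))
    (.while (.neg (.nle b (.var i)))
      (.seq p (.setNat i (.const 0) (.add (.var i) (.const 1)))))

/-- Let the real variable `x` be the sum of `e` over all `i < b` with `c`. -/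
def Prog.sumLoop (x i : ℕ) (b : NExp) (c : Test) (e : RExp) : Prog :=
  .seq (.setReal x (.const 0) (.atom (.nat (.const 0))))
    (.forLoop i b (.ite c (.setReal x (.const 0) (.add (.var x) e)) .skip))

/-- Let the variable `x` be the number of `i < b` with `c`. -/
def Prog.countLoop (x i : ℕ) (b : NExp) (c : Test) : Prog :=
  .seq (.setNat x (.const 0) (.const 0))
    (.forLoop i b (.ite c (.setNat x (.const 0) (.add (.var x) (.const 1))) .skip))

/-- Let the real variable `x` be the minimum of `e` over all `i < b` with `c`, and let the variable
`y` indicate whether there are any. -/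
def Prog.minLoop (y x i : ℕ) (b : NExp) (c : Test) (e : RExp) : Prog :=
  .seq (.setNat y (.const 0) (.const 0))
    (.forLoop i b (.ite (.and c (.neg (.and (.nle (.const 1) (.var y)) (.rle (.var x) e))))
      (.seq (.setReal x (.const 0) e) (.setNat y (.const 0) (.const 1))) .skip))

section Loops

variable {n : ℕ} {M : Model n} {rs : List (Request n)}

/-- The summand 2 pays for the test and the increment in each round, and the extra round for the
initialization and the final test. The bound is stated with some q above B so that all nested loops
can be measured by one parameter. -/
theorem Runs.forLoop {i B q T : ℕ} {b : NExp} {p : Prog} {σ : State n}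
    (Inv : ℕ → State n → Prop) (hb : ∀ σ' : State n, b.eval rs σ' = B) (hBq : B ≤ q)
    (h0 : Inv 0 { σ with nmem := store σ.nmem i 0 0 })
    (hstep : ∀ k < B, ∀ σ', Inv k σ' → σ'.nmem i 0 = k → Runs M rs p T σ' fun σ'' =>
      σ''.nmem i 0 = k ∧ Inv (k + 1) { σ'' with nmem := store σ''.nmem i 0 (k + 1) }) :
    Runs M rs (.forLoop i b p) ((q + 1) * (T + 2)) σ (Inv B) := by
  have main : ∀ d k, k + d = B → ∀ σ', Inv k σ' → σ'.nmem i 0 = k →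
      Runs M rs (.while (.neg (.nle b (.var i)))
        (.seq p (.setNat i (.const 0) (.add (.var i) (.const 1))))) (d * (T + 2) + 1) σ'
        (Inv B) := by
    intro d
    induction d with
    | zero =>
      intro k hk σ' hI hik
      refine ⟨1, σ', .whileFalse ?_, by omega, ?_⟩
      · simp only [Test.Holds, NExp.var, NExp.eval, hb, hik]; omega
      · rwa [show B = k by omega]
    | succ d ih =>
      intro k hk σ' hI hik
      obtain ⟨T₁, σ₁, h1, h2, h3, h4⟩ := hstep k (by omega) σ' hI hik
      obtain ⟨T₂, σ₂, g1, g2, g3⟩ := ih (k + 1) (by omega)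
        { σ₁ with nmem := store σ₁.nmem i 0 (k + 1) } h4 (by simp [store_apply])
      refine ⟨(T₁ + 1) + T₂ + 1, σ₂, .whileTrue ?_ (.seq h1 (.setNat _ _ _ _)) ?_, ?_, g3⟩
      · simp only [Test.Holds, NExp.var, NExp.eval, hb, hik]; omega
      · simpa only [NExp.var, NExp.eval, h3] using g1
      · rw [Nat.succ_mul]; omega
  have h1 := main B 0 (by omega) { σ with nmem := store σ.nmem i 0 0 } h0 (by simp [store_apply])
  have h2 : Runs M rs (.setNat i (.const 0) (.const 0)) 1 σ
      (fun σ' => σ' = { σ with nmem := store σ.nmem i 0 0 }) := Runs.setNat rfl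
  refine (h2.seq (U := B * (T + 2) + 1) fun σ' hσ' => by rw [hσ']; exact h1).mono ?_ fun _ h => h
  have : B * (T + 2) ≤ q * (T + 2) := Nat.mul_le_mul_right _ hBq
  rw [Nat.succ_mul]
  omega

theorem Runs.sumLoop {x i B q : ℕ} {b : NExp} {c : Test} {e : RExp} {σ : State n}
    (p : ℕ → Prop) [DecidablePred p] (f : ℕ → ℝ)
    (hb : ∀ σ' : State n, b.eval rs σ' = B) (hBq : B ≤ q)
    (h : ∀ k < B, ∀ σ', Same [i] [x] σ σ' → σ'.nmem i 0 = k →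
      (c.Holds M rs σ' ↔ p k) ∧ (p k → e.eval M rs σ' = f k)) :
    Runs M rs (.sumLoop x i b c e) (5 * (q + 1)) σ fun σ' =>
      Same [i] [x] σ σ' ∧ σ'.out = σ.out ∧ σ'.rmem x 0 = ∑ k ∈ Finset.range B with p k, f k := by
  refine (Runs.seq (Runs.setReal (Q := fun σ' => Same [i] [x] σ σ' ∧ σ'.out = σ.out ∧
    σ'.rmem x 0 = 0) ?_) (U := (q + 1) * (2 + 2)) fun σ₁ h₁ => ?_).mono (by omega) fun _ h => h
  · refine ⟨(Same.refl _ _ _).store_rmem (List.mem_singleton_self x) _ _, rfl, ?_⟩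
    simp [NExp.eval, RExp.eval, Atom.eval, store_apply]
  refine Runs.forLoop (fun k σ' => Same [i] [x] σ σ' ∧ σ'.out = σ.out ∧
    σ'.rmem x 0 = ∑ k ∈ Finset.range k with p k, f k) hb hBq ?_ ?_
  · exact ⟨h₁.1.store_nmem (List.mem_singleton_self i) _ _, h₁.2.1, by simpa using h₁.2.2⟩
  · rintro k hk σ' ⟨hS, ho, hx⟩ hik
    obtain ⟨hc, he⟩ := h k hk σ' hS hik
    rw [Finset.sum_filter] at hx
    refine Runs.ite (fun hh => Runs.setReal ?_) fun hh => Runs.skip ?_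
    · refine ⟨hik, ((hS.store_rmem (List.mem_singleton_self x) _ _).store_nmem
        (List.mem_singleton_self i) _ _), ho, ?_⟩
      rw [Finset.sum_filter, Finset.sum_range_succ, if_pos (hc.1 hh), ← hx, ← he (hc.1 hh)]
      simp [NExp.eval, RExp.eval, RExp.var, store_apply]
    · refine ⟨hik, hS.store_nmem (List.mem_singleton_self i) _ _, ho, ?_⟩
      rw [Finset.sum_filter, Finset.sum_range_succ, if_neg fun h => hh (hc.2 h), add_zero, ← hx]

theorem Runs.countLoop {x i B q : ℕ} {b : NExp} {c : Test} {σ : State n} (hxi : x ≠ i)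
    (p : ℕ → Prop) [DecidablePred p] (hb : ∀ σ' : State n, b.eval rs σ' = B) (hBq : B ≤ q)
    (h : ∀ k < B, ∀ σ', Same [i, x] [] σ σ' → σ'.nmem i 0 = k → (c.Holds M rs σ' ↔ p k)) :
    Runs M rs (.countLoop x i b c) (5 * (q + 1)) σ fun σ' =>
      Same [i, x] [] σ σ' ∧ σ'.out = σ.out ∧
        σ'.nmem x 0 = ((Finset.range B).filter p).card := by
  have hx : x ∈ [i, x] := by simp
  have hi : i ∈ [i, x] := by simp
  refine (Runs.seq (Runs.setNat (Q := fun σ' => Same [i, x] [] σ σ' ∧ σ'.out = σ.out ∧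
    σ'.nmem x 0 = 0) ?_) (U := (q + 1) * (2 + 2)) fun σ₁ h₁ => ?_).mono (by omega) fun _ h => h
  · refine ⟨(Same.refl _ _ _).store_nmem hx _ _, rfl, ?_⟩
    simp [NExp.eval, store_apply]
  refine Runs.forLoop (fun k σ' => Same [i, x] [] σ σ' ∧ σ'.out = σ.out ∧
    σ'.nmem x 0 = ((Finset.range k).filter p).card) hb hBq ?_ ?_
  · exact ⟨h₁.1.store_nmem hi _ _, h₁.2.1, by simpa [store_apply, hxi] using h₁.2.2⟩
  · rintro k hk σ' ⟨hS, ho, hval⟩ hik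
    have hc := h k hk σ' hS hik
    refine Runs.ite (fun hh => Runs.setNat ?_) fun hh => Runs.skip ?_
    · refine ⟨?_, (hS.store_nmem hx _ _).store_nmem hi _ _, ho, ?_⟩
      · simpa [store_apply, hxi.symm] using hik
      · rw [Finset.range_add_one, Finset.filter_insert, if_pos (hc.1 hh),
          Finset.card_insert_of_notMem (by simp), ← hval]
        simp [NExp.eval, NExp.var, store_apply, hxi]
    · refine ⟨hik, hS.store_nmem hi _ _, ho, ?_⟩
      rw [Finset.range_add_one, Finset.filter_insert, if_neg fun h => hh (hc.2 h), ← hval]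
      simp [store_apply, hxi]

theorem Runs.minLoop {y x i B q : ℕ} {b : NExp} {c : Test} {e : RExp} {σ : State n} (hyi : y ≠ i)
    (p : ℕ → Prop) (f : ℕ → ℝ)
    (hb : ∀ σ' : State n, b.eval rs σ' = B) (hBq : B ≤ q)
    (h : ∀ k < B, ∀ σ', Same [i, y] [x] σ σ' → σ'.nmem i 0 = k →
      (c.Holds M rs σ' ↔ p k) ∧ (p k → e.eval M rs σ' = f k)) :
    Runs M rs (.minLoop y x i b c e) (6 * (q + 1)) σ fun σ' =>
      Same [i, y] [x] σ σ' ∧ σ'.out = σ.out ∧ (1 ≤ σ'.nmem y 0 ↔ ∃ k < B, p k) ∧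
        (1 ≤ σ'.nmem y 0 → ∃ k < B, p k ∧ σ'.rmem x 0 = f k) ∧
        ∀ k < B, p k → σ'.rmem x 0 ≤ f k := by
  have hy : y ∈ [i, y] := by simp
  have hi : i ∈ [i, y] := by simp
  refine (Runs.seq (Runs.setNat (Q := fun σ' => Same [i, y] [x] σ σ' ∧ σ'.out = σ.out ∧
    σ'.nmem y 0 = 0) ?_) (U := (q + 1) * (3 + 2)) fun σ₁ h₁ => ?_).mono (by omega) fun _ h => h
  · refine ⟨(Same.refl _ _ _).store_nmem hy _ _, rfl, ?_⟩
    simp [NExp.eval, store_apply]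
  refine Runs.forLoop (fun m σ' => Same [i, y] [x] σ σ' ∧ σ'.out = σ.out ∧
    (1 ≤ σ'.nmem y 0 ↔ ∃ k < m, p k) ∧
        (1 ≤ σ'.nmem y 0 → ∃ k < m, p k ∧ σ'.rmem x 0 = f k) ∧
        ∀ k < m, p k → σ'.rmem x 0 ≤ f k) hb hBq ?_ ?_
  · refine ⟨h₁.1.store_nmem hi _ _, h₁.2.1, ?_, ?_, ?_⟩ <;> simp [store_apply, hyi, h₁.2.2]
  · rintro k hk σ' ⟨hS, ho, h1, h2, h3⟩ hik
    obtain ⟨hc, he⟩ := h k hk σ' hS hik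
    refine Runs.ite (fun hh => Runs.seq (T := 1) (U := 1) (Runs.setReal (Q := fun σ'' => σ'' = _) rfl)
      ?_) fun hh => (Runs.skip ?_).mono (by omega) fun _ h => h
    · rintro _ rfl
      have hpk := hc.1 hh.1
      refine Runs.setNat ⟨?_, ((hS.store_rmem (List.mem_singleton_self x) _ _).store_nmem
        hy _ _).store_nmem hi _ _, ho, ?_, ?_, ?_⟩
      · simpa [store_apply, hyi.symm] using hik
      · simp only [NExp.eval, store_apply, if_neg hyi, if_true, Function.update_self, le_refl,
          true_iff]
        exact ⟨k, Nat.lt_succ_self k, hpk⟩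
      · intro _
        refine ⟨k, Nat.lt_succ_self k, hpk, ?_⟩
        simp [NExp.eval, store_apply, he hpk]
      · intro l hl hpl
        simp only [NExp.eval, store_apply, if_true, Function.update_self, he hpk]
        rcases Nat.lt_succ_iff_lt_or_eq.1 hl with hl | rfl
        · have hf := h1.2 ⟨l, hl, hpl⟩
          have := hh.2
          simp only [Test.Holds, NExp.eval, NExp.var, RExp.var, RExp.eval, hf, true_and, not_le,
            he hpk] at this
          linarith [h3 l hl hpl]
        · exact le_rfl
    -- The minimum is left alone only if k does not qualify, or a candidate exists already and the
    -- stored value is at most the new one.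
    · have hcase : p k → 1 ≤ σ'.nmem y 0 ∧ σ'.rmem x 0 ≤ f k := by
        intro hpk
        by_contra hcon
        refine hh ⟨hc.2 hpk, ?_⟩
        simpa only [Test.Holds, NExp.eval, NExp.var, RExp.var, RExp.eval, he hpk] using hcon
      refine ⟨hik, hS.store_nmem hi _ _, ho, ?_, ?_, ?_⟩
      · simp only [store_apply, if_neg hyi]
        refine h1.trans ⟨fun ⟨l, hl, hpl⟩ => ⟨l, hl.trans (Nat.lt_succ_self k), hpl⟩, ?_⟩
        rintro ⟨l, hl, hpl⟩
        rcases Nat.lt_succ_iff_lt_or_eq.1 hl with hl | rfl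
        · exact ⟨l, hl, hpl⟩
        · exact h1.1 (hcase hpl).1
      · simp only [store_apply, if_neg hyi]
        intro hf
        obtain ⟨l, hl, hpl⟩ := h2 hf
        exact ⟨l, hl.trans (Nat.lt_succ_self k), hpl⟩
      · intro l hl hpl
        rcases Nat.lt_succ_iff_lt_or_eq.1 hl with hl | rfl
        · exact h3 l hl hpl
        · exact (hcase hpl).2

end Loops

/-! ## The program

Arrays of natural numbers: `0` number of arrived requests, `1` pending requests, `2` number of events,
`3` and `4` loop variables, `5` counter, `6` items of pending requests, `7` included items,
`8` requests to be satisfied, `9` whether there are pending requests. Arrays of real numbers: `0` and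
`6` sums, `1` to `4` the values of `Inst.cand`, `Inst.tau`, `Inst.key` and `Inst.cross`, `5` the
time of the next service. -/

namespace Prog

def pending (e : NExp) : Test := .nle (.const 1) (.get 1 e)

def natEq (e₁ e₂ : NExp) : Test := .and (.nle e₁ e₂) (.nle e₂ e₁)

def dl (e : NExp) : RExp := .atom (.deadline e)

def candLoop : Prog :=
  let c : Test := .and (pending (.var 4)) (.and (natEq (.item (.var 4)) (.item (.var 3)))
    (.rle (dl (.var 4)) (dl (.var 3))))
  .forLoop 3 .numRequests <|
    .seq (.sumLoop 0 4 .numRequests c (dl (.var 4))) <|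
    .seq (.countLoop 5 4 .numRequests c) <|
    .setReal 1 (.var 3) (.div (.add (.div (.atom (.itemCost (.item (.var 3)))) .backRate) (.var 0))
      (.nat (.var 5)))

def tauLoop : Prog :=
  .forLoop 3 .numItems <|
    .seq (.minLoop 5 0 4 .numRequests (.and (pending (.var 4)) (natEq (.item (.var 4)) (.var 3)))
      (.get 1 (.var 4))) <|
    .seq (.setNat 6 (.var 3) (.var 5)) <|
    .setReal 2 (.var 3) (.var 0)

def keyLoop : Prog :=
  .forLoop 3 .numRequests <|
    .ite (.rle (dl (.var 3)) (.get 2 (.item (.var 3))))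
      (.setReal 3 (.var 3) (.get 2 (.item (.var 3))))
      (.setReal 3 (.var 3) (dl (.var 3)))

def crossLoop : Prog :=
  let c : Test := .and (pending (.var 4)) (.rle (.get 3 (.var 4)) (.get 3 (.var 3)))
  .forLoop 3 .numRequests <|
    .seq (.sumLoop 0 4 .numItems
      (.and (.nle (.const 1) (.get 6 (.var 4))) (.rle (.get 2 (.var 4)) (.get 3 (.var 3))))
      (.atom (.itemCost (.var 4)))) <|
    .seq (.sumLoop 6 4 .numRequests c (dl (.var 4))) <|
    .seq (.countLoop 5 4 .numRequests c) <|
    .setReal 4 (.var 3) (.div (.add (.div (.add (.atom .jointCost) (.var 0)) .backRate) (.var 6))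
      (.nat (.var 5)))

def trigLoop : Prog := .minLoop 9 5 3 .numRequests (pending (.var 3)) (.get 4 (.var 3))

/-- Compute the time of the next service. -/
def plan : Prog := .seq candLoop (.seq tauLoop (.seq keyLoop (.seq crossLoop trigLoop)))

def inclLoop : Prog :=
  .forLoop 3 .numItems <|
    .seq (.sumLoop 0 4 .numItems
      (.and (.nle (.const 1) (.get 6 (.var 4))) (.and (.neg (.rle (.get 2 (.var 4)) (.var 5)))
        (.rle (.get 2 (.var 4)) (.get 2 (.var 3)))))
      (.atom (.itemCost (.var 4)))) <|
    .ite (.and (.nle (.const 1) (.get 6 (.var 3))) (.rle (.var 0) (.atom .jointCost)))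
      (.seq (.setNat 7 (.var 3) (.const 1)) (.addItem (.var 3)))
      (.setNat 7 (.var 3) (.const 0))

/-- The disjunction of the two holding rules is written with negations, because tests offer only
`neg` and `and`. -/
def serveLoop : Prog :=
  let late : Test := .and (.neg (.rle (dl (.var 4)) (.var 5))) (.rle (dl (.var 4)) (dl (.var 3)))
  let e : RExp := .mul (.sub (dl (.var 4)) (.var 5)) .holdRate
  .forLoop 3 .numRequests <|
    .seq (.sumLoop 0 4 .numRequests
      (.and (pending (.var 4)) (.and (natEq (.item (.var 4)) (.item (.var 3))) late)) e) <|
    .seq (.sumLoop 6 4 .numRequests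
      (.and (pending (.var 4)) (.and (.nle (.const 1) (.get 7 (.item (.var 4)))) late)) e) <|
    .ite (.and (pending (.var 3)) (.and (.nle (.const 1) (.get 7 (.item (.var 3))))
        (.neg (.and (.neg (.rle (.var 0) (.atom (.itemCost (.item (.var 3))))))
          (.neg (.rle (.var 6) (.atom .jointCost)))))))
      (.seq (.setNat 8 (.var 3) (.const 1)) (.serve (.var 3)))
      (.setNat 8 (.var 3) (.const 0))

def removeLoop : Prog :=
  .forLoop 3 .numRequests <|
    .ite (.nle (.const 1) (.get 8 (.var 3))) (.setNat 1 (.var 3) (.const 0)) .skip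

/-- Carry out a service. -/
def service : Prog :=
  .seq (.newService (.var 5)) (.seq inclLoop (.seq serveLoop removeLoop))

/-- Process the next event. -/
def step : Prog :=
  .seq plan <|
    .ite (.and (.neg (.nle .numRequests (.var 0)))
        (.neg (.and (.nle (.const 1) (.var 9)) (.neg (.rle (.atom (.arrival (.var 0))) (.var 5))))))
      (.seq (.setNat 1 (.var 0) (.const 1)) (.setNat 0 (.const 0) (.add (.var 0) (.const 1))))
      (.ite (.nle (.const 1) (.var 9)) service .skip)

/-- The program for `replenish`. -/
def replenish : Prog := .forLoop 2 (.add .numRequests .numRequests) step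

end Prog

/-! ### Correctness of the program -/

section Correctness

variable {n : ℕ} {M : Model n} {rs : List (Request n)}

theorem eval_natVar (x : ℕ) (σ : State n) : (NExp.var x).eval rs σ = σ.nmem x 0 := rfl

theorem eval_realVar (x : ℕ) (σ : State n) : (RExp.var x).eval M rs σ = σ.rmem x 0 := rfl

theorem eval_const (k : ℕ) (σ : State n) : (NExp.const k).eval rs σ = k := rfl

theorem eval_get (x : ℕ) (e : NExp) (σ : State n) :
    (NExp.get x e).eval rs σ = σ.nmem x (e.eval rs σ) := rfl

theorem eval_numRequests (σ : State n) : NExp.numRequests.eval rs σ = rs.length := rfl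

theorem eval_natAdd (e₁ e₂ : NExp) (σ : State n) :
    (NExp.add e₁ e₂).eval rs σ = e₁.eval rs σ + e₂.eval rs σ := rfl

theorem eval_natAtom (e : NExp) (σ : State n) :
    (Atom.nat e).eval M rs σ = (e.eval rs σ : ℝ) := rfl

theorem eval_item (M : Model n) (e : NExp) (σ : State n) :
    (NExp.item e).eval rs σ = (M.inst rs).item (e.eval rs σ) := rfl

theorem eval_itemCost (e : NExp) (σ : State n) :
    (Atom.itemCost e).eval M rs σ = (M.inst rs).cost (e.eval rs σ) := rfl

theorem eval_arrival (e : NExp) (σ : State n) :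
    (Atom.arrival e).eval M rs σ = (M.inst rs).arr (e.eval rs σ) := rfl

theorem eval_deadline (e : NExp) (σ : State n) :
    (Atom.deadline e).eval M rs σ = (M.inst rs).dl (e.eval rs σ) := rfl

theorem eval_jointCost (σ : State n) : Atom.jointCost.eval M rs σ = (M.inst rs).joint := rfl

theorem eval_holdRate (σ : State n) : Atom.holdRate.eval M rs σ = (M.inst rs).hold := rfl

theorem eval_backRate (σ : State n) : Atom.backRate.eval M rs σ = (M.inst rs).back := rfl

theorem filter_range_mem {P : Finset ℕ} {R : ℕ} (hP : P ⊆ Finset.range R) (p : ℕ → Prop)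
    [DecidablePred p] : ((Finset.range R).filter fun j => j ∈ P ∧ p j) = P.filter p := by
  ext j
  simp only [Finset.mem_filter]
  exact ⟨fun h => h.2, fun h => ⟨hP h.1, h⟩⟩

/-- A loop over `i < B` that fills the entries of `x` and `y`, with the output `o k` before the
iteration `k`. -/
theorem Runs.fill {i B q T x y : ℕ} {b : NExp} {p : Prog} {σ : State n} {N Q : List ℕ}
    (G : ℕ → ℕ → ℝ → Prop) (o : ℕ → Schedule n) (hi : i ∈ N) (hxi : x ≠ i)
    (hb : ∀ σ' : State n, b.eval rs σ' = B) (hBq : B ≤ q) (ho : σ.out = o 0)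
    (h : ∀ k < B, ∀ σ', Same N Q σ σ' → σ'.out = o k → (∀ j, k ≤ j → σ'.nmem x j = σ.nmem x j) →
      σ'.nmem i 0 = k → Runs M rs p T σ' fun σ'' => Same N Q σ σ'' ∧ σ''.out = o (k + 1) ∧
        σ''.nmem i 0 = k ∧ G k (σ''.nmem x k) (σ''.rmem y k) ∧
        ∀ j ≠ k, σ''.nmem x j = σ'.nmem x j ∧ σ''.rmem y j = σ'.rmem y j) :
    Runs M rs (.forLoop i b p) ((q + 1) * (T + 2)) σ fun σ' => Same N Q σ σ' ∧ σ'.out = o B ∧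
      (∀ j, B ≤ j → σ'.nmem x j = σ.nmem x j) ∧ ∀ j < B, G j (σ'.nmem x j) (σ'.rmem y j) := by
  refine Runs.forLoop (fun k σ' => Same N Q σ σ' ∧ σ'.out = o k ∧
      (∀ j, k ≤ j → σ'.nmem x j = σ.nmem x j) ∧ ∀ j < k, G j (σ'.nmem x j) (σ'.rmem y j))
    hb hBq ?_ ?_
  · refine ⟨(Same.refl _ _ _).store_nmem hi _ _, ho, fun j _ => ?_, fun j hj => by omega⟩
    simp [store_apply, hxi]
  · rintro k hk σ' ⟨hS, ho', hx, hG⟩ hik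
    refine (h k hk σ' hS ho' hx hik).mono le_rfl ?_
    rintro σ'' ⟨hS', ho'', hik', hGk, hne⟩
    refine ⟨hik', hS'.store_nmem hi _ _, ho'', ?_, ?_⟩
    · intro j hj
      simp only [store_apply, if_neg hxi]
      rw [(hne j (by omega)).1, hx j (by omega)]
    · intro j hj
      simp only [store_apply, if_neg hxi]
      rcases Nat.lt_succ_iff_lt_or_eq.1 hj with hj | rfl
      · rw [(hne j hj.ne).1, (hne j hj.ne).2]; exact hG j hj
      · exact hGk

variable {P : Finset ℕ} {σ : State n} {q : ℕ}

/-! ### Correctness of the computed trigger time -/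

theorem runs_candLoop (hq : n + rs.length ≤ q) (hP : P ⊆ Finset.range rs.length)
    (hpend : ∀ j, 1 ≤ σ.nmem 1 j ↔ j ∈ P) :
    Runs M rs Prog.candLoop ((q + 1) * (5 * (q + 1) + (5 * (q + 1) + 1) + 2)) σ fun σ' =>
      Same [3, 4, 5] [0, 1] σ σ' ∧ σ'.out = σ.out ∧
        ∀ j < rs.length, σ'.rmem 1 j = (M.inst rs).cand P j := by
  -- The array 0 of natural numbers is a dummy here: only the real array 1 is filled.
  refine (Runs.fill (x := 0) (y := 1) (N := [3, 4, 5]) (Q := [0, 1])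
    (fun j _ z => z = (M.inst rs).cand P j) (fun _ => σ.out) (by decide) (by decide)
    (fun _ => rfl) (by omega) rfl ?_).mono le_rfl fun σ' h => ⟨h.1, h.2.1, h.2.2.2⟩
  intro k hk σ₁ hS₁ ho₁ _ hA
  refine (Runs.sumLoop (fun j => j ∈ P ∧ (M.inst rs).item j = (M.inst rs).item k ∧
    (M.inst rs).dl j ≤ (M.inst rs).dl k) (M.inst rs).dl (fun _ => rfl)
    (by omega) ?_).seq fun σ₂ h₂ => (Runs.countLoop (by decide)
    (fun j => j ∈ P ∧ (M.inst rs).item j = (M.inst rs).item k ∧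
    (M.inst rs).dl j ≤ (M.inst rs).dl k) (fun _ => rfl) (by omega) ?_).seq fun σ₃ h₃ =>
    Runs.setReal ?_
  · intro j hj σ' hS hB
    simp only [Test.Holds, Prog.pending, Prog.natEq, Prog.dl, eval_const, eval_get, RExp.eval, eval_item M,
      eval_deadline, eval_natVar, hB, hS.nmem 3 (by decide), hS.nmem 1 (by decide),
      hS₁.nmem 1 (by decide), hA, hpend, ← le_antisymm_iff, implies_true, and_true]
  · intro j hj σ' hS hB
    simp only [Test.Holds, Prog.pending, Prog.natEq, Prog.dl, eval_const, eval_get, RExp.eval, eval_item M,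
      eval_deadline, eval_natVar, hB, hS.nmem 3 (by decide), hS.nmem 1 (by decide),
      h₂.1.nmem 3 (by decide), h₂.1.nmem 1 (by decide),
      hS₁.nmem 1 (by decide), hA, hpend, ← le_antisymm_iff]
  · obtain ⟨hS₂, ho₂, hx₂⟩ := h₂
    obtain ⟨hS₃, ho₃, hx₃⟩ := h₃
    have hA₃ : σ₃.nmem 3 0 = k := by
      rw [hS₃.nmem 3 (by decide), hS₂.nmem 3 (by decide), hA]
    refine ⟨((hS₁.trans (hS₂.mono (by decide) (by decide))).trans
      (hS₃.mono (by decide) (by decide))).store_rmem (by decide) _ _,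
      ho₃.trans (ho₂.trans ho₁), hA₃, ?_, fun j hj => ?_⟩
    -- This also covers requests outside P, whose count may be 0: the machine and `cand` use the
    -- same convention for division by 0.
    · simp only [eval_natVar, hA₃, store_apply, if_true, Function.update_self, RExp.eval,
        eval_itemCost, eval_item M, eval_backRate, eval_realVar, eval_natAtom, hx₃,
        hS₃.rmem 0 (by decide), hx₂, filter_range_mem hP]
      rfl
    · simp only [eval_natVar, hA₃, store_apply, if_true, Function.update_of_ne hj]
      rw [hS₃.nmem 0 (by decide), hS₂.nmem 0 (by decide), hS₃.rmem 1 (by decide),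
        hS₂.rmem 1 (by decide)]
      exact ⟨rfl, rfl⟩

/-- Items without pending requests keep a meaningless entry in the real array 2; array 6 marks the
items whose entry may be used. -/
theorem runs_tauLoop (hq : n + rs.length ≤ q) (hP : P ⊆ Finset.range rs.length)
    (hpend : ∀ j, 1 ≤ σ.nmem 1 j ↔ j ∈ P)
    (hcand : ∀ j < rs.length, σ.rmem 1 j = (M.inst rs).cand P j) :
    Runs M rs Prog.tauLoop ((q + 1) * (6 * (q + 1) + (1 + 1) + 2)) σ fun σ' =>
      Same [3, 4, 5, 6] [0, 2] σ σ' ∧ σ'.out = σ.out ∧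
        ∀ v < n, (1 ≤ σ'.nmem 6 v ↔ v ∈ (M.inst rs).itemsOf P) ∧
          (v ∈ (M.inst rs).itemsOf P → σ'.rmem 2 v = (M.inst rs).tau P v) := by
  refine (Runs.fill (x := 6) (y := 2) (N := [3, 4, 5, 6]) (Q := [0, 2])
    (fun v m z => (1 ≤ m ↔ v ∈ (M.inst rs).itemsOf P) ∧
      (v ∈ (M.inst rs).itemsOf P → z = (M.inst rs).tau P v)) (fun _ => σ.out) (by decide)
    (by decide) (fun _ => rfl) (by omega) rfl ?_).mono le_rfl fun σ' h => ⟨h.1, h.2.1, h.2.2.2⟩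
  intro k hk σ₁ hS₁ ho₁ _ hA
  refine (Runs.minLoop (by decide) (fun j => j ∈ P ∧ (M.inst rs).item j = k)
    ((M.inst rs).cand P) (fun _ => rfl) (by omega) ?_).seq fun σ₂ h₂ =>
    (Runs.setNat (Q := fun σ' => σ' = _) rfl).seq fun σ₃ h₃ => Runs.setReal ?_
  · intro j hj σ' hS hB
    simp only [Test.Holds, Prog.pending, Prog.natEq, eval_const, eval_get, RExp.eval, eval_item M,
      eval_natVar, hB, hS.nmem 3 (by decide), hS.nmem 1 (by decide),
      hS₁.nmem 1 (by decide), hA, hpend, ← le_antisymm_iff, true_and, hS.rmem 1 (by decide),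
      hS₁.rmem 1 (by decide), hcand j hj, implies_true]
  · obtain ⟨hS₂, ho₂, hflag, hmin, hle⟩ := h₂
    subst h₃
    have hA₂ : σ₂.nmem 3 0 = k := by rw [hS₂.nmem 3 (by decide), hA]
    have hiff : (∃ j < rs.length, j ∈ P ∧ (M.inst rs).item j = k) ↔
        k ∈ (M.inst rs).itemsOf P := by
      rw [Inst.mem_itemsOf]
      exact ⟨fun ⟨j, _, h⟩ => ⟨j, h⟩, fun ⟨j, h⟩ => ⟨j, Finset.mem_range.1 (hP h.1), h⟩⟩
    refine ⟨((hS₁.trans (hS₂.mono (by decide) (by decide))).store_nmem (by decide) _ _).store_rmem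
      (by decide) _ _, ho₂.trans ho₁, ?_, ⟨?_, fun hk => ?_⟩, fun j hj => ?_⟩
    · simpa [store_apply] using hA₂
    · rw [← hiff, ← hflag]
      simp [store_apply, eval_natVar, hA₂]
    · simp only [eval_natVar, store_apply, hA₂, if_true, Nat.reduceEqDiff, if_false,
        Function.update_self, eval_realVar]
      obtain ⟨j, hj, ⟨hjP, hjk⟩, hval⟩ := hmin (hflag.2 (hiff.2 hk))
      rw [Inst.tau, dif_pos (Inst.ofItem_nonempty.2 hk)]
      refine le_antisymm (Finset.le_inf' _ _ fun i hi => ?_) ?_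
      · exact hle i (Finset.mem_range.1 (hP (Inst.mem_ofItem.1 hi).1)) (Inst.mem_ofItem.1 hi)
      · rw [hval]
        exact Finset.inf'_le _ (Inst.mem_ofItem.2 ⟨hjP, hjk⟩)
    · simp only [eval_natVar, store_apply, hA₂, if_true, Nat.reduceEqDiff, if_false,
        Function.update_of_ne hj]
      rw [hS₂.nmem 6 (by decide), hS₂.rmem 2 (by decide)]
      exact ⟨rfl, rfl⟩

theorem runs_keyLoop (hq : n + rs.length ≤ q) (hP : P ⊆ Finset.range rs.length)
    (htau : ∀ v < n, v ∈ (M.inst rs).itemsOf P → σ.rmem 2 v = (M.inst rs).tau P v) :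
    Runs M rs Prog.keyLoop ((q + 1) * (1 + 1 + 2)) σ fun σ' =>
      Same [3] [3] σ σ' ∧ σ'.out = σ.out ∧ ∀ j ∈ P, σ'.rmem 3 j = (M.inst rs).key P j := by
  refine (Runs.fill (x := 0) (y := 3) (N := [3]) (Q := [3])
    (fun j _ z => j ∈ P → z = (M.inst rs).key P j) (fun _ => σ.out) (by decide) (by decide)
    (fun _ => rfl) (by omega) rfl ?_).mono le_rfl fun σ' h => ⟨h.1, h.2.1, fun j hj =>
      h.2.2.2 j (Finset.mem_range.1 (hP hj)) hj⟩
  intro k hk σ₁ hS₁ ho₁ _ hA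
  have htau' : k ∈ P → σ₁.rmem 2 ((M.inst rs).item k) = (M.inst rs).tau P ((M.inst rs).item k) :=
    fun hkP => by
      rw [hS₁.rmem 2 (by decide)]
      exact htau _ (item_lt M rs hk) (Inst.item_mem_itemsOf hkP)
  refine Runs.ite (fun hc => Runs.setReal ?_) fun hc => Runs.setReal ?_
  all_goals
    simp only [Test.Holds, Prog.dl, RExp.eval, eval_item M, eval_deadline, eval_natVar, hA] at hc
    refine ⟨hS₁.store_rmem (by decide) _ _, ho₁, hA, fun hkP => ?_, fun j hj => ?_⟩
    · simp only [Prog.dl, RExp.eval, eval_item M, eval_deadline, eval_natVar, hA,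
        store_apply, if_true, Function.update_self]
      rw [htau' hkP] at hc
      first
        | rw [htau' hkP]; exact (max_eq_right hc).symm
        | exact (max_eq_left (not_le.1 hc).le).symm
    · simp only [eval_natVar, hA, store_apply, if_true, Function.update_of_ne hj]
      exact ⟨trivial, trivial⟩

theorem sum_itemsOf (hP : P ⊆ Finset.range rs.length) (p : ℕ → Prop) [DecidablePred p]
    (f : ℕ → ℝ) : ∑ v ∈ Finset.range n with v ∈ (M.inst rs).itemsOf P ∧ p v, f v =
      ∑ v ∈ (M.inst rs).itemsOf P with p v, f v := by
  refine Finset.sum_congr (filter_range_mem (fun v hv => ?_) p) fun _ _ => rfl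
  obtain ⟨j, hj, rfl⟩ := Inst.mem_itemsOf.1 hv
  exact Finset.mem_range.2 (item_lt M rs (Finset.mem_range.1 (hP hj)))

theorem runs_crossLoop (hq : n + rs.length ≤ q) (hP : P ⊆ Finset.range rs.length)
    (hpend : ∀ j, 1 ≤ σ.nmem 1 j ↔ j ∈ P)
    (htau : ∀ v < n, (1 ≤ σ.nmem 6 v ↔ v ∈ (M.inst rs).itemsOf P) ∧
      (v ∈ (M.inst rs).itemsOf P → σ.rmem 2 v = (M.inst rs).tau P v))
    (hkey : ∀ j ∈ P, σ.rmem 3 j = (M.inst rs).key P j) :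
    Runs M rs Prog.crossLoop
      ((q + 1) * (5 * (q + 1) + (5 * (q + 1) + (5 * (q + 1) + 1)) + 2)) σ fun σ' =>
      Same [3, 4, 5] [0, 4, 6] σ σ' ∧ σ'.out = σ.out ∧
        ∀ j ∈ P, σ'.rmem 4 j = (M.inst rs).cross P j := by
  refine (Runs.fill (x := 0) (y := 4) (N := [3, 4, 5]) (Q := [0, 4, 6])
    (fun j _ z => j ∈ P → z = (M.inst rs).cross P j) (fun _ => σ.out) (by decide) (by decide)
    (fun _ => rfl) (by omega) rfl ?_).mono le_rfl fun σ' h => ⟨h.1, h.2.1, fun j hj =>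
      h.2.2.2 j (Finset.mem_range.1 (hP hj)) hj⟩
  intro k hk σ₁ hS₁ ho₁ _ hA
  have hreq : ∀ (j : ℕ) (σ' : State n), Same [4, 5] [0, 6] σ₁ σ' → σ'.nmem 4 0 = j →
      ((Test.and (Prog.pending (.var 4)) (.rle (.get 3 (.var 4)) (.get 3 (.var 3)))).Holds M rs σ' ↔
        j ∈ P ∧ (M.inst rs).key P j ≤ σ.rmem 3 k) := by
    intro j σ' hS hB
    simp only [Test.Holds, Prog.pending, eval_const, eval_get, RExp.eval, eval_natVar, hB,
      hS.nmem 3 (by decide), hS.nmem 1 (by decide), hS.rmem 3 (by decide),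
      hS₁.nmem 1 (by decide), hS₁.rmem 3 (by decide), hA, hpend]
    exact and_congr_right fun hj => by rw [hkey j hj]
  refine (Runs.sumLoop (fun v => v ∈ (M.inst rs).itemsOf P ∧ (M.inst rs).tau P v ≤ σ.rmem 3 k)
    (M.inst rs).cost (fun _ => rfl) (by omega) ?_).seq fun σ₂ h₂ =>
    (Runs.sumLoop (fun j => j ∈ P ∧ (M.inst rs).key P j ≤ σ.rmem 3 k) (M.inst rs).dl
      (fun _ => rfl) (by omega) ?_).seq fun σ₃ h₃ =>
    (Runs.countLoop (by decide) (fun j => j ∈ P ∧ (M.inst rs).key P j ≤ σ.rmem 3 k)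
      (fun _ => rfl) (by omega) ?_).seq fun σ₄ h₄ => Runs.setReal ?_
  · intro v hv σ' hS hB
    simp only [Test.Holds, eval_const, eval_get, RExp.eval, eval_natVar, eval_itemCost, hB,
      hS.nmem 3 (by decide), hS.nmem 6 (by decide), hS.rmem 2 (by decide), hS.rmem 3 (by decide),
      hS₁.nmem 6 (by decide), hS₁.rmem 2 (by decide), hS₁.rmem 3 (by decide), hA, (htau v hv).1,
      implies_true, and_true]
    exact and_congr_right fun hvP => by rw [(htau v hv).2 hvP]
  · intro j hj σ' hS hB
    refine ⟨hreq j σ' ((h₂.1.mono (by decide) (by decide)).trans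
      (hS.mono (by decide) (by decide))) hB, fun _ => ?_⟩
    simp only [Prog.dl, RExp.eval, eval_deadline, eval_natVar, hB]
  · intro j hj σ' hS hB
    exact hreq j σ' (((h₂.1.mono (by decide) (by decide)).trans
      (h₃.1.mono (by decide) (by decide))).trans (hS.mono (by decide) (by decide))) hB
  · obtain ⟨hS₂, ho₂, hx₂⟩ := h₂
    obtain ⟨hS₃, ho₃, hx₃⟩ := h₃
    obtain ⟨hS₄, ho₄, hx₄⟩ := h₄
    have hA₄ : σ₄.nmem 3 0 = k := by
      rw [hS₄.nmem 3 (by decide), hS₃.nmem 3 (by decide), hS₂.nmem 3 (by decide), hA]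
    refine ⟨(((hS₁.trans (hS₂.mono (by decide) (by decide))).trans
      (hS₃.mono (by decide) (by decide))).trans
      (hS₄.mono (by decide) (by decide))).store_rmem (by decide) _ _,
      ho₄.trans (ho₃.trans (ho₂.trans ho₁)), hA₄, fun hkP => ?_, fun j hj => ?_⟩
    · simp only [eval_natVar, hA₄, store_apply, if_true, Function.update_self, RExp.eval,
        eval_jointCost, eval_backRate, eval_realVar, eval_natAtom, hx₄, hS₄.rmem 0 (by decide),
        hS₃.rmem 0 (by decide), hx₂, hS₄.rmem 6 (by decide), hx₃, hkey k hkP, filter_range_mem hP,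
        sum_itemsOf hP]
      rfl
    · simp only [eval_natVar, hA₄, store_apply, if_true, Function.update_of_ne hj]
      rw [hS₄.nmem 0 (by decide), hS₃.nmem 0 (by decide), hS₂.nmem 0 (by decide),
        hS₄.rmem 4 (by decide), hS₃.rmem 4 (by decide), hS₂.rmem 4 (by decide)]
      exact ⟨rfl, rfl⟩

theorem runs_trigLoop (hq : n + rs.length ≤ q) (hP : P ⊆ Finset.range rs.length)
    (hpend : ∀ j, 1 ≤ σ.nmem 1 j ↔ j ∈ P)
    (hcross : ∀ j ∈ P, σ.rmem 4 j = (M.inst rs).cross P j) :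
    Runs M rs Prog.trigLoop (6 * (q + 1)) σ fun σ' =>
      Same [3, 9] [5] σ σ' ∧ σ'.out = σ.out ∧ (1 ≤ σ'.nmem 9 0 ↔ P.Nonempty) ∧
        (P.Nonempty → σ'.rmem 5 0 = (M.inst rs).trig P) := by
  refine (Runs.minLoop (by decide) (fun j => j ∈ P) ((M.inst rs).cross P) (fun _ => rfl)
    (by omega) ?_).mono le_rfl ?_
  · intro j hj σ' hS hA
    simp only [Test.Holds, Prog.pending, eval_const, eval_get, RExp.eval, eval_natVar, hA,
      hS.nmem 1 (by decide), hS.rmem 4 (by decide), hpend, true_and]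
    exact hcross j
  · rintro σ' ⟨hS, ho, hflag, hmin, hle⟩
    have hiff : (∃ j < rs.length, j ∈ P) ↔ P.Nonempty :=
      ⟨fun ⟨j, _, h⟩ => ⟨j, h⟩, fun ⟨j, h⟩ => ⟨j, Finset.mem_range.1 (hP h), h⟩⟩
    refine ⟨hS, ho, hflag.trans hiff, fun hne => ?_⟩
    obtain ⟨j, _, hjP, hval⟩ := hmin (hflag.2 (hiff.2 hne))
    rw [Inst.trig, dif_pos hne]
    refine le_antisymm (Finset.le_inf' _ _ fun i hi => hle i (Finset.mem_range.1 (hP hi)) hi) ?_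
    rw [hval]
    exact Finset.inf'_le _ hjP

/-- The number of steps of `Prog.plan`. -/
def planTime (q : ℕ) : ℕ :=
  (q + 1) * (5 * (q + 1) + (5 * (q + 1) + 1) + 2) + ((q + 1) * (6 * (q + 1) + (1 + 1) + 2) +
    ((q + 1) * (1 + 1 + 2) + ((q + 1) * (5 * (q + 1) + (5 * (q + 1) + (5 * (q + 1) + 1)) + 2) +
      6 * (q + 1))))

/-- The entries for items and for the next service are correct for the pending requests `P`. -/
structure Planned (M : Model n) (rs : List (Request n)) (P : Finset ℕ) (σ : State n) : Prop where
  mem_itemsOf : ∀ v < n, (1 ≤ σ.nmem 6 v ↔ v ∈ (M.inst rs).itemsOf P)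
  tau : ∀ v ∈ (M.inst rs).itemsOf P, σ.rmem 2 v = (M.inst rs).tau P v
  nonempty : 1 ≤ σ.nmem 9 0 ↔ P.Nonempty
  trig : P.Nonempty → σ.rmem 5 0 = (M.inst rs).trig P

theorem itemsOf_lt (hP : P ⊆ Finset.range rs.length) {v : ℕ} (hv : v ∈ (M.inst rs).itemsOf P) :
    v < n := by
  obtain ⟨j, hj, rfl⟩ := Inst.mem_itemsOf.1 hv
  exact item_lt M rs (Finset.mem_range.1 (hP hj))

theorem runs_plan (hq : n + rs.length ≤ q) (hP : P ⊆ Finset.range rs.length)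
    (hpend : ∀ j, 1 ≤ σ.nmem 1 j ↔ j ∈ P) :
    Runs M rs Prog.plan (planTime q) σ fun σ' =>
      Same [3, 4, 5, 6, 9] [0, 1, 2, 3, 4, 5, 6] σ σ' ∧ σ'.out = σ.out ∧ Planned M rs P σ' := by
  refine (runs_candLoop hq hP hpend).seq fun σ₁ ⟨hS₁, ho₁, h₁⟩ =>
    (runs_tauLoop hq hP ?_ h₁).seq fun σ₂ ⟨hS₂, ho₂, h₂⟩ =>
    (runs_keyLoop hq hP fun v hv => (h₂ v hv).2).seq fun σ₃ ⟨hS₃, ho₃, h₃⟩ =>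
    (runs_crossLoop hq hP ?_ ?_ h₃).seq fun σ₄ ⟨hS₄, ho₄, h₄⟩ =>
    (runs_trigLoop hq hP ?_ h₄).mono le_rfl fun σ₅ ⟨hS₅, ho₅, h₅, h₆⟩ => ?_
  · rw [hS₁.nmem 1 (by decide)]; exact hpend
  · rw [hS₃.nmem 1 (by decide), hS₂.nmem 1 (by decide), hS₁.nmem 1 (by decide)]; exact hpend
  · rw [hS₃.nmem 6 (by decide), hS₃.rmem 2 (by decide)]; exact h₂
  · rw [hS₄.nmem 1 (by decide), hS₃.nmem 1 (by decide), hS₂.nmem 1 (by decide),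
      hS₁.nmem 1 (by decide)]
    exact hpend
  · refine ⟨((((hS₁.mono (by decide) (by decide)).trans (hS₂.mono (by decide) (by decide))).trans
      (hS₃.mono (by decide) (by decide))).trans (hS₄.mono (by decide) (by decide))).trans
      (hS₅.mono (by decide) (by decide)),
      ho₅.trans (ho₄.trans (ho₃.trans (ho₂.trans ho₁))), fun v hv => ?_, fun v hv => ?_, h₅, h₆⟩
    · rw [hS₅.nmem 6 (by decide), hS₄.nmem 6 (by decide), hS₃.nmem 6 (by decide)]
      exact (h₂ v hv).1
    · rw [hS₅.rmem 2 (by decide), hS₄.rmem 2 (by decide), hS₃.rmem 2 (by decide)]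
      exact (h₂ v (itemsOf_lt hP hv)).2 hv

/-! ### Correctness of the program for a service -/

theorem addItem_filter {k : ℕ} (hk : k < n) (t : ℝ) (I : Finset ℕ) (S : Finset ℕ) :
    Service.addItem k (⟨t, Finset.univ.filter fun v : Fin n => (v : ℕ) < k ∧ (v : ℕ) ∈ I, S⟩) =
      ⟨t, Finset.univ.filter fun v : Fin n => (v : ℕ) < k + 1 ∧ ((v : ℕ) ∈ I ∨ (v : ℕ) = k), S⟩ := by
  unfold Service.addItem
  rw [dif_pos hk]
  congr 1
  ext v
  simp only [Finset.mem_insert, Finset.mem_filter, Finset.mem_univ, true_and, Fin.ext_iff,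
    Nat.lt_succ_iff_lt_or_eq]
  tauto

/-- The service at time `t` after the items below `k` have been considered. -/
def partialItems (n : ℕ) (t : ℝ) (I : Finset ℕ) (k : ℕ) : Service n :=
  ⟨t, Finset.univ.filter fun v : Fin n => (v : ℕ) < k ∧ (v : ℕ) ∈ I, ∅⟩

theorem runs_inclLoop {t : ℝ} {out : Schedule n} (hq : n + rs.length ≤ q)
    (hP : P ⊆ Finset.range rs.length) (hplan : Planned M rs P σ) (ht : σ.rmem 5 0 = t)
    (hout : σ.out = ⟨t, ∅, ∅⟩ :: out) :
    Runs M rs Prog.inclLoop ((q + 1) * (5 * (q + 1) + (1 + 1 + 1) + 2)) σ fun σ' =>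
      Same [3, 4, 7] [0] σ σ' ∧ σ'.out =
        ⟨t, Finset.univ.filter fun v : Fin n => (v : ℕ) ∈ (M.inst rs).incl P t, ∅⟩ :: out ∧
        ∀ v < n, (1 ≤ σ'.nmem 7 v ↔ v ∈ (M.inst rs).incl P t) := by
  set I := (M.inst rs).incl P t with hI
  refine (Runs.fill (x := 7) (y := 1) (N := [3, 4, 7]) (Q := [0])
    (fun v m _ => 1 ≤ m ↔ v ∈ I) (fun k => partialItems n t I k :: out) (by decide)
    (by decide) (fun _ => rfl) (by omega) ?_ ?_).mono le_rfl fun σ' h => ⟨h.1, ?_, h.2.2.2⟩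
  · rw [hout]; simp [partialItems]
  · intro k hk σ₁ hS₁ ho₁ _ hA
    refine (Runs.sumLoop (fun v => v ∈ (M.inst rs).itemsOf P ∧ t < (M.inst rs).tau P v ∧
      (M.inst rs).tau P v ≤ σ.rmem 2 k) (M.inst rs).cost (fun _ => rfl) (by omega)
      ?_).seq fun σ₂ h₂ => ?_
    · intro v hv σ' hS hB
      simp only [Test.Holds, eval_const, eval_get, RExp.eval, eval_natVar, eval_realVar,
        eval_itemCost, hB, hS.nmem 3 (by decide), hS.nmem 6 (by decide), hS.rmem 2 (by decide),
        hS.rmem 5 (by decide), hS₁.nmem 6 (by decide), hS₁.rmem 2 (by decide),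
        hS₁.rmem 5 (by decide), hA, ht, hplan.mem_itemsOf v hv, not_le, implies_true, and_true]
      exact and_congr_right fun hvP => by rw [hplan.tau v hvP]
    · obtain ⟨hS₂, ho₂, hx₂⟩ := h₂
      have hA₂ : σ₂.nmem 3 0 = k := by rw [hS₂.nmem 3 (by decide), hA]
      have hS := hS₁.trans (hS₂.mono (N' := [3, 4, 7]) (Q' := [0]) (by decide) (by decide))
      have hcond : (Test.and (.nle (.const 1) (.get 6 (.var 3)))
          (.rle (.var 0) (.atom .jointCost))).Holds M rs σ₂ ↔ k ∈ I := by
        simp only [Test.Holds, eval_const, eval_get, RExp.eval, eval_natVar, eval_realVar,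
          eval_jointCost, hA₂, hS.nmem 6 (by decide), hplan.mem_itemsOf k hk, hx₂]
        rw [hI, Inst.incl, Finset.mem_filter]
        refine and_congr_right fun hkP => ?_
        rw [sum_itemsOf hP (fun v => t < (M.inst rs).tau P v ∧ (M.inst rs).tau P v ≤ σ.rmem 2 k),
          hplan.tau k hkP]
      refine Runs.ite (fun hc => (Runs.setNat (Q := fun σ' => σ' = _) rfl).seq fun σ₃ h₃ =>
        Runs.addItem ?_) fun hc => (Runs.setNat ?_).mono (by omega) fun _ h => h
      · subst h₃
        have hkI := hcond.1 hc
        refine ⟨(hS.store_nmem (by decide) _ _).set_out _, ?_, ?_, ?_, fun j hj => ?_⟩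
        · simp only [eval_natVar, store_apply, hA₂, ho₂, ho₁, Nat.reduceEqDiff, if_false,
            modifyLast, partialItems, addItem_filter hk]
          congr 2
          ext v
          simp only [Finset.mem_filter, Finset.mem_univ, true_and]
          refine and_congr_right fun _ => ⟨?_, Or.inl⟩
          rintro (h | h)
          · exact h
          · rwa [h]
        · simp [store_apply, hA₂]
        · simp [store_apply, hA₂, eval_natVar, eval_const, hkI]
        · simp only [store_apply, hA₂, eval_natVar, if_true, Function.update_of_ne hj]
          rw [hS₂.nmem 7 (by decide), hS₂.rmem 1 (by decide)]
          exact ⟨rfl, rfl⟩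
      · have hkI := hcond.not.1 hc
        refine ⟨hS.store_nmem (by decide) _ _, ?_, ?_, ?_, fun j hj => ?_⟩
        · simp only [ho₂, ho₁, partialItems]
          congr 2
          ext v
          simp only [Finset.mem_filter, Finset.mem_univ, true_and]
          constructor
          · rintro ⟨h1, h2⟩; exact ⟨by omega, h2⟩
          · rintro ⟨h1, h2⟩
            refine ⟨lt_of_le_of_ne (Nat.lt_succ_iff.1 h1) fun h => hkI (h ▸ h2), h2⟩
        · simp [store_apply, hA₂]
        · simp [store_apply, hA₂, eval_natVar, eval_const, hkI]
        · simp only [store_apply, hA₂, eval_natVar, if_true, Function.update_of_ne hj]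
          rw [hS₂.nmem 7 (by decide), hS₂.rmem 1 (by decide)]
          exact ⟨rfl, rfl⟩
  · rw [h.2.1]
    simp [partialItems]

theorem runs_serveLoop {t : ℝ} {I : Finset (Fin n)} {out : Schedule n} (hq : n + rs.length ≤ q)
    (hP : P ⊆ Finset.range rs.length) (hpend : ∀ j, 1 ≤ σ.nmem 1 j ↔ j ∈ P)
    (hincl : ∀ v < n, (1 ≤ σ.nmem 7 v ↔ v ∈ (M.inst rs).incl P t)) (ht : σ.rmem 5 0 = t)
    (hout : σ.out = ⟨t, I, ∅⟩ :: out) :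
    Runs M rs Prog.serveLoop ((q + 1) * (5 * (q + 1) + (5 * (q + 1) + (1 + 1 + 1)) + 2)) σ
      fun σ' => Same [3, 4, 8] [0, 6] σ σ' ∧
        σ'.out = ⟨t, I, (M.inst rs).served P t⟩ :: out ∧
        ∀ j < rs.length, (1 ≤ σ'.nmem 8 j ↔ j ∈ (M.inst rs).served P t) := by
  set S := (M.inst rs).served P t with hSdef
  have hSR : ∀ j ∈ S, j < rs.length := fun j hj =>
    Finset.mem_range.1 (hP (Inst.served_subset _ _ hj))
  refine (Runs.fill (x := 8) (y := 1) (N := [3, 4, 8]) (Q := [0, 6])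
    (fun j m _ => 1 ≤ m ↔ j ∈ S) (fun k => ⟨t, I, S.filter (· < k)⟩ :: out) (by decide)
    (by decide) (fun _ => rfl) (by omega) ?_ ?_).mono le_rfl fun σ' h => ⟨h.1, ?_, h.2.2.2⟩
  · rw [hout]; simp
  · intro k hk σ₁ hS₁ ho₁ _ hA
    refine (Runs.sumLoop (fun j => j ∈ P ∧ (M.inst rs).item j = (M.inst rs).item k ∧
      t < (M.inst rs).dl j ∧ (M.inst rs).dl j ≤ (M.inst rs).dl k)
      (fun j => (M.inst rs).hold * ((M.inst rs).dl j - t)) (fun _ => rfl) (by omega)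
      ?_).seq fun σ₂ h₂ => (Runs.sumLoop (fun j => j ∈ P ∧
        (M.inst rs).item j ∈ (M.inst rs).incl P t ∧
      t < (M.inst rs).dl j ∧ (M.inst rs).dl j ≤ (M.inst rs).dl k)
      (fun j => (M.inst rs).hold * ((M.inst rs).dl j - t)) (fun _ => rfl) (by omega)
      ?_).seq fun σ₃ h₃ => ?_
    · intro j hj σ' hS hB
      simp only [Test.Holds, Prog.pending, Prog.natEq, Prog.dl, eval_const, eval_get, RExp.eval,
        eval_natVar, eval_realVar, eval_item M, eval_deadline, eval_holdRate, hB,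
        hS.nmem 3 (by decide), hS.nmem 1 (by decide), hS.rmem 5 (by decide),
        hS₁.nmem 1 (by decide), hS₁.rmem 5 (by decide), hA, ht, hpend, ← le_antisymm_iff, not_le,
        mul_comm, implies_true, and_true]
    · intro j hj σ' hS hB
      have hS' := (hS₁.trans (h₂.1.mono (by decide) (by decide))).trans
        (hS.mono (by decide) (by decide))
      have hA' : σ'.nmem 3 0 = k := by rw [hS.nmem 3 (by decide), h₂.1.nmem 3 (by decide), hA]
      simp only [Test.Holds, Prog.pending, Prog.dl, eval_const, eval_get, RExp.eval,
        eval_natVar, eval_realVar, eval_item M, eval_deadline, eval_holdRate, hB, hA',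
        hS'.nmem 7 (by decide), hS'.nmem 1 (by decide), hS'.rmem 5 (by decide), ht, hpend,
        hincl _ (item_lt M rs hj), not_le, mul_comm, implies_true, and_true]
    · obtain ⟨hS₂, ho₂, hx₂⟩ := h₂
      obtain ⟨hS₃, ho₃, hx₃⟩ := h₃
      have hA₃ : σ₃.nmem 3 0 = k := by
        rw [hS₃.nmem 3 (by decide), hS₂.nmem 3 (by decide), hA]
      have hSS := (hS₁.trans (hS₂.mono (N' := [3, 4, 8]) (Q' := [0, 6]) (by decide)
        (by decide))).trans (hS₃.mono (by decide) (by decide))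
      have hcond : (Test.and (Prog.pending (.var 3)) (.and (.nle (.const 1)
          (.get 7 (.item (.var 3))))
          (.neg (.and (.neg (.rle (.var 0) (.atom (.itemCost (.item (.var 3))))))
          (.neg (.rle (.var 6) (.atom .jointCost))))))).Holds M rs σ₃ ↔ k ∈ S := by
        simp only [Test.Holds, Prog.pending, eval_const, eval_get, RExp.eval, eval_natVar,
          eval_realVar, eval_jointCost, eval_itemCost, eval_item M, hA₃, hSS.nmem 1 (by decide),
          hSS.nmem 7 (by decide), hpend, hincl _ (item_lt M rs hk), hx₃, hS₃.rmem 0 (by decide),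
          hx₂, filter_range_mem hP]
        rw [hSdef, Inst.served, Finset.mem_filter, ← or_iff_not_and_not]
        rfl
      refine Runs.ite (fun hc => (Runs.setNat (Q := fun σ' => σ' = _) rfl).seq fun σ₄ h₄ =>
        Runs.serve ?_) fun hc => (Runs.setNat ?_).mono (by omega) fun _ h => h
      · subst h₄
        have hkS := hcond.1 hc
        refine ⟨(hSS.store_nmem (by decide) _ _).set_out _, ?_, ?_, ?_, fun j hj => ?_⟩
        · simp only [eval_natVar, store_apply, hA₃, ho₃, ho₂, ho₁, Nat.reduceEqDiff, if_false,
            modifyLast, Service.serve]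
          congr 2
          ext j
          simp only [Finset.mem_insert, Finset.mem_filter, Nat.lt_succ_iff_lt_or_eq]
          constructor
          · rintro (rfl | ⟨h1, h2⟩)
            · exact ⟨hkS, Or.inr rfl⟩
            · exact ⟨h1, Or.inl h2⟩
          · rintro ⟨h1, h2 | h2⟩
            · exact Or.inr ⟨h1, h2⟩
            · exact Or.inl h2
        · simp [store_apply, hA₃]
        · simp [store_apply, hA₃, eval_natVar, eval_const, hkS]
        · simp only [store_apply, hA₃, eval_natVar, if_true, Function.update_of_ne hj]
          rw [hS₃.nmem 8 (by decide), hS₂.nmem 8 (by decide), hS₃.rmem 1 (by decide),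
            hS₂.rmem 1 (by decide)]
          exact ⟨rfl, rfl⟩
      · have hkS := hcond.not.1 hc
        refine ⟨hSS.store_nmem (by decide) _ _, ?_, ?_, ?_, fun j hj => ?_⟩
        · simp only [ho₃, ho₂, ho₁]
          congr 2
          ext j
          simp only [Finset.mem_filter]
          refine and_congr_right fun h1 => ⟨fun h => by omega, fun h =>
            lt_of_le_of_ne (Nat.lt_succ_iff.1 h) fun h => hkS (h ▸ h1)⟩
        · simp [store_apply, hA₃]
        · simp [store_apply, hA₃, eval_natVar, eval_const, hkS]
        · simp only [store_apply, hA₃, eval_natVar, if_true, Function.update_of_ne hj]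
          rw [hS₃.nmem 8 (by decide), hS₂.nmem 8 (by decide), hS₃.rmem 1 (by decide),
            hS₂.rmem 1 (by decide)]
          exact ⟨rfl, rfl⟩
  · rw [h.2.1, Finset.filter_true_of_mem hSR]

theorem runs_removeLoop {S : Finset ℕ} (hq : n + rs.length ≤ q)
    (hP : P ⊆ Finset.range rs.length) (hpend : ∀ j, 1 ≤ σ.nmem 1 j ↔ j ∈ P)
    (hserved : ∀ j < rs.length, (1 ≤ σ.nmem 8 j ↔ j ∈ S)) :
    Runs M rs Prog.removeLoop ((q + 1) * (1 + 1 + 2)) σ fun σ' =>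
      Same [1, 3] [] σ σ' ∧ σ'.out = σ.out ∧ ∀ j, 1 ≤ σ'.nmem 1 j ↔ j ∈ P \ S := by
  refine (Runs.fill (x := 1) (y := 0) (N := [1, 3]) (Q := [])
    (fun j m _ => 1 ≤ m ↔ j ∈ P \ S) (fun _ => σ.out) (by decide) (by decide)
    (fun _ => rfl) (by omega) rfl ?_).mono le_rfl fun σ' h => ⟨h.1, h.2.1, fun j => ?_⟩
  · intro k hk σ₁ hS₁ ho₁ hx hA
    have hcond : (Test.nle (.const 1) (.get 8 (.var 3))).Holds M rs σ₁ ↔ k ∈ S := by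
      simp only [Test.Holds, eval_const, eval_get, eval_natVar, hA, hS₁.nmem 8 (by decide),
        hserved k hk]
    refine Runs.ite (fun hc => Runs.setNat ?_) fun hc => Runs.skip ?_
    · refine ⟨hS₁.store_nmem (by decide) _ _, ho₁, ?_, ?_, fun j hj => ?_⟩
      · simpa [store_apply] using hA
      · simp [store_apply, hA, eval_natVar, eval_const, hcond.1 hc]
      · simp only [store_apply, hA, eval_natVar, if_true, Function.update_of_ne hj]
        exact ⟨trivial, trivial⟩
    · refine ⟨hS₁, ho₁, hA, ?_, fun j hj => ⟨rfl, rfl⟩⟩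
      -- The loop overwrites the array it depends on; `hx` says that entry k has not been changed
      -- before round k.
      rw [hx k le_rfl, hpend, Finset.mem_sdiff]
      exact ⟨fun h => ⟨h, hcond.not.1 hc⟩, fun h => h.1⟩
  · rcases lt_or_ge j rs.length with hj | hj
    · exact h.2.2.2 j hj
    · rw [h.2.2.1 j hj, hpend, Finset.mem_sdiff]
      have : j ∉ P := fun hjP => hj.not_gt (Finset.mem_range.1 (hP hjP))
      simp [this]

/-- The number of steps of `Prog.service`. -/
def serviceTime (q : ℕ) : ℕ :=
  1 + ((q + 1) * (5 * (q + 1) + (1 + 1 + 1) + 2) +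
    ((q + 1) * (5 * (q + 1) + (5 * (q + 1) + (1 + 1 + 1)) + 2) + (q + 1) * (1 + 1 + 2)))

theorem runs_service (hq : n + rs.length ≤ q) (hP : P ⊆ Finset.range rs.length)
    (hpend : ∀ j, 1 ≤ σ.nmem 1 j ↔ j ∈ P) (hplan : Planned M rs P σ) (hne : P.Nonempty) :
    Runs M rs Prog.service (serviceTime q) σ fun σ' =>
      Same [1, 3, 4, 7, 8] [0, 6] σ σ' ∧ σ'.out = (M.inst rs).service n P :: σ.out ∧
        ∀ j, 1 ≤ σ'.nmem 1 j ↔ j ∈ P \ (M.inst rs).served P ((M.inst rs).trig P) := by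
  have ht := hplan.trig hne
  refine (Runs.newService (Q := fun σ' => σ' =
    { σ with out := ⟨(M.inst rs).trig P, ∅, ∅⟩ :: σ.out }) ?_).seq fun σ₁ h₁ =>
    (runs_inclLoop (t := (M.inst rs).trig P) (out := σ.out) hq hP ?_ ?_ ?_).seq
      fun σ₂ ⟨hS₂, ho₂, h₂⟩ =>
    (runs_serveLoop hq hP ?_ h₂ ?_ ho₂).seq fun σ₃ ⟨hS₃, ho₃, h₃⟩ =>
    (runs_removeLoop hq hP ?_ h₃).mono le_rfl fun σ₄ ⟨hS₄, ho₄, h₄⟩ => ?_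
  · rw [eval_realVar, ht]
  · subst h₁
    exact ⟨hplan.mem_itemsOf, hplan.tau, hplan.nonempty, hplan.trig⟩
  · subst h₁; exact ht
  · subst h₁; rfl
  · subst h₁
    rw [hS₂.nmem 1 (by decide)]; exact hpend
  · subst h₁
    rw [hS₂.rmem 5 (by decide)]; exact ht
  · subst h₁
    rw [hS₃.nmem 1 (by decide), hS₂.nmem 1 (by decide)]; exact hpend
  · subst h₁
    refine ⟨((((Same.refl [1, 3, 4, 7, 8] [0, 6] σ).set_out _).trans
      (hS₂.mono (by decide) (by decide))).trans (hS₃.mono (by decide) (by decide))).trans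
      (hS₄.mono (by decide) (by decide)), ?_, h₄⟩
    rw [ho₄, ho₃]
    rfl

/-- The state of the machine represents the state `s` of the algorithm. -/
structure Represents (σ : State n) (s : Sim n) : Prop where
  k : σ.nmem 0 0 = s.k
  P : ∀ j, 1 ≤ σ.nmem 1 j ↔ j ∈ s.P
  out : σ.out = s.out

theorem runs_step (hq : n + rs.length ≤ q) {s : Sim n} (h : Represents σ s)
    (hP : s.P ⊆ Finset.range rs.length) :
    Runs M rs Prog.step (planTime q + (serviceTime q + 1 + 1)) σ fun σ' =>
      σ'.nmem 2 0 = σ.nmem 2 0 ∧ Represents σ' (s.step (M.inst rs) rs.length) := by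
  refine (runs_plan hq hP h.P).seq fun σ₁ ⟨hS₁, ho₁, hplan⟩ => ?_
  have hk₁ : σ₁.nmem 0 0 = s.k := by rw [hS₁.nmem 0 (by decide), h.k]
  have hP₁ : ∀ j, 1 ≤ σ₁.nmem 1 j ↔ j ∈ s.P := by rw [hS₁.nmem 1 (by decide)]; exact h.P
  have h2 : σ₁.nmem 2 0 = σ.nmem 2 0 := by rw [hS₁.nmem 2 (by decide)]
  -- The time in real register 5 is meaningful only if the flag in register 9 is set, so the test
  -- consults the flag first.
  have hcond : (Test.and (.neg (.nle .numRequests (.var 0)))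
      (.neg (.and (.nle (.const 1) (.var 9))
        (.neg (.rle (.atom (.arrival (.var 0))) (.var 5)))))).Holds M rs σ₁ ↔
      (s.k < rs.length ∧ (s.P = ∅ ∨ (M.inst rs).arr s.k ≤ (M.inst rs).trig s.P)) := by
    simp only [Test.Holds, eval_const, eval_numRequests, RExp.eval, eval_natVar, eval_realVar,
      eval_arrival, hk₁, hplan.nonempty, not_le, not_and, not_lt]
    refine and_congr_right fun _ => ⟨fun h => ?_, ?_⟩
    · rcases s.P.eq_empty_or_nonempty with hne | hne
      · exact Or.inl hne
      · exact Or.inr (hplan.trig hne ▸ h hne)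
    · rintro (h | h) hne
      · exact absurd h hne.ne_empty
      · rwa [hplan.trig hne]
  refine Runs.ite (fun hc => ((Runs.setNat (Q := fun σ' => σ' = _) rfl).seq fun σ₂ h₂ =>
    Runs.setNat ?_).mono (by unfold serviceTime; omega) fun _ h => h) fun hc =>
    Runs.ite (fun hc' => ?_) fun hc' => (Runs.skip ?_).mono (by unfold serviceTime; omega)
      fun _ h => h
  · subst h₂
    rw [Sim.step, if_pos (hcond.1 hc)]
    refine ⟨by simpa [store_apply] using h2, ⟨?_, fun j => ?_, ho₁.trans h.out⟩⟩
    · simp [store_apply, eval_natVar, eval_natAdd, eval_const, hk₁]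
    · simp only [store_apply, eval_natVar, eval_const, hk₁, if_true, Nat.reduceEqDiff, if_false,
        one_ne_zero, Finset.mem_insert]
      by_cases hj : j = s.k
      · subst hj; simp
      · rw [Function.update_of_ne hj, hP₁]
        simp [hj]
  · have hne : s.P.Nonempty := hplan.nonempty.1 hc'
    refine (runs_service hq hP hP₁ hplan hne).mono le_rfl fun σ₂ ⟨hS₂, ho₂, h₂⟩ => ?_
    rw [Sim.step, if_neg (hcond.not.1 hc), if_neg hne.ne_empty]
    refine ⟨by rw [hS₂.nmem 2 (by decide), h2], ⟨?_, h₂, ?_⟩⟩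
    · rw [hS₂.nmem 0 (by decide), hk₁]
    · rw [ho₂, ho₁, h.out]
  · have hemp : s.P = ∅ := by
      rw [← Finset.not_nonempty_iff_eq_empty, ← hplan.nonempty]
      exact hc'
    rw [Sim.step, if_neg (hcond.not.1 hc), if_pos hemp]
    exact ⟨h2, hk₁, hP₁, ho₁.trans h.out⟩

theorem iterate_pending_subset (D : Inst) (R m : ℕ) :
    ((Sim.step D R)^[m] (Sim.init n)).P ⊆ Finset.range R := by
  induction m with
  | zero => exact Finset.empty_subset _
  | succ m ih =>
    rw [Function.iterate_succ_apply']
    rcases Sim.step_cases D R ((Sim.step D R)^[m] (Sim.init n)) with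
      ⟨h, _, e⟩ | ⟨_, _, e⟩ | ⟨_, _, e⟩ <;> rw [e]
    · exact Finset.insert_subset (Finset.mem_range.2 h) ih
    · exact Finset.sdiff_subset.trans ih
    · exact ih

theorem runs_replenish (M : Model n) (rs : List (Request n)) :
    Runs M rs Prog.replenish ((2 * (n + rs.length) + 1) *
        (planTime (n + rs.length) + (serviceTime (n + rs.length) + 1 + 1) + 2)) (State.init n)
      fun σ => σ.out = replenish n M rs := by
  refine (Runs.forLoop (B := 2 * rs.length) (fun m σ =>
    Represents σ ((Sim.step (M.inst rs) rs.length)^[m] (Sim.init n))) (fun σ' => ?_) (by omega)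
    ?_ ?_).mono le_rfl fun σ h => h.out
  · rw [eval_natAdd, eval_numRequests]; omega
  · refine ⟨?_, fun j => ?_, rfl⟩ <;> simp [store_apply, State.init, Sim.init]
  · intro m hm σ hσ hm'
    refine (runs_step le_rfl hσ (iterate_pending_subset _ _ _)).mono le_rfl fun σ' h => ?_
    refine ⟨h.1.trans hm', ?_⟩
    rw [Function.iterate_succ_apply']
    exact ⟨by simpa [store_apply] using h.2.k, by simpa [store_apply] using h.2.P, h.2.out⟩

end Correctness

theorem replenish_isPolynomialTime : IsPolynomialTime replenish := by
  -- There are at most 2q events, each handled by loops nested to depth two over at most q values,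
  -- with q = `n + rs.length`; hence a cubic bound with a generous constant.
  refine ⟨Prog.replenish, 1000 * (Polynomial.X + 1) ^ 3, fun n M rs _ => ?_⟩
  obtain ⟨T, σ, h1, h2, h3⟩ := runs_replenish M rs
  refine ⟨T, σ, h1, h2.trans ?_, h3⟩
  simp only [Polynomial.eval_mul, Polynomial.eval_pow, Polynomial.eval_add, Polynomial.eval_X,
    Polynomial.eval_one, Polynomial.eval_ofNat, planTime, serviceTime]
  generalize n + rs.length = q
  nlinarith [Nat.zero_le (q ^ 3), Nat.zero_le (q ^ 2), Nat.zero_le q]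

end

end JRP

/-- There is a 30-competitive deterministic polynomial-time online algorithm for the joint
replenishment problem with holding and backlog costs. -/
theorem theorem2 :
    ∃ A : JRP.Algorithm, JRP.IsOnline A ∧ JRP.IsPolynomialTime A ∧ JRP.IsCompetitive 30 A :=
  ⟨JRP.replenish, JRP.replenish_isOnline, JRP.replenish_isPolynomialTime,
    JRP.replenish_isCompetitive⟩
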